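/- Let $p>5$, $\gamma<0$ and $\omega>\gamma^2/4$, and consider the nonlinear Schrödinger equation with a repulsive Dirac delta potential at the origin, $$i\partial_t u+\partial_x^2u+\gamma\delta u+|u|^{p-1}u=0,\qquad u(0)=u_0,$$ where $H^1(\mathbb R)$-solutions are understood as functions $u\in C(I;H^1(\mathbb R))$ on an open time interval $I\ni 0$ that satisfy the equation in $H^{-1}(\mathbb R)$, the operator $-\partial_x^2-\gamma\delta$ being given by the form $\langle -\Delta_\gamma f,g\rangle=\int_{\mathbb R}\partial_xf\,\overline{\partial_xg}\,dx-\gamma f(0)\overline{g(0)}$. For $f\in H^1(\mathbb R)$ put $$M(f)=\|f\|_{L^2}^2,\qquad \|f\|_{\dot H^1_\gamma}^2=\|\partial_xf\|_{L^2}^2-\gamma|f(0)|^2,\qquad E_\gamma(f)=\tfrac12\|f\|_{\dot H^1_\gamma}^2-\tfrac1{p+1}\|f\|_{L^{p+1}}^{p+1},$$ $$K_\gamma(f)=\|\partial_xf\|_{L^2}^2-\tfrac{\gamma}{2}|f(0)|^2-\tfrac{p-1}{2(p+1)}\|f\|_{L^{p+1}}^{p+1},\qquad \mu(f)=\|Q_{\omega,\gamma}\|_{\dot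 H^1_\gamma}^2-\|f\|_{\dot H^1_\gamma}^2,$$ where $$Q_{\omega,\gamma}(x)=\Bigl[\tfrac{(p+1)\omega}{2}\operatorname{sech}^2\Bigl\{\tfrac{(p-1)\sqrt\omega}{2}|x|+\tanh^{-1}\Bigl(\tfrac{\gamma}{2\sqrt\omega}\Bigr)\Bigr\}\Bigr]^{\frac1{p-1}}.$$ Let $u_0\in H^1(\mathbb R)$ be even with $M(u_0)=M(Q_{\omega,\gamma})$ and $E_\gamma(u_0)=E_\gamma(Q_{\omega,\gamma})$, and let $u$ be the solution with $u(0)=u_0$ on its maximal interval of existence $I$. 1. If $K_\gamma(u_0)>0$, then $u$ is global ($I=\mathbb R$), and there is a constant $c>0$, depending only on $u_0$ and the parameters $p,\gamma,\omega$ of the problem, such that $K_\gamma(u(t))\ge c\,\mu(u(t))>0$ for all $t\in\mathbb R$. 2. If $K_\gamma(u_0)<0$, then there is such a constant $c>0$ with $K_\gamma(u(t))\le c\,\mu(u(t))<0$ for all $t\in I$. -/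

import Mathlib

open MeasureTheory Filter Topology
open scoped ComplexConjugate

noncomputable section

namespace DeltaNLS

/-- `f` is (the continuous representative of) an element of `H¹(ℝ)`: it lies in `L²`, it is
locally absolutely continuous (it is the integral of its almost everywhere derivative), and that
derivative, which is its weak derivative, lies in `L²`. For such `f`, the term `deriv f` is
`∂ₓ f` almost everywhere. -/
structure MemH1 (f : ℝ → ℂ) : Prop where
  memLp : MemLp f 2 volume
  memLp_deriv : MemLp (deriv f) 2 volume
  integral_deriv : ∀ a b : ℝ, ∫ x in a..b, deriv f x = f b - f a

/-- `f` is an element of `H¹_even(ℝ)`. -/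
def MemH1Even (f : ℝ → ℂ) : Prop :=
  MemH1 f ∧ ∀ x, f (-x) = f x

/-- The squared norm `‖f‖²` in `H¹(ℝ)`. -/
def h1NormSq (f : ℝ → ℂ) : ℝ :=
  (∫ x, ‖f x‖ ^ 2) + ∫ x, ‖deriv f x‖ ^ 2

/-- The mass `M(f) = ‖f‖²` in `L²`. -/
def mass (f : ℝ → ℂ) : ℝ :=
  ∫ x, ‖f x‖ ^ 2

/-- `‖f‖²` in `Ḣ¹_γ`, that is `‖∂ₓ f‖² - γ |f(0)|²`. -/
def hdotNormSq (γ : ℝ) (f : ℝ → ℂ) : ℝ :=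
  (∫ x, ‖deriv f x‖ ^ 2) - γ * ‖f 0‖ ^ 2

/-- `‖f‖_{L^{p+1}}^{p+1}`. -/
def lpPow (p : ℝ) (f : ℝ → ℂ) : ℝ :=
  ∫ x, ‖f x‖ ^ (p + 1)

/-- The energy `E_γ`. -/
def energy (p γ : ℝ) (f : ℝ → ℂ) : ℝ :=
  1 / 2 * hdotNormSq γ f - 1 / (p + 1) * lpPow p f

/-- The virial functional `K_γ`. -/
def virial (p γ : ℝ) (f : ℝ → ℂ) : ℝ :=
  (∫ x, ‖deriv f x‖ ^ 2) + (-γ) / 2 * ‖f 0‖ ^ 2 - (p - 1) / (2 * (p + 1)) * lpPow p f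

/-- The ground state
`Q_{ω,γ}(x) = [((p+1)ω/2) sech²{((p-1)√ω/2)|x| + artanh(γ/(2√ω))}]^{1/(p-1)}`. -/
def groundState (p ω γ : ℝ) (x : ℝ) : ℂ :=
  (((p + 1) * ω / 2 *
    (1 / Real.cosh ((p - 1) * √ω / 2 * |x| + Real.artanh (γ / (2 * √ω)))) ^ 2) ^ (1 / (p - 1)) : ℝ)

/-- `μ(f) = ‖Q_{ω,γ}‖² - ‖f‖²`, with the norms of `Ḣ¹_γ`. -/
def mu (p ω γ : ℝ) (f : ℝ → ℂ) : ℝ :=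
  hdotNormSq γ (groundState p ω γ) - hdotNormSq γ f

/-- The mass-energy condition. -/
def MassEnergy (p ω γ : ℝ) (f : ℝ → ℂ) : Prop :=
  mass f = mass (groundState p ω γ) ∧ energy p γ f = energy p γ (groundState p ω γ)

/-- The sesquilinear form `⟨-Δ_γ f, g⟩ = ∫ ∂ₓf conj(∂ₓg) - γ f(0) conj(g(0))` on `H¹(ℝ)`. -/
def form (γ : ℝ) (f g : ℝ → ℂ) : ℂ :=
  (∫ x, deriv f x * conj (deriv g x)) - γ * (f 0 * conj (g 0))

/-- The nonlinearity `|z|^{p-1} z`. -/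
def nonlin (p : ℝ) (z : ℂ) : ℂ :=
  ((‖z‖ ^ (p - 1) : ℝ) : ℂ) * z

/-- `u` is an `H¹` solution of `i ∂ₜu + ∂ₓ²u + γ δ u + |u|^{p-1}u = 0`, `u(0) = u₀`, on the open
time interval `I ∋ 0`: it belongs to `C(I; H¹(ℝ))`, and the equation
`∂ₜu = i (Δ_γ u + |u|^{p-1}u)` holds in `H⁻¹(ℝ)`, i.e. tested against every `φ ∈ H¹(ℝ)`.
The values of `u` outside `I` play no role. -/
structure IsSolution (p γ : ℝ) (u₀ : ℝ → ℂ) (I : Set ℝ) (u : ℝ → ℝ → ℂ) : Prop where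
  isOpen : IsOpen I
  ordConnected : I.OrdConnected
  zero_mem : 0 ∈ I
  initial : u 0 = u₀
  memH1 : ∀ t ∈ I, MemH1 (u t)
  continuous : ∀ t ∈ I, Tendsto (fun s => h1NormSq (fun x => u s x - u t x)) (𝓝 t) (𝓝 0)
  equation : ∀ φ : ℝ → ℂ, MemH1 φ → ∀ t ∈ I,
    HasDerivAt (fun s => ∫ x, u s x * conj (φ x))
      (Complex.I * (-form γ (u t) φ + ∫ x, nonlin p (u t x) * conj (φ x))) t

/-- `u` is the solution on its maximal interval of existence `I`: it has no extension to a
solution on a larger interval. -/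
def IsMaximalSolution (p γ : ℝ) (u₀ : ℝ → ℂ) (I : Set ℝ) (u : ℝ → ℝ → ℂ) : Prop :=
  IsSolution p γ u₀ I u ∧
    ∀ (J : Set ℝ) (v : ℝ → ℝ → ℂ), IsSolution p γ u₀ J v → I ⊆ J →
      (∀ t ∈ I, v t = u t) → J = I

end DeltaNLS

end

open MeasureTheory Filter Topology
open scoped ComplexConjugate

noncomputable section

namespace DeltaNLS

/-! Write `N(f) = ‖f‖²_{Ḣ¹_γ} + ω M(f)` (`formNormSq`), `L` for `lpPow`, `K` for `virial` and `Q`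
for the ground state. On the mass-energy level of `Q` the single number `w = L(f) / N(Q)` determines
`N(f)`, and `μ(f)` is a positive multiple of `1 - w`. Two things are needed: `K` has the sign of `1
- w`, quantitatively, and this sign cannot change in time.

The first rests on the sharp inequality `L(f) N(Q)^((p-1)/2) ≤ N(f)^((p+1)/2)` for even `f`
(`lpPow_mul_le`). Below the peak height of `Q`, the action density dominates the derivative of a
function of `|f|²` (`abs_calib_sub_le`), with equality along `Q`. An even `f` with the same peak
height as `Q` pays, on each half-line, for the way from `f(0)` to the peak and from there down to
zero; concavity of the calibration absorbs the delta term (`action_groundState_le`). Scaling and the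
weighted inequality between geometric and arithmetic means remove the normalization of the peak.
Applied to mass-preserving dilations of `f`, the inequality makes `K` appear in the coefficient of
the dilation parameter (`dilated_ineq`), and a good choice of that parameter bounds `K` by a
multiple of `μ` (`exists_virial_coercive`).

For the second, suppose that `μ` vanishes at some time. Then `u` is at that time an optimizer of the
sharp inequality, so it solves the stationary equation (`eq_of_optimizer`), and by uniqueness the
whole solution is a standing wave with `K = 0` (`IsFlow.virial_eq_zero`). This contradicts `K(u₀) ≠
0`; no classification of the optimizers is needed. So `μ` keeps its sign by continuity. If it is
positive it bounds the energy norm, and a bounded maximal solution is global (`eq_univ_of_bounded`).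

The Cauchy theory is built on `H¹` with the inner product of `1 - Δ_γ`, whose inverse is
`resolvent`. Conjugation by `exp(-it(1 - Δ_γ))` turns the equation into an ordinary differential
equation with a locally Lipschitz field. This yields uniqueness, local existence on a time
controlled by the norm, and conservation of mass, energy and evenness. -/

/-! ### Locally absolutely continuous functions -/

section Primitive

variable {E F : Type*} [NormedAddCommGroup E] [NormedSpace ℝ E] [NormedAddCommGroup F]
  [NormedSpace ℝ F]

/-- `f` is a primitive of the locally integrable function `w`. -/
structure IsPrimitive (f w : ℝ → E) : Prop where
  locallyIntegrable : LocallyIntegrable w volume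
  integral_eq : ∀ a b : ℝ, ∫ x in a..b, w x = f b - f a

lemma intervalIntegrable_of_locallyIntegrable {E : Type*} [NormedAddCommGroup E]
    {w : ℝ → E} (hw : LocallyIntegrable w volume)
    (a b : ℝ) : IntervalIntegrable w volume a b :=
  intervalIntegrable_iff.mpr <|
    (hw.integrableOn_isCompact isCompact_uIcc).mono_set Set.uIoc_subset_uIcc

lemma IsPrimitive.intervalIntegrable {f w : ℝ → E} (h : IsPrimitive f w) (a b : ℝ) :
    IntervalIntegrable w volume a b :=
  intervalIntegrable_of_locallyIntegrable h.locallyIntegrable a b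

lemma IsPrimitive.eq_add {f w : ℝ → E} (h : IsPrimitive f w) (a : ℝ) :
    f = fun x => f a + ∫ t in a..x, w t := by
  funext x
  rw [h.integral_eq]
  abel

lemma IsPrimitive.continuous {f w : ℝ → E} (h : IsPrimitive f w) : Continuous f := by
  rw [h.eq_add 0]
  exact continuous_const.add
    (intervalIntegral.continuous_primitive (fun a b => h.intervalIntegrable a b) 0)

lemma IsPrimitive.ae_hasDerivAt [CompleteSpace E] {f w : ℝ → E} (h : IsPrimitive f w) :
    ∀ᵐ x, HasDerivAt f (w x) x := by
  filter_upwards [LocallyIntegrable.ae_hasDerivAt_integral h.locallyIntegrable] with x hx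
  rw [h.eq_add 0]
  exact (hx 0).const_add _

lemma IsPrimitive.deriv_ae_eq [CompleteSpace E] {f w : ℝ → E} (h : IsPrimitive f w) :
    deriv f =ᵐ[volume] w := by
  filter_upwards [h.ae_hasDerivAt] with x hx using hx.deriv

lemma absolutelyContinuousOnInterval_of_dist_le {X Y : Type*} [PseudoMetricSpace X]
    [PseudoMetricSpace Y] {f : ℝ → X} {g : ℝ → Y} {a b K : ℝ}
    (hg : AbsolutelyContinuousOnInterval g a b)
    (h : ∀ x ∈ Set.uIcc a b, ∀ y ∈ Set.uIcc a b, dist (f x) (f y) ≤ K * dist (g x) (g y)) :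
    AbsolutelyContinuousOnInterval f a b := by
  have h0 := Tendsto.const_mul K hg
  rw [mul_zero] at h0
  refine squeeze_zero' (Eventually.of_forall fun E => Finset.sum_nonneg fun i _ => dist_nonneg)
    ?_ h0
  have : ∀ᶠ E in AbsolutelyContinuousOnInterval.totalLengthFilter ⊓
      𝓟 (AbsolutelyContinuousOnInterval.disjWithin a b),
      E ∈ AbsolutelyContinuousOnInterval.disjWithin a b :=
    eventually_inf_principal.mpr (Eventually.of_forall fun _ h => h)
  filter_upwards [this] with E hE
  rw [Finset.mul_sum]
  exact Finset.sum_le_sum fun i hi => h _ (hE.1 i hi).1 _ (hE.1 i hi).2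

lemma IsPrimitive.absolutelyContinuousOnInterval {f w : ℝ → E} (h : IsPrimitive f w)
    (a b : ℝ) : AbsolutelyContinuousOnInterval f a b := by
  have hi := (h.intervalIntegrable a b).norm
  refine absolutelyContinuousOnInterval_of_dist_le (K := 1)
    (hi.absolutelyContinuousOnInterval_intervalIntegral (c := a) Set.left_mem_uIcc) ?_
  intro x _ y _
  rw [one_mul, dist_comm, dist_eq_norm, ← h.integral_eq, dist_comm, Real.dist_eq,
    intervalIntegral.integral_interval_sub_left
      ((h.intervalIntegrable a y).norm) ((h.intervalIntegrable a x).norm)]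
  exact intervalIntegral.norm_integral_le_abs_integral_norm

/-- The chain rule for the composition of a `C¹` map with a locally absolutely continuous
function. -/
lemma IsPrimitive.comp_contDiff [FiniteDimensional ℝ E] [CompleteSpace F] {f w : ℝ → E}
    (h : IsPrimitive f w) {G : E → F} (hG : ContDiff ℝ 1 G) :
    IsPrimitive (fun x => G (f x)) (fun x => fderiv ℝ G (f x) (w x)) := by
  have : CompleteSpace E := FiniteDimensional.complete ℝ E
  have hGc : Continuous fun x => fderiv ℝ G (f x) :=
    (hG.continuous_fderiv one_ne_zero).comp h.continuous
  have hloc : LocallyIntegrable (fun x => fderiv ℝ G (f x) (w x)) volume := by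
    rw [locallyIntegrable_iff]
    intro k hk
    obtain ⟨C, hC⟩ := hk.exists_bound_of_continuousOn hGc.continuousOn
    have hwk := h.locallyIntegrable.integrableOn_isCompact hk
    refine Integrable.mono' (hwk.norm.const_mul C) ?_ ?_
    · have h1 := hGc.aestronglyMeasurable (μ := volume.restrict k)
      exact isBoundedBilinearMap_apply.continuous.comp_aestronglyMeasurable₂ h1
        hwk.aestronglyMeasurable
    · filter_upwards [ae_restrict_mem hk.measurableSet] with x hx
      exact (ContinuousLinearMap.le_opNorm _ _).trans (by gcongr; exact hC x hx)
  refine ⟨hloc, fun a b => ?_⟩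
  have hint := intervalIntegrable_of_locallyIntegrable hloc
  have hprim : IsPrimitive (fun x => ∫ t in a..x, fderiv ℝ G (f t) (w t))
      (fun x => fderiv ℝ G (f x) (w x)) :=
    ⟨hloc, fun c d => (intervalIntegral.integral_interval_sub_left (hint a d) (hint a c)).symm⟩
  -- Both functions are absolutely continuous with the same derivative almost everywhere, so their
  -- difference is constant.
  have hac1 := hprim.absolutelyContinuousOnInterval a b
  have hac2 : AbsolutelyContinuousOnInterval (fun x => G (f x)) a b := by
    obtain ⟨K, hK⟩ : ∃ K : NNReal, LipschitzOnWith K G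
        (Metric.closedBall 0 (Classical.choose
          ((h.absolutelyContinuousOnInterval a b).exists_bound))) :=
      hG.contDiffOn.exists_lipschitzOnWith one_ne_zero (convex_closedBall _ _)
        (isCompact_closedBall _ _)
    have hb := Classical.choose_spec ((h.absolutelyContinuousOnInterval a b).exists_bound)
    refine absolutelyContinuousOnInterval_of_dist_le (K := K)
      (h.absolutelyContinuousOnInterval a b) fun x hx y hy => ?_
    exact hK.dist_le_mul _ (by simpa using hb x hx) _ (by simpa using hb y hy)
  obtain ⟨C, hC⟩ := (hac2.sub hac1).const_of_ae_hasDerivAt_zero (by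
    filter_upwards [h.ae_hasDerivAt, hprim.ae_hasDerivAt] with x hx hx' _
    have h1 : HasFDerivAt G (fderiv ℝ G (f x)) (f x) :=
      (hG.differentiable one_ne_zero).differentiableAt.hasFDerivAt
    have := (h1.comp_hasDerivAt x hx).sub hx'
    rwa [sub_self] at this)
  have ha := hC a Set.left_mem_uIcc
  have hb := hC b Set.right_mem_uIcc
  simp only [Pi.sub_apply, intervalIntegral.integral_same, sub_zero] at ha hb
  rw [ha, ← hb]
  abel

end Primitive

/-! ### Functions in `H¹(ℝ)` -/

lemma MemH1.isPrimitive {f : ℝ → ℂ} (hf : MemH1 f) : IsPrimitive f (deriv f) :=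
  ⟨hf.memLp_deriv.locallyIntegrable one_le_two, hf.integral_deriv⟩

lemma MemH1.continuous' {f : ℝ → ℂ} (hf : MemH1 f) : Continuous f :=
  hf.isPrimitive.continuous

/-- `MemH1` refers to `deriv f`; sums, compositions and limits only produce some almost everywhere
representative `w` of it. -/
lemma IsPrimitive.memH1 {f w : ℝ → ℂ} (h : IsPrimitive f w) (hf : MemLp f 2 volume)
    (hw : MemLp w 2 volume) : MemH1 f where
  memLp := hf
  memLp_deriv := (memLp_congr_ae h.deriv_ae_eq).mpr hw
  integral_deriv a b := by
    rw [← h.integral_eq]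
    exact intervalIntegral.integral_congr_ae (h.deriv_ae_eq.mono fun x hx _ => hx)

lemma IsPrimitive.add {E : Type*} [NormedAddCommGroup E] [NormedSpace ℝ E] {f w g z : ℝ → E}
    (hf : IsPrimitive f w) (hg : IsPrimitive g z) :
    IsPrimitive (fun x => f x + g x) (fun x => w x + z x) := by
  refine ⟨hf.locallyIntegrable.add hg.locallyIntegrable, fun a b => ?_⟩
  rw [intervalIntegral.integral_add (hf.intervalIntegrable a b) (hg.intervalIntegrable a b),
    hf.integral_eq, hg.integral_eq]
  abel

lemma IsPrimitive.const_mul {f w : ℝ → ℂ} (hf : IsPrimitive f w) (c : ℂ) :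
    IsPrimitive (fun x => c * f x) (fun x => c * w x) := by
  refine ⟨hf.locallyIntegrable.smul c, fun a b => ?_⟩
  rw [intervalIntegral.integral_const_mul, hf.integral_eq]
  ring

lemma MemH1.add {f g : ℝ → ℂ} (hf : MemH1 f) (hg : MemH1 g) : MemH1 (fun x => f x + g x) :=
  (hf.isPrimitive.add hg.isPrimitive).memH1 (hf.memLp.add hg.memLp)
    (hf.memLp_deriv.add hg.memLp_deriv)

lemma MemH1.const_mul {f : ℝ → ℂ} (hf : MemH1 f) (c : ℂ) : MemH1 (fun x => c * f x) :=
  (hf.isPrimitive.const_mul c).memH1 (hf.memLp.const_mul c) (hf.memLp_deriv.const_mul c)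

lemma MemH1.deriv_add {f g : ℝ → ℂ} (hf : MemH1 f) (hg : MemH1 g) :
    deriv (fun x => f x + g x) =ᵐ[volume] fun x => deriv f x + deriv g x :=
  (hf.isPrimitive.add hg.isPrimitive).deriv_ae_eq

lemma MemH1.deriv_const_mul {f : ℝ → ℂ} (hf : MemH1 f) (c : ℂ) :
    deriv (fun x => c * f x) =ᵐ[volume] fun x => c * deriv f x :=
  (hf.isPrimitive.const_mul c).deriv_ae_eq

lemma memH1_zero : MemH1 (fun _ => 0) := by
  refine ⟨MemLp.zero', ?_, ?_⟩ <;> simp [deriv_const']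

lemma integrable_norm_sq {f : ℝ → ℂ} (hf : MemLp f 2 volume) :
    Integrable fun x => ‖f x‖ ^ 2 := by
  simpa using hf.integrable_norm_pow two_ne_zero

lemma MemH1.integrable_sq {f : ℝ → ℂ} (hf : MemH1 f) : Integrable fun x => ‖f x‖ ^ 2 :=
  integrable_norm_sq hf.memLp

lemma MemH1.integrable_deriv_sq {f : ℝ → ℂ} (hf : MemH1 f) :
    Integrable fun x => ‖deriv f x‖ ^ 2 :=
  integrable_norm_sq hf.memLp_deriv

/-- The local Sobolev inequality on a unit interval. -/
lemma MemH1.norm_sq_le_integral {f : ℝ → ℂ} (hf : MemH1 f) (x : ℝ) :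
    ‖f x‖ ^ 2 ≤ 2 * ∫ y in Set.Ioc x (x + 1), (‖f y‖ ^ 2 + ‖deriv f y‖ ^ 2) := by
  set s := Set.Ioc x (x + 1)
  have hvol : (volume.restrict s).real Set.univ = 1 := by simp [s, Measure.real]
  have : IsProbabilityMeasure (volume.restrict s) := ⟨by simp [s]⟩
  have h1 : MemLp f 2 (volume.restrict s) := hf.memLp.restrict s
  have h2 : MemLp (deriv f) 2 (volume.restrict s) := hf.memLp_deriv.restrict s
  set D := ∫ y in s, ‖deriv f y‖
  have hD : ∀ y ∈ s, ‖f x‖ ≤ ‖f y‖ + D := by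
    intro y hy
    have e : f x = f y - ∫ t in x..y, deriv f t := by rw [hf.integral_deriv]; ring
    rw [e]
    refine (norm_sub_le _ _).trans ?_
    gcongr
    refine (intervalIntegral.norm_integral_le_integral_norm hy.1.le).trans ?_
    rw [intervalIntegral.integral_of_le hy.1.le]
    exact setIntegral_mono_set (h2.integrable one_le_two).norm
      (Eventually.of_forall fun _ => norm_nonneg _)
      (Set.Ioc_subset_Ioc_right hy.2).eventuallyLE
  have hDsq : D ^ 2 ≤ ∫ y in s, ‖deriv f y‖ ^ 2 := by
    have := ConvexOn.map_integral_le (μ := volume.restrict s) (g := fun z : ℝ => z ^ 2)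
      (f := fun y => ‖deriv f y‖) (s := Set.univ) (even_two.convexOn_pow)
      (by fun_prop) isClosed_univ (by simp) (h2.integrable one_le_two).norm
      (by simpa using! h2.integrable_norm_pow two_ne_zero)
    simpa using! this
  have i1 : Integrable (fun y => ‖f y‖ ^ 2) (volume.restrict s) := hf.integrable_sq.restrict
  have i2 : Integrable (fun y => ‖deriv f y‖ ^ 2) (volume.restrict s) :=
    hf.integrable_deriv_sq.restrict
  -- The pointwise bound is averaged over an interval of length one; Jensen's inequality controls `D
  -- ^ 2`.
  have key : ∫ _ in s, ‖f x‖ ^ 2 ≤ ∫ y in s, (2 * ‖f y‖ ^ 2 + 2 * D ^ 2) := by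
    refine setIntegral_mono_on (integrable_const _) ((i1.const_mul 2).add (integrable_const _))
      measurableSet_Ioc fun y hy => ?_
    have h0 := hD y hy
    nlinarith [norm_nonneg (f x), sq_nonneg (‖f y‖ - D)]
  rw [integral_add (i1.const_mul 2) (integrable_const _), integral_const_mul, integral_const,
    integral_const, hvol] at key
  rw [integral_add i1 i2]
  simp only [smul_eq_mul, one_mul] at key
  linarith

lemma MemH1.norm_sq_le {f : ℝ → ℂ} (hf : MemH1 f) (x : ℝ) : ‖f x‖ ^ 2 ≤ 2 * h1NormSq f := by
  refine (hf.norm_sq_le_integral x).trans ?_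
  rw [h1NormSq, ← integral_add hf.integrable_sq hf.integrable_deriv_sq]
  gcongr
  · exact Eventually.of_forall fun y => by positivity
  · exact hf.integrable_sq.add hf.integrable_deriv_sq
  · exact Measure.restrict_le_self

lemma h1NormSq_nonneg (f : ℝ → ℂ) : 0 ≤ h1NormSq f := by
  unfold h1NormSq
  positivity

/-- The local Sobolev bound is an integral over `(x, x + 1]`, the difference of two integrals with
the same limit. -/
lemma MemH1.tendsto_atTop {f : ℝ → ℂ} (hf : MemH1 f) : Tendsto f atTop (𝓝 0) := by
  have hi := hf.integrable_sq.add hf.integrable_deriv_sq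
  have h1 : Tendsto (fun x : ℝ => ∫ y in Set.Ioc x (x + 1),
      (‖f y‖ ^ 2 + ‖deriv f y‖ ^ 2)) atTop (𝓝 0) := by
    have h2 := intervalIntegral_tendsto_integral_Ioi 0 hi.integrableOn tendsto_id
    have h3 := intervalIntegral_tendsto_integral_Ioi 0 hi.integrableOn
      (tendsto_atTop_add_const_right atTop (1 : ℝ) tendsto_id)
    have h4 := h3.sub h2
    rw [sub_self] at h4
    refine h4.congr fun x => ?_
    rw [intervalIntegral.integral_interval_sub_left hi.intervalIntegrable hi.intervalIntegrable,
      intervalIntegral.integral_of_le (by simp)]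
    rfl
  rw [tendsto_zero_iff_norm_tendsto_zero]
  have h5 : Tendsto (fun x => ‖f x‖ ^ 2) atTop (𝓝 0) := by
    refine squeeze_zero (fun x => by positivity) hf.norm_sq_le_integral ?_
    simpa using h1.const_mul 2
  have h6 := (Real.continuous_sqrt.tendsto 0).comp h5
  simpa [Function.comp_def] using h6

/-! ### The unitary group generated by the inverse of an injective self-adjoint operator -/

section Group

variable {V : Type*} [NormedAddCommGroup V] [InnerProductSpace ℂ V] [CompleteSpace V]

/-- The function `x ↦ x exp (-it/x)` of the real part. -/
def groupSymbol (t : ℝ) (z : ℂ) : ℂ :=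
  z.re * Complex.exp (-Complex.I * (t / z.re : ℝ))

lemma norm_exp_neg_I_mul (y : ℝ) : ‖Complex.exp (-Complex.I * (y : ℂ))‖ = 1 := by
  rw [show -Complex.I * (y : ℂ) = ((-y : ℝ) : ℂ) * Complex.I by push_cast; ring,
    Complex.norm_exp_ofReal_mul_I]

lemma norm_groupSymbol (t : ℝ) (z : ℂ) : ‖groupSymbol t z‖ = |z.re| := by
  rw [groupSymbol, norm_mul, norm_exp_neg_I_mul, mul_one, Complex.norm_real, Real.norm_eq_abs]

/-- The factor `z.re` damps the oscillation of the exponential at `z.re = 0`. This is why `R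
exp(-itR⁻¹)`, and not `exp(-itR⁻¹)`, comes from the continuous functional calculus. -/
lemma continuous_groupSymbol (t : ℝ) : Continuous (groupSymbol t) := by
  rw [continuous_iff_continuousAt]
  intro z
  by_cases hz : z.re = 0
  · have h0 : groupSymbol t z = 0 := by simp [groupSymbol, hz]
    rw [ContinuousAt, h0, tendsto_zero_iff_norm_tendsto_zero]
    simp only [norm_groupSymbol]
    have : Continuous fun z : ℂ => |z.re| := Complex.continuous_re.abs
    simpa [hz] using this.tendsto z
  · unfold groupSymbol
    have : ContinuousAt (fun z : ℂ => t / z.re) z :=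
      continuousAt_const.div Complex.continuous_re.continuousAt hz
    fun_prop

lemma groupSymbol_mul (s t : ℝ) (z : ℂ) :
    groupSymbol s z * groupSymbol t z = groupSymbol (s + t) z * groupSymbol 0 z := by
  simp only [groupSymbol, zero_div, Complex.ofReal_zero, mul_zero, Complex.exp_zero, mul_one,
    add_div, Complex.ofReal_add, mul_add, Complex.exp_add]
  ring

lemma star_groupSymbol (t : ℝ) (z : ℂ) : star (groupSymbol t z) = groupSymbol (-t) z := by
  simp only [groupSymbol, star_mul', RCLike.star_def, ← Complex.exp_conj, map_mul, map_neg,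
    Complex.conj_I, Complex.conj_ofReal]
  congr 2
  push_cast
  ring

/-- Taylor's formula for `|y| ≤ 1`; otherwise the trivial bound `2 + |y|` is at most `3 y²`. -/
lemma norm_exp_sub_le (y : ℝ) :
    ‖Complex.exp (-Complex.I * (y : ℂ)) - 1 - (-Complex.I * (y : ℂ))‖ ≤ 3 * y ^ 2 := by
  have hn : ‖-Complex.I * (y : ℂ)‖ = |y| := by simp
  by_cases hy : |y| ≤ 1
  · have := Complex.norm_exp_sub_one_sub_id_le (x := -Complex.I * (y : ℂ)) (by rwa [hn])
    rw [hn, sq_abs] at this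
    nlinarith [sq_nonneg y]
  · push Not at hy
    refine (norm_sub_le _ _).trans ?_
    have h1 := norm_sub_le (Complex.exp (-Complex.I * (y : ℂ))) 1
    rw [norm_exp_neg_I_mul, norm_one] at h1
    rw [hn, ← sq_abs y]
    nlinarith

/-- The Taylor remainder at `s / x` costs `s² / x²` and is multiplied by `x²`, so the bound is
uniform in `z`. Hence `R² exp(-itR⁻¹)` is differentiable in operator norm. -/
lemma norm_groupSymbol_sub_le (t s : ℝ) (z : ℂ) :
    ‖groupSymbol (t + s) z * groupSymbol 0 z - groupSymbol t z * groupSymbol 0 z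
      - (s : ℂ) * (-Complex.I * groupSymbol t z)‖ ≤ 3 * s ^ 2 := by
  by_cases hz : z.re = 0
  · simp [groupSymbol, hz]
    positivity
  · have e : groupSymbol (t + s) z * groupSymbol 0 z - groupSymbol t z * groupSymbol 0 z
        - (s : ℂ) * (-Complex.I * groupSymbol t z)
        = groupSymbol t z * (z.re : ℂ) * (Complex.exp (-Complex.I * ((s / z.re : ℝ) : ℂ)) - 1
          - (-Complex.I * ((s / z.re : ℝ) : ℂ))) := by
      have hz' : (z.re : ℂ) ≠ 0 := by exact_mod_cast hz
      simp only [groupSymbol, zero_div, Complex.ofReal_zero, mul_zero, Complex.exp_zero, mul_one,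
        add_div, Complex.ofReal_add, mul_add, Complex.exp_add]
      push_cast
      field_simp
    rw [e, norm_mul, norm_mul, norm_groupSymbol, Complex.norm_real, Real.norm_eq_abs]
    refine (mul_le_mul_of_nonneg_left (norm_exp_sub_le _) (by positivity)).trans (le_of_eq ?_)
    rw [abs_mul_abs_self]
    field_simp

variable (R : V →L[ℂ] V)

/-- The operator `R exp (-itR⁻¹)`. -/
def smoothGroup (t : ℝ) : V →L[ℂ] V := cfc (groupSymbol t) R

/-- The operator `exp (-itR⁻¹)`. -/
def unitaryGroup (t : ℝ) : V →L[ℂ] V :=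
  (smoothGroup R t).toLinearMap.extendOfNorm R.toLinearMap

variable {R}

lemma star_smoothGroup (t : ℝ) : star (smoothGroup R t) = smoothGroup R (-t) := by
  rw [smoothGroup, ← cfc_star]
  simp only [star_groupSymbol]
  rfl

variable (hR : IsSelfAdjoint R)

include hR

lemma smoothGroup_zero : smoothGroup R 0 = R := by
  have := hR.isStarNormal
  rw [smoothGroup]
  nth_rw 2 [← cfc_id ℂ R]
  refine cfc_congr fun z hz => ?_
  conv_rhs => rw [hR.mem_spectrum_eq_re hz]
  simp [groupSymbol]

lemma smoothGroup_mul (s t : ℝ) :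
    smoothGroup R s * smoothGroup R t = smoothGroup R (s + t) * R := by
  have := hR.isStarNormal
  nth_rw 4 [← smoothGroup_zero hR]
  simp only [smoothGroup]
  rw [← cfc_mul _ _ R (continuous_groupSymbol s).continuousOn (continuous_groupSymbol t).continuousOn,
    ← cfc_mul _ _ R (continuous_groupSymbol _).continuousOn (continuous_groupSymbol _).continuousOn]
  exact congrArg (fun f => cfc f R) (funext fun z => groupSymbol_mul s t z)

lemma smoothGroup_mul_comm (t : ℝ) : smoothGroup R t * R = R * smoothGroup R t := by
  nth_rw 2 [← smoothGroup_zero hR]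
  nth_rw 3 [← smoothGroup_zero hR]
  exact (cfc_commute_cfc _ _ R).eq

/-- The symbol has modulus `|x|`, so `T* T = R²` for `T = smoothGroup R t`. Thus `R x ↦ T x` is
isometric on the dense range of `R`, and its extension is `unitaryGroup`. -/
lemma norm_smoothGroup_apply (t : ℝ) (x : V) : ‖smoothGroup R t x‖ = ‖R x‖ := by
  have h1 : star (smoothGroup R t) * smoothGroup R t = star R * R := by
    rw [star_smoothGroup, smoothGroup_mul hR, neg_add_cancel, smoothGroup_zero hR, hR.star_eq]
  have h2 : ∀ T : V →L[ℂ] V, ‖T x‖ ^ 2 = RCLike.re (inner ℂ ((star T * T) x) x) := by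
    intro T
    rw [ContinuousLinearMap.star_eq_adjoint, mul_apply_eq_comp,
      ContinuousLinearMap.adjoint_inner_left, inner_self_eq_norm_sq]
  have h3 : ‖smoothGroup R t x‖ ^ 2 = ‖R x‖ ^ 2 := by rw [h2, h2, h1]
  exact (sq_eq_sq₀ (norm_nonneg _) (norm_nonneg _)).mp h3

lemma hasDerivAt_smoothGroup_mul (t : ℝ) :
    HasDerivAt (fun s => smoothGroup R s * R) (-Complex.I • smoothGroup R t) t := by
  have := hR.isStarNormal
  have hc := fun s => (continuous_groupSymbol s).continuousOn (s := spectrum ℂ R)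
  rw [hasDerivAt_iff_isLittleO_nhds_zero]
  have hb : ∀ s : ℝ, ‖smoothGroup R (t + s) * R - smoothGroup R t * R
      - s • (-Complex.I • smoothGroup R t)‖ ≤ 3 * ‖s ^ 2‖ := by
    intro s
    have e : smoothGroup R (t + s) * R - smoothGroup R t * R - s • (-Complex.I • smoothGroup R t)
        = cfc (fun z => groupSymbol (t + s) z * groupSymbol 0 z
          - groupSymbol t z * groupSymbol 0 z - (s : ℂ) * (-Complex.I * groupSymbol t z)) R := by
      nth_rw 2 [← smoothGroup_zero hR]
      nth_rw 4 [← smoothGroup_zero hR]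
      simp only [smoothGroup]
      have h1 : ContinuousOn (fun z => groupSymbol (t + s) z * groupSymbol 0 z) (spectrum ℂ R) :=
        (hc _).mul (hc _)
      have h2 : ContinuousOn (fun z => groupSymbol t z * groupSymbol 0 z) (spectrum ℂ R) :=
        (hc _).mul (hc _)
      have h3 : ContinuousOn (fun z => -Complex.I * groupSymbol t z) (spectrum ℂ R) :=
        continuousOn_const.mul (hc _)
      have h4 : ContinuousOn (fun z => (s : ℂ) * (-Complex.I * groupSymbol t z))
        (spectrum ℂ R) := continuousOn_const.mul h3
      have h5 : ContinuousOn (fun z => groupSymbol (t + s) z * groupSymbol 0 z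
        - groupSymbol t z * groupSymbol 0 z) (spectrum ℂ R) := h1.sub h2
      rw [cfc_sub _ _ R h5 h4, cfc_sub _ _ R h1 h2, cfc_mul _ _ R (hc _) (hc _),
        cfc_mul _ _ R (hc _) (hc _), cfc_const_mul _ _ R h3, cfc_const_mul _ _ R (hc _)]
      rfl
    rw [e, norm_pow, Real.norm_eq_abs, sq_abs]
    exact norm_cfc_le (by positivity) fun z _ => norm_groupSymbol_sub_le t s z
  refine (Asymptotics.IsBigO.of_bound 3 (Eventually.of_forall hb)).trans_isLittleO ?_
  simpa using Asymptotics.isLittleO_pow_id (𝕜 := ℝ) one_lt_two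

variable (hinj : Function.Injective R)

include hinj

lemma denseRange_of_injective : DenseRange R := by
  have h1 : R.rangeᗮ = ⊥ := by
    rw [ContinuousLinearMap.orthogonal_range, ← ContinuousLinearMap.star_eq_adjoint, hR.star_eq]
    exact LinearMap.ker_eq_bot.mpr hinj
  have h2 := (Submodule.topologicalClosure_eq_top_iff (K := R.range)).mpr h1
  have h3 : Dense (R.range : Set V) := (Submodule.dense_iff_topologicalClosure_eq_top).mpr h2
  simpa [DenseRange] using! h3

lemma unitaryGroup_apply (t : ℝ) (x : V) : unitaryGroup R t (R x) = smoothGroup R t x :=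
  LinearMap.extendOfNorm_eq (e := R.toLinearMap) (denseRange_of_injective hR hinj)
    ⟨1, fun y => by rw [one_mul]; exact (norm_smoothGroup_apply hR t y).le⟩ x

lemma norm_unitaryGroup (t : ℝ) (x : V) : ‖unitaryGroup R t x‖ = ‖x‖ := by
  refine (denseRange_of_injective hR hinj).induction_on
    (p := fun x => ‖unitaryGroup R t x‖ = ‖x‖) x (isClosed_eq (by fun_prop) (by fun_prop)) ?_
  intro y
  rw [unitaryGroup_apply hR hinj, norm_smoothGroup_apply hR]

lemma inner_unitaryGroup (t : ℝ) (x y : V) :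
    inner ℂ (unitaryGroup R t x) (unitaryGroup R t y) = inner ℂ x y :=
  LinearIsometry.inner_map_map ⟨(unitaryGroup R t).toLinearMap, norm_unitaryGroup hR hinj t⟩ x y

lemma map_unitaryGroup (t : ℝ) (x : V) : R (unitaryGroup R t x) = unitaryGroup R t (R x) := by
  refine (denseRange_of_injective hR hinj).induction_on
    (p := fun x => R (unitaryGroup R t x) = unitaryGroup R t (R x)) x
    (isClosed_eq (by fun_prop) (by fun_prop)) ?_
  intro y
  rw [unitaryGroup_apply hR hinj, unitaryGroup_apply hR hinj]
  exact (DFunLike.congr_fun (smoothGroup_mul_comm hR t) y).symm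

lemma unitaryGroup_add (s t : ℝ) (x : V) :
    unitaryGroup R s (unitaryGroup R t x) = unitaryGroup R (s + t) x := by
  have hd := denseRange_of_injective hR hinj
  refine (hd.comp hd R.continuous).induction_on
    (p := fun x => unitaryGroup R s (unitaryGroup R t x) = unitaryGroup R (s + t) x) x
    (isClosed_eq (by fun_prop) (by fun_prop)) ?_
  intro y
  simp only [Function.comp_apply]
  rw [← map_unitaryGroup hR hinj, unitaryGroup_apply hR hinj, unitaryGroup_apply hR hinj,
    unitaryGroup_apply hR hinj]
  exact DFunLike.congr_fun (smoothGroup_mul hR s t) y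

lemma unitaryGroup_zero (x : V) : unitaryGroup R 0 x = x := by
  refine (denseRange_of_injective hR hinj).induction_on
    (p := fun x => unitaryGroup R 0 x = x) x (isClosed_eq (by fun_prop) (by fun_prop)) ?_
  intro y
  rw [unitaryGroup_apply hR hinj, smoothGroup_zero hR]

lemma unitaryGroup_apply_neg (t : ℝ) (x : V) :
    unitaryGroup R t (unitaryGroup R (-t) x) = x := by
  rw [unitaryGroup_add hR hinj, add_neg_cancel, unitaryGroup_zero hR hinj]

lemma hasDerivAt_map_unitaryGroup_range (t : ℝ) (y : V) :
    HasDerivAt (fun s => R (unitaryGroup R s (R y)))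
      (-Complex.I • unitaryGroup R t (R y)) t := by
  have h := ((ContinuousLinearMap.apply ℂ V y).restrictScalars ℝ).hasFDerivAt.comp_hasDerivAt t
    (hasDerivAt_smoothGroup_mul hR t)
  rw [unitaryGroup_apply hR hinj]
  convert! h using 2 with s
  rw [unitaryGroup_apply hR hinj]
  exact (DFunLike.congr_fun (smoothGroup_mul_comm hR s) y).symm

lemma continuous_unitaryGroup (x : V) : Continuous fun t => unitaryGroup R t x := by
  have hd := denseRange_of_injective hR hinj
  refine continuous_of_uniform_approx_of_continuous fun u hu => ?_
  obtain ⟨ε, hε, hu⟩ := Metric.mem_uniformity_dist.mp hu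
  obtain ⟨y, hy⟩ := (hd.comp hd R.continuous).exists_dist_lt x hε
  refine ⟨fun t => unitaryGroup R t (R (R y)), ?_, fun t => hu ?_⟩
  · rw [continuous_iff_continuousAt]
    intro t
    have := (hasDerivAt_map_unitaryGroup_range hR hinj t y).continuousAt
    simpa only [map_unitaryGroup hR hinj] using this
  · rw [dist_eq_norm, ← map_sub, norm_unitaryGroup hR hinj, ← dist_eq_norm]
    exact hy

/-- The differential equation is available for `x` in the range of `R`. Its integrated form is
continuous in `x`, so it passes to all `x` by density. -/
lemma map_unitaryGroup_eq_integral (t : ℝ) (x : V) :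
    R (unitaryGroup R t x) = R x + -Complex.I • ∫ s in (0 : ℝ)..t, unitaryGroup R s x := by
  have hint : ∀ x : V, IntervalIntegrable (fun s => unitaryGroup R s x) volume 0 t :=
    fun x => (continuous_unitaryGroup hR hinj x).intervalIntegrable _ _
  refine (denseRange_of_injective hR hinj).induction_on
    (p := fun x => R (unitaryGroup R t x)
      = R x + -Complex.I • ∫ s in (0 : ℝ)..t, unitaryGroup R s x) x
    (isClosed_eq (by fun_prop) ?_) ?_
  · refine R.continuous.add (continuous_const.smul ?_)
    refine LipschitzWith.continuous (K := ⟨|t|, abs_nonneg t⟩)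
      (LipschitzWith.of_dist_le_mul fun a b => ?_)
    rw [dist_eq_norm, ← intervalIntegral.integral_sub (hint a) (hint b), dist_eq_norm]
    have := intervalIntegral.norm_integral_le_of_norm_le_const (a := 0) (b := t)
      (f := fun s => unitaryGroup R s a - unitaryGroup R s b) (C := ‖a - b‖) (fun s _ => by
        rw [← map_sub, norm_unitaryGroup hR hinj])
    rw [sub_zero, mul_comm] at this
    exact this
  · intro y
    rw [← intervalIntegral.integral_smul,
      intervalIntegral.integral_eq_sub_of_hasDerivAt
        (fun s _ => hasDerivAt_map_unitaryGroup_range hR hinj s y)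
        ((hint (R y)).smul (-Complex.I)), unitaryGroup_zero hR hinj]
    abel

lemma hasDerivAt_map_unitaryGroup (t : ℝ) (x : V) :
    HasDerivAt (fun s => R (unitaryGroup R s x)) (-Complex.I • unitaryGroup R t x) t := by
  have hc := continuous_unitaryGroup hR hinj x
  simp only [map_unitaryGroup_eq_integral hR hinj _ x]
  exact ((intervalIntegral.integral_hasDerivAt_right (hc.intervalIntegrable _ _)
    hc.stronglyMeasurable.stronglyMeasurableAtFilter hc.continuousAt).const_smul
      (-Complex.I)).const_add _

lemma tendsto_unitaryGroup {l : Filter ℝ} {a : ℝ} {φ : ℝ → ℝ} {x : ℝ → V} {y : V}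
    (hφ : Tendsto φ l (𝓝 a)) (hx : Tendsto x l (𝓝 y)) :
    Tendsto (fun s => unitaryGroup R (φ s) (x s)) l (𝓝 (unitaryGroup R a y)) := by
  have h1 : Tendsto (fun s => unitaryGroup R (φ s) (x s - y)) l (𝓝 0) := by
    rw [tendsto_zero_iff_norm_tendsto_zero]
    simp only [norm_unitaryGroup hR hinj]
    exact tendsto_iff_norm_sub_tendsto_zero.mp hx
  have h2 := ((continuous_unitaryGroup hR hinj y).tendsto a).comp hφ
  have h3 := h1.add h2
  simpa using h3

/-- A product rule for a group that is only strongly continuous: `hx` places `y t` in the domain of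
the generator, at the single time `t`. It is used with `c = -1` and `c = 1` to enter and to leave
the interaction picture. -/
lemma hasDerivAt_unitaryGroup_mul (c : ℝ) {y : ℝ → V} {y' x : V} {t : ℝ}
    (hy : HasDerivAt y y' t) (hx : y t = R x) :
    HasDerivAt (fun s => unitaryGroup R (c * s) (y s))
      (unitaryGroup R (c * t) (y' - (c * Complex.I) • x)) t := by
  have h1 : HasDerivAt (fun s => unitaryGroup R (c * s) (y t))
      (-((c * Complex.I) • unitaryGroup R (c * t) x)) t := by
    have := (hasDerivAt_map_unitaryGroup hR hinj (c * t) x).scomp t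
      ((hasDerivAt_id t).const_mul c)
    simp only [Function.comp_def, map_unitaryGroup hR hinj, ← hx] at this
    convert! this using 1
    rw [mul_one, ← Complex.coe_smul, smul_smul, ← neg_smul]
    congr 1
    ring
  have h2 : HasDerivAt (fun s => unitaryGroup R (c * s) (y s - y t))
      (unitaryGroup R (c * t) y') t := by
    rw [hasDerivAt_iff_isLittleO] at hy ⊢
    have e : (fun s => unitaryGroup R (c * s) (y s - y t) - unitaryGroup R (c * t) (y t - y t)
        - (s - t) • unitaryGroup R (c * t) y') = fun s =>
        unitaryGroup R (c * s) (y s - y t - (s - t) • y')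
          + (s - t) • (unitaryGroup R (c * s) y' - unitaryGroup R (c * t) y') := by
      funext s
      have hs : ∀ z : V, unitaryGroup R (c * s) ((s - t) • z)
          = (s - t) • unitaryGroup R (c * s) z :=
        fun z => (unitaryGroup R (c * s)).map_smul_of_tower _ _
      simp only [map_sub, sub_self, map_zero, hs, smul_sub]
      abel
    rw [e]
    refine Asymptotics.IsLittleO.add ?_ ?_
    · refine Asymptotics.IsLittleO.of_norm_left ?_
      simp only [norm_unitaryGroup hR hinj]
      exact hy.norm_left
    · have h3 : Tendsto (fun s => unitaryGroup R (c * s) y' - unitaryGroup R (c * t) y') (𝓝 t)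
          (𝓝 0) := by
        have := (tendsto_unitaryGroup hR hinj ((continuous_const_mul c).tendsto t)
          (tendsto_const_nhds (x := y'))).sub_const (unitaryGroup R (c * t) y')
        rwa [sub_self] at this
      have h4 := (Asymptotics.isBigO_refl (fun s : ℝ => s - t) (𝓝 t)).smul_isLittleO
        ((Asymptotics.isLittleO_one_iff ℝ).mpr h3)
      simpa using h4
  have h5 := h2.add h1
  rw [map_sub, map_smul, sub_eq_add_neg]
  convert! h5 using 2 with s
  simp

end Group

/-! ### The energy space as a Hilbert space -/

lemma integrable_conj_mul {f g : ℝ → ℂ} (hf : MemLp f 2 volume) (hg : MemLp g 2 volume) :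
    Integrable fun x => conj (f x) * g x :=
  MemLp.integrable_mul (p := 2) (q := 2) hf.star hg

lemma integrable_mul_conj {f g : ℝ → ℂ} (hf : MemLp f 2 volume) (hg : MemLp g 2 volume) :
    Integrable fun x => f x * conj (g x) :=
  MemLp.integrable_mul (p := 2) (q := 2) hf hg.star

lemma MemH1.eq_zero_of_mass_eq_zero {f : ℝ → ℂ} (hf : MemH1 f) (h : mass f = 0) (x : ℝ) :
    f x = 0 := by
  rw [mass, integral_eq_zero_iff_of_nonneg (fun x => by positivity) hf.integrable_sq] at h
  have h2 : f =ᵐ[volume] fun _ => 0 := by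
    filter_upwards [h] with x hx
    simpa using hx
  exact congrFun (Continuous.ae_eq_iff_eq volume hf.continuous' continuous_const |>.mp h2) x

/-- The functions in `H¹(ℝ)` as a submodule of all functions. -/
def h1Submodule : Submodule ℂ (ℝ → ℂ) where
  carrier := {f | MemH1 f}
  add_mem' hf hg := hf.add hg
  zero_mem' := memH1_zero
  smul_mem' c _ hf := hf.const_mul c

/-- `H¹(ℝ)` with the inner product of the form of `1 - ∂ₓ² + |γ| δ`. -/
def EnergySpace (_γ : ℝ) : Type := h1Submodule

namespace EnergySpace

variable {γ : ℝ}

instance : AddCommGroup (EnergySpace γ) := inferInstanceAs (AddCommGroup h1Submodule)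

instance : Module ℂ (EnergySpace γ) := inferInstanceAs (Module ℂ h1Submodule)

/-- The function underlying an element of the energy space. -/
@[coe] def toFun (f : EnergySpace γ) : ℝ → ℂ := Subtype.val (p := fun f => f ∈ h1Submodule) f

instance : CoeFun (EnergySpace γ) fun _ => ℝ → ℂ := ⟨toFun⟩

/-- The element of the energy space given by a function in `H¹(ℝ)`. -/
def mk (f : ℝ → ℂ) (hf : MemH1 f) : EnergySpace γ := ⟨f, hf⟩

@[simp] lemma mk_apply (f : ℝ → ℂ) (hf : MemH1 f) (x : ℝ) : (mk f hf : EnergySpace γ) x = f x :=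
  rfl

lemma memH1 (f : EnergySpace γ) : MemH1 f := f.2

@[ext] lemma ext {f g : EnergySpace γ} (h : ∀ x, f x = g x) : f = g := Subtype.ext (funext h)

@[simp] lemma add_apply (f g : EnergySpace γ) (x : ℝ) : (f + g) x = f x + g x := rfl

@[simp] lemma sub_apply (f g : EnergySpace γ) (x : ℝ) : (f - g) x = f x - g x := rfl

@[simp] lemma smul_apply (c : ℂ) (f : EnergySpace γ) (x : ℝ) : (c • f) x = c * f x := rfl

lemma deriv_add (f g : EnergySpace γ) :
    deriv (f + g : EnergySpace γ) =ᵐ[volume] fun x => deriv f x + deriv g x :=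
  f.memH1.deriv_add g.memH1

lemma deriv_smul (c : ℂ) (f : EnergySpace γ) :
    deriv (c • f : EnergySpace γ) =ᵐ[volume] fun x => c * deriv f x :=
  f.memH1.deriv_const_mul c

/-- The inner product of the energy space. -/
def innerFun (f g : EnergySpace γ) : ℂ :=
  (∫ x, conj (deriv f x) * deriv g x) + |γ| * (conj (f 0) * g 0) + ∫ x, conj (f x) * g x

lemma innerFun_self (f : EnergySpace γ) :
    innerFun f f = ((∫ x, ‖deriv f x‖ ^ 2) + |γ| * ‖f 0‖ ^ 2 + ∫ x, ‖f x‖ ^ 2 : ℝ) := by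
  simp only [innerFun, Complex.conj_mul', ← Complex.ofReal_pow, integral_complex_ofReal]
  push_cast
  rfl

/-- The inner product space structure. -/
abbrev core : InnerProductSpace.Core ℂ (EnergySpace γ) where
  inner := innerFun
  conj_inner_symm f g := by
    simp only [innerFun, map_add, map_mul, ← integral_conj, Complex.conj_conj, Complex.conj_ofReal]
    simp only [mul_comm]
  re_inner_nonneg f := by
    rw [innerFun_self, RCLike.re_eq_complex_re, Complex.ofReal_re]
    positivity
  add_left f g h := by
    have e : ∫ x, conj (deriv (f + g : EnergySpace γ) x) * deriv h x
        = ∫ x, (conj (deriv f x) * deriv h x + conj (deriv g x) * deriv h x) := by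
      refine integral_congr_ae ?_
      filter_upwards [deriv_add f g] with x hx
      rw [hx, map_add, add_mul]
    simp only [innerFun]
    rw [e, integral_add (integrable_conj_mul f.memH1.memLp_deriv h.memH1.memLp_deriv)
      (integrable_conj_mul g.memH1.memLp_deriv h.memH1.memLp_deriv)]
    simp only [add_apply, map_add, add_mul]
    rw [integral_add (integrable_conj_mul f.memH1.memLp h.memH1.memLp)
      (integrable_conj_mul g.memH1.memLp h.memH1.memLp)]
    ring
  smul_left f g c := by
    have e : ∫ x, conj (deriv (c • f : EnergySpace γ) x) * deriv g x
        = ∫ x, conj c * (conj (deriv f x) * deriv g x) := by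
      refine integral_congr_ae ?_
      filter_upwards [deriv_smul c f] with x hx
      rw [hx, map_mul, mul_assoc]
    simp only [innerFun]
    rw [e, integral_const_mul]
    simp only [smul_apply, map_mul, mul_assoc]
    rw [integral_const_mul]
    ring
  definite f h := by
    rw [innerFun_self, Complex.ofReal_eq_zero] at h
    have h1 : ∫ x, ‖f x‖ ^ 2 = 0 := by
      have h2 : 0 ≤ ∫ x, ‖deriv f x‖ ^ 2 := integral_nonneg fun x => by positivity
      have h3 : 0 ≤ ∫ x, ‖f x‖ ^ 2 := integral_nonneg fun x => by positivity
      have h4 : 0 ≤ |γ| * ‖f 0‖ ^ 2 := by positivity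
      linarith
    exact ext fun x => f.memH1.eq_zero_of_mass_eq_zero h1 x

instance : NormedAddCommGroup (EnergySpace γ) := (core (γ := γ)).toNormedAddCommGroup

instance : InnerProductSpace ℂ (EnergySpace γ) := InnerProductSpace.ofCore (core (γ := γ)).toCore

lemma inner_def (f g : EnergySpace γ) : inner ℂ f g =
    (∫ x, conj (deriv f x) * deriv g x) + |γ| * (conj (f 0) * g 0) + ∫ x, conj (f x) * g x :=
  rfl

lemma norm_sq (f : EnergySpace γ) :
    ‖f‖ ^ 2 = (∫ x, ‖deriv f x‖ ^ 2) + |γ| * ‖f 0‖ ^ 2 + ∫ x, ‖f x‖ ^ 2 := by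
  have h : ((‖f‖ ^ 2 : ℝ) : ℂ) = innerFun f f := by
    push_cast
    exact (inner_self_eq_norm_sq_to_K (𝕜 := ℂ) f).symm
  rw [innerFun_self] at h
  exact_mod_cast h

lemma h1NormSq_le (f : EnergySpace γ) : h1NormSq f ≤ ‖f‖ ^ 2 := by
  rw [norm_sq, h1NormSq]
  have h4 : 0 ≤ |γ| * ‖f 0‖ ^ 2 := by positivity
  linarith

lemma norm_sq_le (f : EnergySpace γ) : ‖f‖ ^ 2 ≤ (1 + 2 * |γ|) * h1NormSq f := by
  have h := mul_le_mul_of_nonneg_left (f.memH1.norm_sq_le 0) (abs_nonneg γ)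
  rw [norm_sq]
  unfold h1NormSq at h ⊢
  linarith

lemma norm_apply_le (f : EnergySpace γ) (x : ℝ) : ‖f x‖ ≤ 2 * ‖f‖ := by
  have h1 := f.memH1.norm_sq_le x
  have h2 := h1NormSq_le f
  refine le_of_sq_le_sq ?_ (by positivity)
  nlinarith [sq_nonneg ‖f‖]

lemma inner_toLp {f g : ℝ → ℂ} (hf : MemLp f 2 volume) (hg : MemLp g 2 volume) :
    inner ℂ (hf.toLp f) (hg.toLp g) = ∫ x, conj (f x) * g x := by
  rw [L2.inner_def]
  refine integral_congr_ae ?_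
  filter_upwards [hf.coeFn_toLp, hg.coeFn_toLp] with x h1 h2
  rw [h1, h2, RCLike.inner_apply, mul_comm]

lemma norm_toLp_sq {f : ℝ → ℂ} (hf : MemLp f 2 volume) : ‖hf.toLp f‖ ^ 2 = ∫ x, ‖f x‖ ^ 2 := by
  have h := inner_toLp hf hf
  rw [inner_self_eq_norm_sq_to_K] at h
  simp only [Complex.conj_mul', ← Complex.ofReal_pow, integral_complex_ofReal] at h
  refine Complex.ofReal_injective ?_
  rw [Complex.ofReal_pow]
  exact h

/-- The embedding into `L²(ℝ)`. -/
def toL2 : EnergySpace γ →L[ℂ] Lp ℂ 2 (volume : Measure ℝ) :=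
  LinearMap.mkContinuous
    { toFun := fun f => f.memH1.memLp.toLp f
      map_add' := fun f g => MemLp.toLp_add f.memH1.memLp g.memH1.memLp
      map_smul' := fun c f => MemLp.toLp_const_smul c f.memH1.memLp } 1 (by
    intro f
    rw [one_mul]
    refine le_of_sq_le_sq ?_ (norm_nonneg _)
    refine (norm_toLp_sq f.memH1.memLp).trans_le ?_
    rw [norm_sq]
    have h1 : 0 ≤ ∫ x, ‖deriv f x‖ ^ 2 := integral_nonneg fun x => by positivity
    have h2 : 0 ≤ |γ| * ‖f 0‖ ^ 2 := by positivity
    linarith)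

lemma toL2_def (f : EnergySpace γ) : toL2 f = f.memH1.memLp.toLp f := rfl

/-- The weak derivative as a map into `L²(ℝ)`. -/
def derivL2 : EnergySpace γ →L[ℂ] Lp ℂ 2 (volume : Measure ℝ) :=
  LinearMap.mkContinuous
    { toFun := fun f => f.memH1.memLp_deriv.toLp (deriv f)
      map_add' := fun f g => by
        rw [← MemLp.toLp_add, MemLp.toLp_eq_toLp_iff]
        exact deriv_add f g
      map_smul' := fun c f => by
        rw [RingHom.id_apply, ← MemLp.toLp_const_smul, MemLp.toLp_eq_toLp_iff]
        exact deriv_smul c f } 1 (by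
    intro f
    rw [one_mul]
    refine le_of_sq_le_sq ?_ (norm_nonneg _)
    refine (norm_toLp_sq f.memH1.memLp_deriv).trans_le ?_
    rw [norm_sq]
    have h1 : 0 ≤ ∫ x, ‖f x‖ ^ 2 := integral_nonneg fun x => by positivity
    have h2 : 0 ≤ |γ| * ‖f 0‖ ^ 2 := by positivity
    linarith)

lemma derivL2_def (f : EnergySpace γ) : derivL2 f = f.memH1.memLp_deriv.toLp (deriv f) := rfl

lemma norm_sq_eq (f : EnergySpace γ) :
    ‖f‖ ^ 2 = ‖derivL2 f‖ ^ 2 + |γ| * ‖f 0‖ ^ 2 + ‖toL2 f‖ ^ 2 := by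
  rw [norm_sq, derivL2_def, toL2_def, norm_toLp_sq, norm_toLp_sq]

/-- Evaluation at a point. -/
def evalCLM (x : ℝ) : EnergySpace γ →L[ℂ] ℂ :=
  LinearMap.mkContinuous
    { toFun := fun f => f x
      map_add' := fun _ _ => rfl
      map_smul' := fun _ _ => rfl } 2 fun f => norm_apply_le f x

@[simp] lemma evalCLM_apply (x : ℝ) (f : EnergySpace γ) : evalCLM x f = f x := rfl

lemma setIntegral_deriv_eq_inner (f : EnergySpace γ) (a b : ℝ) :
    inner ℂ (indicatorConstLp 2 (measurableSet_Ioc (a := a) (b := b))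
      (measure_Ioc_lt_top (μ := volume)).ne (1 : ℂ)) (derivL2 f)
      = ∫ x in Set.Ioc a b, deriv f x := by
  rw [L2.inner_indicatorConstLp_one]
  refine integral_congr_ae (ae_restrict_of_ae ?_)
  exact f.memH1.memLp_deriv.coeFn_toLp

/-- Along a Cauchy sequence the functions and their derivatives converge in `L²`, and the values
converge at every point. Pairing the derivatives with indicators of intervals passes the primitive
relation to the limit; a subsequence converging almost everywhere identifies the pointwise limit
with the `L²` limit. -/
instance : CompleteSpace (EnergySpace γ) := by
  refine Metric.complete_of_cauchySeq_tendsto fun F hF => ?_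
  have hlim : ∀ {W : Type} [NormedAddCommGroup W] [NormedSpace ℂ W] [CompleteSpace W]
      (T : EnergySpace γ →L[ℂ] W), ∃ y, Tendsto (fun n => T (F n)) atTop (𝓝 y) := by
    intro W _ _ _ T
    exact cauchySeq_tendsto_of_complete (hF.map T.uniformContinuous)
  obtain ⟨w, hw⟩ := hlim derivL2
  obtain ⟨j, hj⟩ := hlim toL2
  choose f hf using fun x : ℝ => hlim (evalCLM x)
  simp only [evalCLM_apply] at hf
  have hloc : LocallyIntegrable w volume := (Lp.memLp w).locallyIntegrable one_le_two
  have hle : ∀ a b : ℝ, a ≤ b → ∫ x in a..b, w x = f b - f a := by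
    intro a b hab
    have h1 := (tendsto_const_nhds (x := indicatorConstLp 2 (measurableSet_Ioc (a := a) (b := b))
      (measure_Ioc_lt_top (μ := volume)).ne (1 : ℂ))).inner (𝕜 := ℂ) hw
    rw [L2.inner_indicatorConstLp_one] at h1
    simp only [setIntegral_deriv_eq_inner, ← intervalIntegral.integral_of_le hab] at h1
    simp only [(F _).memH1.integral_deriv] at h1
    exact tendsto_nhds_unique h1 ((hf b).sub (hf a))
  have hprim : IsPrimitive f w := by
    refine ⟨hloc, fun a b => ?_⟩
    rcases le_total a b with h | h
    · exact hle a b h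
    · rw [intervalIntegral.integral_symm, hle b a h]
      ring
  have hfj : f =ᵐ[volume] j := by
    obtain ⟨ns, hns, hns'⟩ := (tendstoInMeasure_of_tendsto_Lp hj).exists_seq_tendsto_ae
    have h1 : ∀ᵐ x, ∀ n, toL2 (F n) x = F n x :=
      ae_all_iff.mpr fun n => (F n).memH1.memLp.coeFn_toLp
    filter_upwards [hns', h1] with x hx h1
    simp only [h1] at hx
    exact tendsto_nhds_unique ((hf x).comp hns.tendsto_atTop) hx
  have hfm : MemLp f 2 volume := (memLp_congr_ae hfj).mpr (Lp.memLp j)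
  have hH1 : MemH1 f := hprim.memH1 hfm (Lp.memLp w)
  refine ⟨mk f hH1, ?_⟩
  have e1 : toL2 (mk f hH1 : EnergySpace γ) = j := by
    rw [toL2_def]
    exact Lp.ext ((MemLp.coeFn_toLp _).trans hfj)
  have e2 : derivL2 (mk f hH1 : EnergySpace γ) = w := by
    rw [derivL2_def]
    exact Lp.ext ((MemLp.coeFn_toLp _).trans hprim.deriv_ae_eq)
  rw [tendsto_iff_norm_sub_tendsto_zero]
  have h1 : Tendsto (fun n => ‖F n - mk f hH1‖ ^ 2) atTop (𝓝 0) := by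
    simp only [norm_sq_eq, map_sub, e1, e2, sub_apply, mk_apply]
    have t1 := (tendsto_iff_norm_sub_tendsto_zero.mp hw).pow 2
    have t2 := (tendsto_iff_norm_sub_tendsto_zero.mp hj).pow 2
    have t3 := ((tendsto_iff_norm_sub_tendsto_zero.mp (hf 0)).pow 2).const_mul |γ|
    simpa using (t1.add t3).add t2
  have h2 := (Real.continuous_sqrt.tendsto 0).comp h1
  simpa [Function.comp_def] using h2

/-- The operator representing the inner product of `L²` in the energy space. -/
def resolvent : EnergySpace γ →L[ℂ] EnergySpace γ :=
  (ContinuousLinearMap.adjoint toL2).comp toL2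

lemma inner_toL2 (f g : EnergySpace γ) : inner ℂ (toL2 f) (toL2 g) = ∫ x, conj (f x) * g x :=
  inner_toLp f.memH1.memLp g.memH1.memLp

lemma inner_resolvent_left (f g : EnergySpace γ) :
    inner ℂ (resolvent f) g = ∫ x, conj (f x) * g x := by
  rw [resolvent, ContinuousLinearMap.comp_apply, ContinuousLinearMap.adjoint_inner_left,
    inner_toL2]

lemma inner_resolvent_right (f g : EnergySpace γ) :
    inner ℂ f (resolvent g) = ∫ x, conj (f x) * g x := by
  rw [resolvent, ContinuousLinearMap.comp_apply, ContinuousLinearMap.adjoint_inner_right,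
    inner_toL2]

lemma isSelfAdjoint_resolvent : IsSelfAdjoint (resolvent (γ := γ)) := by
  rw [ContinuousLinearMap.isSelfAdjoint_iff_isSymmetric]
  intro f g
  exact (inner_resolvent_left f g).trans (inner_resolvent_right f g).symm

lemma norm_toL2_sq (f : EnergySpace γ) : ‖toL2 f‖ ^ 2 = mass f :=
  norm_toLp_sq f.memH1.memLp

lemma inner_resolvent_self (f : EnergySpace γ) : inner ℂ (resolvent f) f = (mass f : ℂ) := by
  rw [resolvent, ContinuousLinearMap.comp_apply, ContinuousLinearMap.adjoint_inner_left,
    inner_self_eq_norm_sq_to_K, ← norm_toL2_sq]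
  push_cast
  rfl

lemma injective_resolvent : Function.Injective (resolvent (γ := γ)) := by
  rw [injective_iff_map_eq_zero]
  intro f hf
  refine ext fun x => f.memH1.eq_zero_of_mass_eq_zero ?_ x
  have h := inner_resolvent_self f
  rw [hf, inner_zero_left] at h
  exact_mod_cast h.symm

lemma hdotNormSq_eq (hγ : γ < 0) (f : EnergySpace γ) : hdotNormSq γ f = ‖f‖ ^ 2 - mass f := by
  rw [norm_sq, hdotNormSq, mass, abs_of_neg hγ]
  ring

/-- For `γ < 0` the energy inner product is the form of `-Δ_γ` plus the `L²` product, so `resolvent`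
is `(1 - Δ_γ)⁻¹`. -/
lemma form_eq (hγ : γ < 0) (f g : EnergySpace γ) :
    form γ f g = inner ℂ g f - inner ℂ g (resolvent f) := by
  rw [inner_resolvent_right, inner_def, form, abs_of_neg hγ]
  simp only [mul_comm (conj _)]
  push_cast
  ring

end EnergySpace

/-! ### The nonlinearity on the energy space -/

/-- As a power `s / 2 ≥ 2` of the smooth function `‖z‖²`, this is `C²` even at the origin. With `s =
p - 1` it is one of the places where `p > 5` enters. -/
lemma contDiff_norm_rpow {s : ℝ} (hs : 4 ≤ s) : ContDiff ℝ 2 fun z : ℂ => ‖z‖ ^ s := by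
  have h1 : (fun z : ℂ => ‖z‖ ^ s) = fun z : ℂ => (‖z‖ ^ 2) ^ (s / 2) := by
    funext z
    rw [← Real.rpow_natCast, ← Real.rpow_mul (norm_nonneg _)]
    congr 1
    push_cast
    ring
  rw [h1]
  have h2 : ContDiff ℝ (2 : ℕ) fun x : ℝ => x ^ (s / 2) :=
    Real.contDiff_rpow_const_of_le (by push_cast; linarith)
  exact h2.comp (contDiff_norm_sq ℝ)

lemma contDiff_nonlin {p : ℝ} (hp : 5 < p) : ContDiff ℝ 2 (nonlin p) := by
  have h := contDiff_norm_rpow (s := p - 1) (by linarith)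
  exact (Complex.ofRealCLM.contDiff.comp h).mul contDiff_id

lemma hasFDerivAt_norm_rpow {p : ℝ} (hp : 5 < p) (z : ℂ) :
    HasFDerivAt (fun z : ℂ => ‖z‖ ^ (p + 1))
      (((p + 1) * ‖z‖ ^ (p - 1)) • innerSL ℝ z) z := by
  have h1 : (fun z : ℂ => ‖z‖ ^ (p + 1)) = fun z : ℂ => (‖z‖ ^ 2) ^ ((p + 1) / 2) := by
    funext z
    rw [← Real.rpow_natCast, ← Real.rpow_mul (norm_nonneg _)]
    congr 1
    push_cast
    ring
  rw [h1]
  have h2 : HasFDerivAt (fun z : ℂ => ‖z‖ ^ 2) (2 • innerSL ℝ z) z :=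
    (hasStrictFDerivAt_norm_sq z).hasFDerivAt
  have h3 := h2.rpow_const (p := (p + 1) / 2) (Or.inr (by linarith))
  convert! h3 using 1
  have h4 : (‖z‖ ^ 2) ^ ((p + 1) / 2 - 1) = ‖z‖ ^ (p - 1) := by
    rw [← Real.rpow_natCast, ← Real.rpow_mul (norm_nonneg _)]
    congr 1
    push_cast
    ring
  rw [h4]
  ext w
  simp only [smul_apply, smul_eq_mul, nsmul_eq_mul]
  push_cast
  ring

lemma fderiv_norm_rpow_apply {p : ℝ} (hp : 5 < p) (z w : ℂ) :
    fderiv ℝ (fun z : ℂ => ‖z‖ ^ (p + 1)) z w = (p + 1) * (nonlin p z * conj w).re := by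
  rw [(hasFDerivAt_norm_rpow hp z).fderiv]
  simp only [smul_apply, smul_eq_mul, innerSL_apply_apply, nonlin,
    Complex.inner, mul_assoc, Complex.re_ofReal_mul]
  congr 2
  simp only [Complex.mul_re, Complex.conj_re, Complex.conj_im]
  ring

lemma nonlin_zero {p : ℝ} : nonlin p 0 = 0 := by simp [nonlin]

lemma nonlin_mul {p : ℝ} {c : ℂ} (hc : ‖c‖ = 1) (z : ℂ) : nonlin p (c * z) = c * nonlin p z := by
  simp only [nonlin, norm_mul, hc, one_mul]
  ring

lemma nonlin_mul_conj {p : ℝ} (hp : 5 < p) (z : ℂ) :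
    nonlin p z * conj z = ((‖z‖ ^ (p + 1) : ℝ) : ℂ) := by
  rw [nonlin, mul_assoc, Complex.mul_conj', ← Complex.ofReal_pow, ← Complex.ofReal_mul,
    ← Real.rpow_natCast, ← Real.rpow_add' (norm_nonneg _) (by push_cast; linarith)]
  congr 2
  push_cast
  ring

/-- Bounds for a `C²` map and its derivative on a ball. -/
lemma exists_bounds {W : Type*} [NormedAddCommGroup W] [NormedSpace ℝ W] {G : ℂ → W}
    (hG : ContDiff ℝ 2 G) (ρ : ℝ) :
    ∃ K : ℝ, 0 ≤ K ∧
      (∀ z w : ℂ, ‖z‖ ≤ ρ → ‖w‖ ≤ ρ → ‖G z - G w‖ ≤ K * ‖z - w‖) ∧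
      (∀ z : ℂ, ‖z‖ ≤ ρ → ‖fderiv ℝ G z‖ ≤ K) ∧
      (∀ z w : ℂ, ‖z‖ ≤ ρ → ‖w‖ ≤ ρ → ‖fderiv ℝ G z - fderiv ℝ G w‖ ≤ K * ‖z - w‖) := by
  have hball : ∀ z : ℂ, ‖z‖ ≤ ρ → z ∈ Metric.closedBall (0 : ℂ) ρ := fun z hz => by simpa using hz
  obtain ⟨K₁, h₁⟩ := hG.contDiffOn.exists_lipschitzOnWith two_ne_zero
    (convex_closedBall (0 : ℂ) ρ) (isCompact_closedBall _ _)
  have hd : ContDiff ℝ 1 (fderiv ℝ G) := hG.fderiv_right (by norm_num [one_add_one_eq_two])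
  obtain ⟨K₂, h₂⟩ := hd.contDiffOn.exists_lipschitzOnWith one_ne_zero
    (convex_closedBall (0 : ℂ) ρ) (isCompact_closedBall _ _)
  obtain ⟨K₃, h₃⟩ := (isCompact_closedBall (0 : ℂ) ρ).exists_bound_of_continuousOn
    hd.continuous.continuousOn
  refine ⟨max (max K₁ K₂) K₃, le_max_of_le_left (le_max_of_le_left K₁.2), ?_, ?_, ?_⟩
  · intro z w hz hw
    refine (h₁.norm_sub_le (hball z hz) (hball w hw)).trans ?_
    gcongr
    exact le_max_of_le_left (le_max_left _ _)
  · intro z hz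
    exact (h₃ z (hball z hz)).trans (le_max_right _ _)
  · intro z w hz hw
    refine (h₂.norm_sub_le (hball z hz) (hball w hw)).trans ?_
    gcongr
    exact le_max_of_le_left (le_max_right _ _)

lemma MemH1.exists_norm_le {f : ℝ → ℂ} (hf : MemH1 f) : ∃ ρ : ℝ, ∀ x, ‖f x‖ ≤ ρ :=
  ⟨√(2 * h1NormSq f), fun x => Real.le_sqrt_of_sq_le (hf.norm_sq_le x)⟩

lemma MemH1.comp {f : ℝ → ℂ} (hf : MemH1 f) {G : ℂ → ℂ} (hG : ContDiff ℝ 2 G) (h0 : G 0 = 0) :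
    MemH1 fun x => G (f x) := by
  obtain ⟨ρ, hρ⟩ := hf.exists_norm_le
  obtain ⟨K, hK, h1, h2, -⟩ := exists_bounds hG ρ
  have hprim := hf.isPrimitive.comp_contDiff (hG.of_le one_le_two)
  refine hprim.memH1 ?_ ?_
  · refine hf.memLp.of_le_mul (c := K)
      (hG.continuous.comp hf.continuous').aestronglyMeasurable (Eventually.of_forall fun x => ?_)
    have := h1 (f x) 0 (hρ x) (by simpa using (norm_nonneg _).trans (hρ x))
    simpa [h0] using this
  · refine hf.memLp_deriv.of_le_mul (c := K)
      hprim.locallyIntegrable.aestronglyMeasurable (Eventually.of_forall fun x => ?_)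
    exact (ContinuousLinearMap.le_opNorm _ _).trans (by gcongr; exact h2 _ (hρ x))

namespace EnergySpace

variable {γ : ℝ}

/-- Composition with a `C²` map. -/
def compMap (G : ℂ → ℂ) (hG : ContDiff ℝ 2 G) (h0 : G 0 = 0) (f : EnergySpace γ) :
    EnergySpace γ :=
  mk (fun x => G (f x)) (f.memH1.comp hG h0)

lemma compMap_lipschitz {G : ℂ → ℂ} (hG : ContDiff ℝ 2 G) (h0 : G 0 = 0) (ρ : ℝ) :
    ∃ K : ℝ, 0 ≤ K ∧ ∀ f g : EnergySpace γ, ‖f‖ ≤ ρ → ‖g‖ ≤ ρ →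
      ‖compMap G hG h0 f - compMap G hG h0 g‖ ≤ K * ‖f - g‖ := by
  obtain ⟨K, hK, h1, h2, h3⟩ := exists_bounds hG (2 * ρ)
  -- `1 + 2|γ|` compares the two norms. One `K²` comes from `G(f) - G(g)`; the terms `2K²` and
  -- `8K²ρ²` come from `G'(f)(f' - g')` and `(G'(f) - G'(g))g'`, the latter using that `G'` is
  -- Lipschitz.
  refine ⟨√((1 + 2 * |γ|) * (3 * K ^ 2 + 8 * K ^ 2 * ρ ^ 2)), by positivity, ?_⟩
  intro f g hf hg
  have hfx : ∀ x, ‖f x‖ ≤ 2 * ρ := fun x => (norm_apply_le f x).trans (by linarith)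
  have hgx : ∀ x, ‖g x‖ ≤ 2 * ρ := fun x => (norm_apply_le g x).trans (by linarith)
  have hd0 : ∀ x, ‖f x - g x‖ ≤ 2 * ‖f - g‖ := fun x => norm_apply_le (f - g) x
  set D := compMap G hG h0 f - compMap G hG h0 g with hD
  have hDx : ∀ x, D x = G (f x) - G (g x) := fun x => rfl
  have hderiv : ∀ᵐ x, deriv D x = fderiv ℝ G (f x) (deriv f x) - fderiv ℝ G (g x) (deriv g x) := by
    filter_upwards [(f.memH1.isPrimitive.comp_contDiff (hG.of_le one_le_two)).ae_hasDerivAt,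
      (g.memH1.isPrimitive.comp_contDiff (hG.of_le one_le_two)).ae_hasDerivAt] with x hx hx'
    exact (hx.sub hx').deriv
  have hderiv' : ∀ᵐ x, deriv (f - g : EnergySpace γ) x = deriv f x - deriv g x := by
    filter_upwards [f.memH1.isPrimitive.ae_hasDerivAt,
      g.memH1.isPrimitive.ae_hasDerivAt] with x hx hx'
    exact (hx.sub hx').deriv
  have i1 : ∫ x, ‖D x‖ ^ 2 ≤ K ^ 2 * ∫ x, ‖(f - g : EnergySpace γ) x‖ ^ 2 := by
    rw [← integral_const_mul]
    refine integral_mono D.memH1.integrable_sq ((f - g).memH1.integrable_sq.const_mul _)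
      fun x => ?_
    have := h1 _ _ (hfx x) (hgx x)
    simp only [hDx, sub_apply]
    rw [← mul_pow]
    gcongr
  have i2 : ∫ x, ‖deriv D x‖ ^ 2 ≤ ∫ x, (2 * K ^ 2 * ‖deriv (f - g : EnergySpace γ) x‖ ^ 2
      + 8 * K ^ 2 * ‖f - g‖ ^ 2 * ‖deriv g x‖ ^ 2) := by
    refine integral_mono_ae D.memH1.integrable_deriv_sq
      (((f - g).memH1.integrable_deriv_sq.const_mul _).add
        (g.memH1.integrable_deriv_sq.const_mul _)) ?_
    filter_upwards [hderiv, hderiv'] with x hx hx'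
    rw [hx, hx']
    have e : fderiv ℝ G (f x) (deriv f x) - fderiv ℝ G (g x) (deriv g x)
        = fderiv ℝ G (f x) (deriv f x - deriv g x)
          + (fderiv ℝ G (f x) - fderiv ℝ G (g x)) (deriv g x) := by
      simp
    have b1 : ‖fderiv ℝ G (f x) (deriv f x - deriv g x)‖ ≤ K * ‖deriv f x - deriv g x‖ :=
      (ContinuousLinearMap.le_opNorm _ _).trans (by gcongr; exact h2 _ (hfx x))
    have b2 : ‖(fderiv ℝ G (f x) - fderiv ℝ G (g x)) (deriv g x)‖
        ≤ (K * (2 * ‖f - g‖)) * ‖deriv g x‖ :=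
      (ContinuousLinearMap.le_opNorm _ _).trans (by
        gcongr
        exact (h3 _ _ (hfx x) (hgx x)).trans (by gcongr; exact hd0 x))
    rw [e]
    have b3 := (norm_add_le (fderiv ℝ G (f x) (deriv f x - deriv g x))
      ((fderiv ℝ G (f x) - fderiv ℝ G (g x)) (deriv g x))).trans (add_le_add b1 b2)
    have b4 := pow_le_pow_left₀ (norm_nonneg _) b3 2
    refine b4.trans ?_
    nlinarith [sq_nonneg (K * ‖deriv f x - deriv g x‖ - K * (2 * ‖f - g‖) * ‖deriv g x‖)]
  rw [integral_add ((f - g).memH1.integrable_deriv_sq.const_mul _)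
    (g.memH1.integrable_deriv_sq.const_mul _), integral_const_mul, integral_const_mul] at i2
  have n1 : ∫ x, ‖(f - g : EnergySpace γ) x‖ ^ 2 ≤ ‖f - g‖ ^ 2 := by
    have := h1NormSq_le (f - g)
    rw [h1NormSq] at this
    have h5 : 0 ≤ ∫ x, ‖deriv (f - g : EnergySpace γ) x‖ ^ 2 :=
      integral_nonneg fun x => by positivity
    linarith
  have n2 : ∫ x, ‖deriv (f - g : EnergySpace γ) x‖ ^ 2 ≤ ‖f - g‖ ^ 2 := by
    have := h1NormSq_le (f - g)
    rw [h1NormSq] at this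
    have h5 : 0 ≤ ∫ x, ‖(f - g : EnergySpace γ) x‖ ^ 2 :=
      integral_nonneg fun x => by positivity
    linarith
  have n3 : ∫ x, ‖deriv g x‖ ^ 2 ≤ ρ ^ 2 := by
    have := h1NormSq_le g
    rw [h1NormSq] at this
    have h5 : 0 ≤ ∫ x, ‖g x‖ ^ 2 := integral_nonneg fun x => by positivity
    have h6 := pow_le_pow_left₀ (norm_nonneg _) hg 2
    linarith
  have key : ‖D‖ ^ 2 ≤ (1 + 2 * |γ|) * (3 * K ^ 2 + 8 * K ^ 2 * ρ ^ 2) * ‖f - g‖ ^ 2 := by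
    refine (norm_sq_le D).trans ?_
    rw [mul_assoc (1 + 2 * |γ|)]
    refine mul_le_mul_of_nonneg_left ?_ (by positivity)
    rw [h1NormSq]
    have m1 := mul_le_mul_of_nonneg_left n1 (sq_nonneg K)
    have m2 := mul_le_mul_of_nonneg_left n2 (show 0 ≤ 2 * K ^ 2 by positivity)
    have m3 := mul_le_mul_of_nonneg_left n3 (show 0 ≤ 8 * K ^ 2 * ‖f - g‖ ^ 2 by positivity)
    linarith
  refine le_of_sq_le_sq ?_ (by positivity)
  rw [mul_pow, Real.sq_sqrt (by positivity)]
  exact key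

/-- The nonlinearity `|f|^{p-1} f` on the energy space. -/
def nonlinMap {p : ℝ} (hp : 5 < p) (f : EnergySpace γ) : EnergySpace γ :=
  compMap (nonlin p) (contDiff_nonlin hp) nonlin_zero f

@[simp] lemma nonlinMap_apply {p : ℝ} (hp : 5 < p) (f : EnergySpace γ) (x : ℝ) :
    nonlinMap hp f x = nonlin p (f x) := rfl

lemma nonlinMap_smul {p : ℝ} (hp : 5 < p) {c : ℂ} (hc : ‖c‖ = 1) (f : EnergySpace γ) :
    nonlinMap hp (c • f) = c • nonlinMap hp f := by
  ext x
  simp [nonlin_mul hc]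

lemma integrable_norm_rpow {p : ℝ} (hp : 5 < p) (f : EnergySpace γ) :
    Integrable fun x => ‖f x‖ ^ (p + 1) := by
  have h := integrable_mul_conj (nonlinMap hp f).memH1.memLp f.memH1.memLp
  simp only [nonlinMap_apply, nonlin_mul_conj hp] at h
  simpa using h.re

lemma inner_resolvent_nonlinMap {p : ℝ} (hp : 5 < p) (f : EnergySpace γ) :
    inner ℂ f (resolvent (nonlinMap hp f)) = (lpPow p f : ℂ) := by
  rw [inner_resolvent_right]
  simp only [nonlinMap_apply, mul_comm (conj _), nonlin_mul_conj hp]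
  rw [integral_complex_ofReal]
  rfl

/-- The first order expansion of `‖f‖_{L^{p+1}}^{p+1}`. -/
lemma lpPow_expansion {p : ℝ} (hp : 5 < p) (ρ : ℝ) :
    ∃ C : ℝ, 0 ≤ C ∧ ∀ f g : EnergySpace γ, ‖f‖ ≤ ρ → ‖g‖ ≤ ρ →
      |lpPow p g - lpPow p f - (p + 1) * (inner ℂ (resolvent (g - f)) (nonlinMap hp f)).re|
        ≤ C * mass (g - f : EnergySpace γ) := by
  have hH : ContDiff ℝ 2 fun z : ℂ => ‖z‖ ^ (p + 1) := contDiff_norm_rpow (by linarith)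
  obtain ⟨K, hK, -, -, h3⟩ := exists_bounds hH (2 * ρ)
  refine ⟨K, hK, fun f g hf hg => ?_⟩
  have hfx : ∀ x, ‖f x‖ ≤ 2 * ρ := fun x => (norm_apply_le f x).trans (by linarith)
  have hgx : ∀ x, ‖g x‖ ≤ 2 * ρ := fun x => (norm_apply_le g x).trans (by linarith)
  -- The remainder is quadratic at each point, hence bounded by the mass of `g - f` rather than by
  -- its energy norm; `IsFlow.hasDerivAt_lpPow` depends on this.
  have hpt : ∀ x, |‖g x‖ ^ (p + 1) - ‖f x‖ ^ (p + 1)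
      - (p + 1) * (nonlin p (f x) * conj ((g - f : EnergySpace γ) x)).re|
      ≤ K * ‖(g - f : EnergySpace γ) x‖ ^ 2 := by
    intro x
    rw [← fderiv_norm_rpow_apply hp, sub_apply, ← Real.norm_eq_abs, pow_two, ← mul_assoc]
    refine (convex_segment (f x) (g x)).norm_image_sub_le_of_norm_fderiv_le'
      (f := fun z : ℂ => ‖z‖ ^ (p + 1)) (𝕜 := ℝ)
      (fun z _ => (hH.differentiable two_ne_zero).differentiableAt) (fun z hz => ?_)
      (left_mem_segment ℝ _ _) (right_mem_segment ℝ _ _)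
    have hzb : ‖z‖ ≤ 2 * ρ := by
      have h0 := (convex_closedBall (0 : ℂ) (2 * ρ)).segment_subset
        (by simpa using hfx x) (by simpa using hgx x) hz
      simpa using h0
    refine (h3 _ _ hzb (hfx x)).trans ?_
    gcongr
    obtain ⟨θ, ⟨h0, h1⟩, rfl⟩ := (segment_eq_image' ℝ (f x) (g x)) ▸ hz
    simp only [add_sub_cancel_left, norm_smul, Real.norm_eq_abs, abs_of_nonneg h0]
    exact mul_le_of_le_one_left (norm_nonneg _) h1
  have hi := integrable_mul_conj (nonlinMap hp f).memH1.memLp (g - f).memH1.memLp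
  have e : lpPow p g - lpPow p f - (p + 1) * (inner ℂ (resolvent (g - f)) (nonlinMap hp f)).re
      = ∫ x, (‖g x‖ ^ (p + 1) - ‖f x‖ ^ (p + 1)
        - (p + 1) * (nonlin p (f x) * conj ((g - f : EnergySpace γ) x)).re) := by
    have j1 : Integrable fun x => ‖g x‖ ^ (p + 1) - ‖f x‖ ^ (p + 1) :=
      (integrable_norm_rpow hp g).sub (integrable_norm_rpow hp f)
    have j2 : Integrable fun x => (p + 1) * (nonlin p (f x) * conj ((g - f : EnergySpace γ) x)).re :=
      hi.re.const_mul _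
    rw [integral_sub j1 j2, integral_sub (integrable_norm_rpow hp g) (integrable_norm_rpow hp f),
      integral_const_mul, inner_resolvent_left]
    simp only [mul_comm (conj _)]
    have h5 : ∫ x, (nonlin p (f x) * conj ((g - f : EnergySpace γ) x)).re
        = (∫ x, nonlin p (f x) * conj ((g - f : EnergySpace γ) x)).re := integral_re hi
    rw [h5]
    rfl
  rw [e, ← Real.norm_eq_abs, mass, ← integral_const_mul]
  exact norm_integral_le_of_norm_le ((g - f).memH1.integrable_sq.const_mul K)
    (Eventually.of_forall hpt)

end EnergySpace

/-! ### The flow in the energy space -/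

section Abstract

variable {V : Type*} [NormedAddCommGroup V] [InnerProductSpace ℂ V]

/-- A weak derivative that is continuous is a strong derivative. -/
lemma hasDerivAt_of_weak {y k : ℝ → V} {I : Set ℝ} (hI : IsOpen I) (hk : ContinuousOn k I)
    (h : ∀ φ : V, ∀ t ∈ I, HasDerivAt (fun s => inner ℂ φ (y s)) (inner ℂ φ (k t)) t)
    {t : ℝ} (ht : t ∈ I) : HasDerivAt y (k t) t := by
  rw [hasDerivAt_iff_isLittleO, Asymptotics.isLittleO_iff]
  intro ε hε
  have hct : ContinuousAt k t := hk.continuousAt (hI.mem_nhds ht)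
  obtain ⟨δ, hδ, hball⟩ := Metric.mem_nhds_iff.mp
    (inter_mem (hI.mem_nhds ht) (hct.preimage_mem_nhds (Metric.closedBall_mem_nhds (k t) hε)))
  filter_upwards [Metric.ball_mem_nhds t hδ] with s hs
  -- The error itself serves as test vector, and the mean value inequality gives `‖D‖² ≤ ‖D‖ ε |s -
  -- t|`.
  set D := y s - y t - (s - t) • k t with hD
  have hder : ∀ r ∈ Metric.ball t δ, HasDerivWithinAt
      (fun r => inner ℂ D (y r) - (r : ℂ) * inner ℂ D (k t))
      (inner ℂ D (k r) - 1 * inner ℂ D (k t)) (Metric.ball t δ) r := by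
    intro r hr
    refine HasDerivAt.hasDerivWithinAt ((h D r (hball hr).1).sub ?_)
    exact (Complex.ofRealCLM.hasDerivAt (x := r)).mul_const _
  have hmv := (convex_ball t δ).norm_image_sub_le_of_norm_hasDerivWithin_le (C := ‖D‖ * ε)
    hder (fun r hr => by
      rw [one_mul, ← inner_sub_right]
      refine (norm_inner_le_norm _ _).trans ?_
      gcongr
      have := (hball hr).2
      simpa [dist_eq_norm] using this) (Metric.mem_ball_self hδ) hs
  have e : (inner ℂ D (y s) - (s : ℂ) * inner ℂ D (k t))
      - (inner ℂ D (y t) - (t : ℂ) * inner ℂ D (k t)) = inner ℂ D D := by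
    nth_rw 6 [hD]
    rw [inner_sub_right, inner_sub_right, ← Complex.coe_smul, inner_smul_right]
    push_cast
    ring
  rw [e, inner_self_eq_norm_sq_to_K] at hmv
  simp only [norm_pow, RCLike.norm_ofReal, abs_norm] at hmv
  rcases (norm_nonneg D).eq_or_lt with h0 | h0
  · rw [← h0]
    positivity
  · have : ‖D‖ * ‖D‖ ≤ ‖D‖ * (ε * ‖s - t‖) := by linarith
    exact le_of_mul_le_mul_left this h0

/-- If `R ∘ v` has the derivative `R ∘ k` with `k` continuous and `R` injective, then `v` has the
derivative `k`. -/
lemma hasDerivAt_of_map [CompleteSpace V] {R : V →L[ℂ] V} (hinj : Function.Injective R)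
    {v k : ℝ → V} {I : Set ℝ} (hI : IsOpen I) (hk : ContinuousOn k I)
    (h : ∀ t ∈ I, HasDerivAt (fun s => R (v s)) (R (k t)) t) {t : ℝ} (ht : t ∈ I) :
    HasDerivAt v (k t) t := by
  obtain ⟨δ, hδ, hball⟩ := Metric.mem_nhds_iff.mp (hI.mem_nhds ht)
  have hint : ∀ s ∈ Metric.ball t δ, IntervalIntegrable k volume t s := by
    intro s hs
    refine ContinuousOn.intervalIntegrable (hk.mono ((Set.OrdConnected.uIcc_subset ?_
      (Metric.mem_ball_self hδ) hs).trans hball))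
    exact (convex_ball t δ).ordConnected
  have hw : ∀ s ∈ Metric.ball t δ, HasDerivAt (fun r => ∫ τ in t..r, k τ) (k s) s := by
    intro s hs
    exact intervalIntegral.integral_hasDerivAt_right (hint s hs)
      (hk.stronglyMeasurableAtFilter hI s (hball hs)) (hk.continuousAt (hI.mem_nhds (hball hs)))
  have hR : ∀ s ∈ Metric.ball t δ, HasDerivAt (fun r => R (v t + ∫ τ in t..r, k τ)) (R (k s)) s :=
    fun s hs => (R.restrictScalars ℝ).hasFDerivAt.comp_hasDerivAt s ((hw s hs).const_add _)
  -- After applying `R`, `v` and the integral of `k` have the same derivative and agree at `t`;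
  -- injectivity then removes `R`.
  have heq : Set.EqOn (fun r => R (v r)) (fun r => R (v t + ∫ τ in t..r, k τ))
      (Metric.ball t δ) := by
    refine Metric.isOpen_ball.eqOn_of_deriv_eq (convex_ball t δ).isPreconnected
      (fun s hs => (h s (hball hs)).differentiableAt.differentiableWithinAt)
      (fun s hs => (hR s hs).differentiableAt.differentiableWithinAt)
      (fun s hs => ?_) (Metric.mem_ball_self hδ) (by simp)
    rw [(h s (hball hs)).deriv, (hR s hs).deriv]
  refine ((hw t (Metric.mem_ball_self hδ)).const_add (v t)).congr_of_eventuallyEq ?_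
  filter_upwards [Metric.ball_mem_nhds t hδ] with s hs
  exact hinj (heq hs)

end Abstract

namespace EnergySpace

variable {γ p : ℝ} (hp : 5 < p)

/-- The linear propagator. -/
abbrev propagator (t : ℝ) : EnergySpace γ →L[ℂ] EnergySpace γ := unitaryGroup resolvent t

/-- The source term `f + |f|^{p-1} f` of the evolution. -/
def source (f : EnergySpace γ) : EnergySpace γ := f + nonlinMap hp f

lemma source_lipschitz (ρ : ℝ) : ∃ K : NNReal,
    LipschitzOnWith K (source hp) (Metric.closedBall (0 : EnergySpace γ) ρ) := by
  obtain ⟨K, hK, h⟩ := compMap_lipschitz (γ := γ) (contDiff_nonlin hp) nonlin_zero ρ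
  refine ⟨1 + K.toNNReal, LipschitzOnWith.of_dist_le_mul fun f hf g hg => ?_⟩
  rw [dist_eq_norm, dist_eq_norm]
  have e : source hp f - source hp g = (f - g) + (nonlinMap hp f - nonlinMap hp g) := by
    simp only [source]
    abel
  rw [e]
  refine (norm_add_le _ _).trans ?_
  have := h f g (by simpa using hf) (by simpa using hg)
  calc _ ≤ ‖f - g‖ + K * ‖f - g‖ := by gcongr; exact this
    _ = _ := by rw [NNReal.coe_add, NNReal.coe_one, Real.coe_toNNReal _ hK]; ring

lemma continuous_source : Continuous (source hp : EnergySpace γ → EnergySpace γ) := by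
  rw [continuous_iff_continuousAt]
  intro f
  obtain ⟨K, hK⟩ := source_lipschitz (γ := γ) hp (‖f‖ + 1)
  exact hK.continuousOn.continuousAt (mem_of_superset (Metric.ball_mem_nhds f one_pos)
    fun g hg => by
      have h1 : ‖g - f‖ < 1 := by simpa [dist_eq_norm] using hg
      have h2 := norm_le_norm_add_norm_sub' g f
      simp only [mem_closedBall_zero_iff]
      linarith)

lemma source_zero : source hp (0 : EnergySpace γ) = 0 := by
  ext x
  change (0 : ℂ) + nonlin p 0 = 0
  rw [nonlin_zero, add_zero]

/-- Solutions of the evolution equation in the energy space. -/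
structure IsFlow (I : Set ℝ) (u : ℝ → EnergySpace γ) : Prop where
  continuousOn : ContinuousOn u I
  -- This is `∂ₜu = i(Δ_γ u + |u|^{p-1}u)` after applying `(1 - Δ_γ)⁻¹`, so that both sides lie in
  -- `H¹`. The linear term in `source` compensates the `1` in `1 - Δ_γ`.
  hasDerivAt : ∀ t ∈ I, HasDerivAt (fun s => resolvent (u s))
    (Complex.I • (resolvent (source hp (u t)) - u t)) t

/-- The vector field of the equation in the interaction picture. -/
def field (t : ℝ) (v : EnergySpace γ) : EnergySpace γ :=
  Complex.I • propagator (-t) (source hp (propagator t v))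

lemma norm_propagator (t : ℝ) (f : EnergySpace γ) : ‖propagator t f‖ = ‖f‖ :=
  norm_unitaryGroup isSelfAdjoint_resolvent injective_resolvent t f

lemma propagator_apply_neg (t : ℝ) (f : EnergySpace γ) :
    propagator t (propagator (-t) f) = f :=
  unitaryGroup_apply_neg isSelfAdjoint_resolvent injective_resolvent t f

lemma resolvent_propagator (t : ℝ) (f : EnergySpace γ) :
    resolvent (propagator t f) = propagator t (resolvent f) :=
  map_unitaryGroup isSelfAdjoint_resolvent injective_resolvent t f

lemma inner_propagator (t : ℝ) (f g : EnergySpace γ) :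
    inner ℂ (propagator t f) (propagator t g) = inner ℂ f g :=
  inner_unitaryGroup isSelfAdjoint_resolvent injective_resolvent t f g

lemma continuousOn_propagator {I : Set ℝ} {φ : ℝ → ℝ} (hφ : ContinuousOn φ I)
    {v : ℝ → EnergySpace γ} (hv : ContinuousOn v I) :
    ContinuousOn (fun t => propagator (φ t) (v t)) I :=
  fun t ht => tendsto_unitaryGroup isSelfAdjoint_resolvent injective_resolvent (hφ t ht) (hv t ht)

lemma continuousOn_field {I : Set ℝ} {v : ℝ → EnergySpace γ} (hv : ContinuousOn v I) :
    ContinuousOn (fun t => field hp t (v t)) I := by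
  have h := continuousOn_propagator continuous_neg.continuousOn
    ((continuous_source hp).comp_continuousOn (continuousOn_propagator continuousOn_id hv))
  exact h.const_smul Complex.I

/-- The propagator is isometric, so the Lipschitz constant of the source serves at all times. -/
lemma field_lipschitz (ρ : ℝ) : ∃ K : NNReal, ∀ t,
    LipschitzOnWith K (field hp t) (Metric.closedBall (0 : EnergySpace γ) ρ) := by
  obtain ⟨K, hK⟩ := source_lipschitz (γ := γ) hp ρ
  refine ⟨K, fun t => LipschitzOnWith.of_dist_le_mul fun f hf g hg => ?_⟩
  rw [dist_eq_norm, field, field, ← smul_sub, ← map_sub, norm_smul, Complex.norm_I, one_mul,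
    norm_propagator, ← dist_eq_norm]
  refine (hK.dist_le_mul _ ?_ _ ?_).trans ?_
  · simpa [norm_propagator] using hf
  · simpa [norm_propagator] using hg
  · rw [dist_eq_norm, ← map_sub, norm_propagator, dist_eq_norm]

variable {hp}

/-- The interaction picture of a flow solves an ordinary differential equation. -/
lemma IsFlow.hasDerivAt_propagator {I : Set ℝ} (hI : IsOpen I) {u : ℝ → EnergySpace γ}
    (hu : IsFlow hp I u) {t : ℝ} (ht : t ∈ I) :
    HasDerivAt (fun s => propagator (-s) (u s)) (field hp t (propagator (-t) (u t))) t := by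
  refine hasDerivAt_of_map (k := fun t => field hp t (propagator (-t) (u t)))
    injective_resolvent hI
    (continuousOn_field hp (continuousOn_propagator continuous_neg.continuousOn hu.continuousOn))
    (fun t ht => ?_) ht
  have h := hasDerivAt_unitaryGroup_mul isSelfAdjoint_resolvent injective_resolvent (-1)
    (hu.hasDerivAt t ht) rfl
  simp only [neg_one_mul] at h
  simp only [resolvent_propagator]
  convert! h using 1
  rw [field, propagator_apply_neg, map_smul, resolvent_propagator, ← map_smul]
  congr 1
  push_cast
  rw [smul_sub, neg_mul, one_mul, neg_smul]
  abel

lemma isFlow_of_hasDerivAt_propagator {I : Set ℝ} {v : ℝ → EnergySpace γ}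
    (hv : ∀ t ∈ I, HasDerivAt v (field hp t (v t)) t) :
    IsFlow hp I fun t => propagator t (v t) := by
  have hc : ContinuousOn v I := fun t ht => (hv t ht).continuousAt.continuousWithinAt
  refine ⟨continuousOn_propagator continuousOn_id hc, fun t ht => ?_⟩
  have h1 : HasDerivAt (fun s => resolvent (v s)) (resolvent (field hp t (v t))) t :=
    (resolvent.restrictScalars ℝ).hasFDerivAt.comp_hasDerivAt t (hv t ht)
  have h := hasDerivAt_unitaryGroup_mul isSelfAdjoint_resolvent injective_resolvent 1 h1 rfl
  simp only [one_mul] at h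
  simp only [resolvent_propagator]
  convert! h using 1
  rw [field, map_smul, resolvent_propagator, map_sub, map_smul, map_smul]
  change _ = Complex.I • propagator t (propagator (-t) _) - _
  rw [propagator_apply_neg]
  push_cast
  rw [one_mul, smul_sub]

lemma exists_Icc_subset {I : Set ℝ} (hI : IsOpen I) (hI' : I.OrdConnected) {s t : ℝ}
    (hs : s ∈ I) (ht : t ∈ I) :
    ∃ a b : ℝ, s ∈ Set.Ioo a b ∧ t ∈ Set.Ioo a b ∧ Set.Icc a b ⊆ I := by
  have key : ∀ r ∈ I, ∃ ε > 0, r - ε ∈ I ∧ r + ε ∈ I := by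
    intro r hr
    obtain ⟨δ, hδ, hb⟩ := Metric.isOpen_iff.mp hI r hr
    refine ⟨δ / 2, by positivity, hb ?_, hb ?_⟩ <;>
      simp only [Metric.mem_ball, Real.dist_eq, sub_sub_cancel_left, add_sub_cancel_left, abs_neg] <;>
      rw [abs_of_pos (by positivity)] <;> linarith
  obtain ⟨ε, hε, h1, h2⟩ := key s hs
  obtain ⟨ε', hε', h3, h4⟩ := key t ht
  rcases le_total (s - ε) (t - ε') with ha | ha <;> rcases le_total (s + ε) (t + ε') with hb | hb
  · exact ⟨s - ε, t + ε', ⟨by linarith, by linarith⟩, ⟨by linarith, by linarith⟩, hI'.out h1 h4⟩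
  · exact ⟨s - ε, s + ε, ⟨by linarith, by linarith⟩, ⟨by linarith, by linarith⟩, hI'.out h1 h2⟩
  · exact ⟨t - ε', t + ε', ⟨by linarith, by linarith⟩, ⟨by linarith, by linarith⟩, hI'.out h3 h4⟩
  · exact ⟨t - ε', s + ε, ⟨by linarith, by linarith⟩, ⟨by linarith, by linarith⟩, hI'.out h3 h2⟩

lemma IsFlow.eqOn {I : Set ℝ} (hI : IsOpen I) (hI' : I.OrdConnected) {u w : ℝ → EnergySpace γ}
    (hu : IsFlow hp I u) (hw : IsFlow hp I w) {t₀ : ℝ} (ht₀ : t₀ ∈ I) (h : u t₀ = w t₀) :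
    Set.EqOn u w I := by
  intro t ht
  obtain ⟨a, b, hs, ht', hab⟩ := exists_Icc_subset hI hI' ht₀ ht
  obtain ⟨C₁, hC₁⟩ := isCompact_Icc.exists_bound_of_continuousOn (hu.continuousOn.mono hab)
  obtain ⟨C₂, hC₂⟩ := isCompact_Icc.exists_bound_of_continuousOn (hw.continuousOn.mono hab)
  obtain ⟨K, hK⟩ := field_lipschitz (γ := γ) hp (max C₁ C₂)
  have hsub : Set.Ioo a b ⊆ I := Set.Ioo_subset_Icc_self.trans hab
  have := ODE_solution_unique_of_mem_Ioo (v := field hp)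
    (f := fun s => propagator (-s) (u s)) (g := fun s => propagator (-s) (w s))
    (s := fun _ => Metric.closedBall 0 (max C₁ C₂)) (fun t _ => hK t) hs
    (fun r hr => ⟨hu.hasDerivAt_propagator hI (hsub hr), by
      simpa [norm_propagator] using Or.inl (hC₁ r (Set.Ioo_subset_Icc_self hr))⟩)
    (fun r hr => ⟨hw.hasDerivAt_propagator hI (hsub hr), by
      simpa [norm_propagator] using Or.inr (hC₂ r (Set.Ioo_subset_Icc_self hr))⟩)
    (by simp only [h]) ht'
  have h2 := congrArg (propagator t) this
  simpa only [propagator_apply_neg] using h2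

variable (γ hp) in
/-- Local existence, on a time interval that depends only on the norm of the datum. -/
lemma exists_isFlow (ρ : ℝ) : ∃ T > 0, ∀ (t₀ : ℝ) (f : EnergySpace γ), ‖f‖ ≤ ρ →
    ∃ u : ℝ → EnergySpace γ, u t₀ = f ∧ IsFlow hp (Set.Ioo (t₀ - T) (t₀ + T)) u := by
  obtain ⟨K, hK⟩ := field_lipschitz (γ := γ) hp (|ρ| + 1)
  -- The field vanishes at zero, so `B` bounds it on the ball of radius `|ρ| + 1`. During a time `1
  -- / (B + 1)` the solution stays within distance one of its datum.
  set B : NNReal := K * (|ρ| + 1).toNNReal with hB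
  have hfield : ∀ t, ∀ v ∈ Metric.closedBall (0 : EnergySpace γ) (|ρ| + 1),
      ‖field hp t v‖ ≤ B := by
    intro t v hv
    have h0 : field hp t (0 : EnergySpace γ) = 0 := by
      rw [field, map_zero, source_zero, map_zero, smul_zero]
    have h1 := (hK t).norm_sub_le hv (Metric.mem_closedBall_self (by positivity))
    rw [h0, sub_zero, sub_zero] at h1
    refine h1.trans ?_
    rw [hB, NNReal.coe_mul, Real.coe_toNNReal _ (by positivity)]
    gcongr
    simpa using hv
  have hT : (0 : ℝ) < 1 / (B + 1) := by positivity
  refine ⟨1 / (B + 1), hT, fun t₀ f hf => ?_⟩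
  set T : ℝ := 1 / (B + 1)
  have hsub : Metric.closedBall (propagator (-t₀) f) (1 : NNReal) ⊆
      Metric.closedBall (0 : EnergySpace γ) (|ρ| + 1) := by
    refine Metric.closedBall_subset_closedBall' ?_
    rw [dist_zero_right, norm_propagator, NNReal.coe_one]
    linarith [hf.trans (le_abs_self ρ)]
  have hPL : IsPicardLindelof (field hp) (tmin := t₀ - T) (tmax := t₀ + T)
      ⟨t₀, by constructor <;> linarith⟩ (propagator (-t₀) f) 1 0 B K := by
    refine ⟨fun t _ => (hK t).mono hsub, fun v _ => continuousOn_field hp continuousOn_const,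
      fun t _ v hv => hfield t v (hsub hv), ?_⟩
    simp only [add_sub_cancel_left, sub_sub_cancel, max_self, NNReal.coe_one, NNReal.coe_zero,
      sub_zero, T]
    rw [mul_one_div, div_le_one (by positivity)]
    linarith
  obtain ⟨v, hv0, hv⟩ := hPL.exists_eq_forall_mem_Icc_hasDerivWithinAt₀
  refine ⟨fun t => propagator t (v t), ?_, isFlow_of_hasDerivAt_propagator fun t ht => ?_⟩
  · simp only at hv0 ⊢
    rw [hv0, propagator_apply_neg]
  · exact (hv t (Set.Ioo_subset_Icc_self ht)).hasDerivAt (Icc_mem_nhds ht.1 ht.2)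

lemma mass_propagator (t : ℝ) (f : EnergySpace γ) : mass (propagator t f) = mass f := by
  have h := inner_resolvent_self (propagator t f)
  rw [resolvent_propagator, inner_propagator, inner_resolvent_self] at h
  exact_mod_cast h.symm

lemma inner_resolvent_source_im (f : EnergySpace γ) :
    (inner ℂ (resolvent f) (source hp f)).im = 0 := by
  have h : inner ℂ (resolvent f) (nonlinMap hp f) = inner ℂ f (resolvent (nonlinMap hp f)) := by
    rw [inner_resolvent_left, inner_resolvent_right]
  rw [source, inner_add_right, inner_resolvent_self, h, inner_resolvent_nonlinMap hp]
  simp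

lemma eqOn_const {I : Set ℝ} (hI : IsOpen I) (hI' : I.OrdConnected) {F : ℝ → ℝ}
    (h : ∀ t ∈ I, HasDerivAt F 0 t) {s t : ℝ} (hs : s ∈ I) (ht : t ∈ I) : F s = F t :=
  hI.is_const_of_deriv_eq_zero (isPreconnected_iff_ordConnected.mpr hI')
    (fun t ht => (h t ht).differentiableAt.differentiableWithinAt)
    (fun t ht => (h t ht).deriv) hs ht

/-- Conservation of mass. -/
lemma IsFlow.mass_eq {I : Set ℝ} (hI : IsOpen I) (hI' : I.OrdConnected) {u : ℝ → EnergySpace γ}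
    (hu : IsFlow hp I u) {s t : ℝ} (hs : s ∈ I) (ht : t ∈ I) : mass (u s) = mass (u t) := by
  refine eqOn_const hI hI' (F := fun t => mass (u t)) (fun t ht => ?_) hs ht
  have hv := hu.hasDerivAt_propagator hI ht
  have h1 : HasDerivAt (fun s => resolvent (propagator (-s) (u s)))
      (resolvent (field hp t (propagator (-t) (u t)))) t :=
    (resolvent.restrictScalars ℝ).hasFDerivAt.comp_hasDerivAt t hv
  have h2 := Complex.reCLM.hasFDerivAt.comp_hasDerivAt t (h1.inner ℂ hv)
  convert! h2 using 1
  · funext s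
    simp only [Function.comp_apply, inner_resolvent_self, mass_propagator]
    simp
  · have e1 : inner ℂ (resolvent (field hp t (propagator (-t) (u t)))) (propagator (-t) (u t))
        = conj (inner ℂ (resolvent (propagator (-t) (u t)))
          (field hp t (propagator (-t) (u t)))) := by
      rw [inner_conj_symm, inner_resolvent_left, inner_resolvent_right]
    have e2 : inner ℂ (resolvent (propagator (-t) (u t))) (field hp t (propagator (-t) (u t)))
        = Complex.I * inner ℂ (resolvent (u t)) (source hp (u t)) := by
      rw [field, inner_smul_right, resolvent_propagator, propagator_apply_neg, inner_propagator]
    rw [e1, e2, Complex.reCLM_apply, Complex.add_re, Complex.conj_re, Complex.mul_re,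
      inner_resolvent_source_im]
    simp

/-- The curve `u` is known to be differentiable only after applying `resolvent`, but its interaction
picture has the same norm and is differentiable. The linear part of the source contributes `i‖u‖²`,
which has no real part. -/
lemma IsFlow.hasDerivAt_norm_sq {I : Set ℝ} (hI : IsOpen I) {u : ℝ → EnergySpace γ}
    (hu : IsFlow hp I u) {t : ℝ} (ht : t ∈ I) :
    HasDerivAt (fun s => ‖u s‖ ^ 2)
      (2 * (Complex.I * inner ℂ (u t) (nonlinMap hp (u t))).re) t := by
  have hv := hu.hasDerivAt_propagator hI ht
  have h2 := Complex.reCLM.hasFDerivAt.comp_hasDerivAt t (hv.inner ℂ hv)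
  convert! h2 using 1
  · funext s
    simp only [Function.comp_apply, inner_self_eq_norm_sq_to_K, norm_propagator]
    simp [← Complex.ofReal_pow]
  · have e1 : inner ℂ (field hp t (propagator (-t) (u t))) (propagator (-t) (u t))
        = conj (inner ℂ (propagator (-t) (u t)) (field hp t (propagator (-t) (u t)))) := by
      rw [inner_conj_symm]
    have e2 : inner ℂ (propagator (-t) (u t)) (field hp t (propagator (-t) (u t)))
        = Complex.I * (((‖u t‖ ^ 2 : ℝ) : ℂ) + inner ℂ (u t) (nonlinMap hp (u t))) := by
      rw [field, inner_smul_right, propagator_apply_neg, inner_propagator, source,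
        inner_add_right, inner_self_eq_norm_sq_to_K]
      push_cast
      rfl
    rw [e1, e2, Complex.reCLM_apply, Complex.add_re, Complex.conj_re, mul_add, Complex.add_re]
    have e3 : (Complex.I * ((‖u t‖ ^ 2 : ℝ) : ℂ)).re = 0 := by simp [-Complex.ofReal_pow]
    rw [e3]
    ring

lemma mass_eq_re (f : EnergySpace γ) : mass f = (inner ℂ (resolvent f) f).re := by
  rw [inner_resolvent_self, Complex.ofReal_re]

/-- The linear term of `lpPow_expansion` sees only `resolvent (u s - u t)`, which is differentiable.
The remainder is controlled by the mass of `u s - u t`, which is `⟨resolvent (u s - u t), u s - u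
t⟩`, a product of `O(s - t)` and `o(1)`. -/
lemma IsFlow.hasDerivAt_lpPow {I : Set ℝ} (hI : IsOpen I) {u : ℝ → EnergySpace γ}
    (hu : IsFlow hp I u) {t : ℝ} (ht : t ∈ I) :
    HasDerivAt (fun s => lpPow p (u s))
      ((p + 1) * (Complex.I * inner ℂ (u t) (nonlinMap hp (u t))).re) t := by
  have hct : ContinuousAt u t := hu.continuousOn.continuousAt (hI.mem_nhds ht)
  obtain ⟨C, hC, hexp⟩ := lpPow_expansion (γ := γ) hp (‖u t‖ + 1)
  have hlin : HasDerivAt (fun s => (p + 1) *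
      (inner ℂ (resolvent (u s - u t)) (nonlinMap hp (u t))).re)
      ((p + 1) * (Complex.I * inner ℂ (u t) (nonlinMap hp (u t))).re) t := by
    have h1 := (((hu.hasDerivAt t ht).sub_const (resolvent (u t))).inner ℂ
      (hasDerivAt_const t (nonlinMap hp (u t))))
    have h2 := (Complex.reCLM.hasFDerivAt.comp_hasDerivAt t h1).const_mul (p + 1)
    simp only [Function.comp_def, ← map_sub] at h2
    convert! h2 using 1
    rw [inner_zero_right, zero_add, Complex.reCLM_apply, inner_smul_left, inner_sub_left]
    have h3 : (inner ℂ (resolvent (source hp (u t))) (nonlinMap hp (u t))).im = 0 := by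
      have h4 : inner ℂ (resolvent (u t)) (nonlinMap hp (u t)) = (lpPow p (u t) : ℂ) := by
        rw [← inner_resolvent_nonlinMap hp, inner_resolvent_left, inner_resolvent_right]
      rw [source, map_add, inner_add_left, h4, inner_resolvent_self]
      simp
    congr 1
    simp [Complex.mul_re, h3]
  have hrem : HasDerivAt (fun s => lpPow p (u s) - lpPow p (u t) - (p + 1) *
      (inner ℂ (resolvent (u s - u t)) (nonlinMap hp (u t))).re) 0 t := by
    rw [hasDerivAt_iff_isLittleO]
    have hb : ∀ᶠ s in 𝓝 t, ‖lpPow p (u s) - lpPow p (u t) - (p + 1) *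
        (inner ℂ (resolvent (u s - u t)) (nonlinMap hp (u t))).re‖
        ≤ C * ‖‖resolvent (u s) - resolvent (u t)‖ * ‖u s - u t‖‖ := by
      filter_upwards [hct.preimage_mem_nhds (Metric.ball_mem_nhds (u t) one_pos)] with s hs
      have h1 : ‖u s - u t‖ < 1 := by simpa [dist_eq_norm] using hs
      have h2 := norm_le_norm_add_norm_sub' (u s) (u t)
      refine (hexp (u t) (u s) (by linarith) (by linarith)).trans ?_
      gcongr
      rw [mass_eq_re, map_sub, Real.norm_of_nonneg (by positivity)]
      exact (Complex.re_le_norm _).trans (norm_inner_le_norm _ _)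
    have h3 : (fun s => ‖resolvent (u s) - resolvent (u t)‖ * ‖u s - u t‖) =o[𝓝 t]
        fun s => s - t := by
      have h4 := (hu.hasDerivAt t ht).isBigO_sub.norm_left
      have h5 : Tendsto (fun s => ‖u s - u t‖) (𝓝 t) (𝓝 0) :=
        tendsto_iff_norm_sub_tendsto_zero.mp hct
      have h6 := h4.mul_isLittleO ((Asymptotics.isLittleO_one_iff ℝ).mpr h5)
      simpa using h6
    have h7 := (Asymptotics.IsBigO.of_bound C hb).trans_isLittleO h3
    simpa using h7
  have := (hrem.add hlin).add_const (lpPow p (u t))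
  simp only [zero_add] at this
  convert! this using 2 with s
  simp

/-- Conservation of energy. -/
lemma IsFlow.energy_eq (hγ : γ < 0) {I : Set ℝ} (hI : IsOpen I) (hI' : I.OrdConnected)
    {u : ℝ → EnergySpace γ} (hu : IsFlow hp I u) {s t : ℝ} (hs : s ∈ I) (ht : t ∈ I) :
    energy p γ (u s) = energy p γ (u t) := by
  -- This differs from the energy by half of the conserved mass, and the derivatives of its two
  -- terms cancel.
  have h : ∀ t ∈ I, HasDerivAt (fun s => 1 / 2 * ‖u s‖ ^ 2 - 1 / (p + 1) * lpPow p (u s)) 0 t := by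
    intro t ht
    have := ((hu.hasDerivAt_norm_sq hI ht).const_mul (1 / 2)).sub
      ((hu.hasDerivAt_lpPow hI ht).const_mul (1 / (p + 1)))
    convert! this using 1
    have : p + 1 ≠ 0 := by linarith
    field_simp
    ring
  have h1 := eqOn_const hI hI' h hs ht
  have h2 := hu.mass_eq hI hI' hs ht
  simp only [energy, hdotNormSq_eq hγ]
  rw [h2]
  linarith

end EnergySpace

/-! ### Solutions and flows -/

namespace EnergySpace

variable {γ p : ℝ} {hp : 5 < p}

open scoped Classical in
/-- A function as an element of the energy space (zero if it is not in `H¹`). -/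
def lift (f : ℝ → ℂ) : EnergySpace γ := if h : MemH1 f then mk f h else 0

lemma coe_lift {f : ℝ → ℂ} (hf : MemH1 f) : (lift f : EnergySpace γ) = f := by
  rw [lift, dif_pos hf]
  rfl

lemma inner_equation (hγ : γ < 0) (f φ : EnergySpace γ) :
    Complex.I * (-form γ f φ + ∫ x, nonlin p (f x) * conj (φ x))
      = inner ℂ φ (Complex.I • (resolvent (source hp f) - f)) := by
  have h : ∫ x, nonlin p (f x) * conj (φ x) = inner ℂ φ (resolvent (nonlinMap hp f)) := by
    rw [inner_resolvent_right]
    simp only [nonlinMap_apply, mul_comm (conj _)]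
  rw [form_eq hγ, h, inner_smul_right, inner_sub_right, source, map_add, inner_add_right]
  ring

/-- A solution is a flow in the energy space. -/
lemma isFlow_lift (hγ : γ < 0) {u₀ : ℝ → ℂ} {I : Set ℝ} {u : ℝ → ℝ → ℂ}
    (hu : IsSolution p γ u₀ I u) : IsFlow hp I fun t => (lift (u t) : EnergySpace γ) := by
  have hc : ContinuousOn (fun t => (lift (u t) : EnergySpace γ)) I := by
    intro t ht
    refine ContinuousAt.continuousWithinAt ?_
    rw [ContinuousAt, tendsto_iff_norm_sub_tendsto_zero]
    have h1 : Tendsto (fun s => √((1 + 2 * |γ|) * h1NormSq (fun x => u s x - u t x))) (𝓝 t)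
        (𝓝 0) := by
      have := (Real.continuous_sqrt.tendsto 0).comp
        (by simpa using (hu.continuous t ht).const_mul (1 + 2 * |γ|))
      simpa [Function.comp_def] using this
    refine squeeze_zero' (Eventually.of_forall fun s => norm_nonneg _) ?_ h1
    filter_upwards [hu.isOpen.mem_nhds ht] with s hs
    refine Real.le_sqrt_of_sq_le ((norm_sq_le _).trans (le_of_eq ?_))
    congr 2
    funext x
    rw [sub_apply, coe_lift (hu.memH1 s hs), coe_lift (hu.memH1 t ht)]
  refine ⟨hc, fun t ht => ?_⟩
  refine hasDerivAt_of_weak (k := fun t => Complex.I • (resolvent (source hp (lift (u t)))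
    - lift (u t))) hu.isOpen ?_ (fun φ t ht => ?_) ht
  · exact ((resolvent.continuous.comp_continuousOn
      ((continuous_source hp).comp_continuousOn hc)).sub hc).const_smul Complex.I
  · have h := hu.equation φ φ.memH1 t ht
    rw [← coe_lift (γ := γ) (hu.memH1 t ht), inner_equation (hp := hp) hγ] at h
    refine h.congr_of_eventuallyEq ?_
    filter_upwards [hu.isOpen.mem_nhds ht] with s hs
    rw [inner_resolvent_right, coe_lift (hu.memH1 s hs)]
    simp only [mul_comm (conj _)]

/-- A flow in the energy space is a solution. -/
lemma IsFlow.isSolution (hγ : γ < 0) {I : Set ℝ} (hI : IsOpen I) (hI' : I.OrdConnected)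
    (h0 : 0 ∈ I) {u : ℝ → EnergySpace γ} (hu : IsFlow hp I u) :
    IsSolution p γ (u 0) I fun t => u t where
  isOpen := hI
  ordConnected := hI'
  zero_mem := h0
  initial := rfl
  memH1 t _ := (u t).memH1
  continuous t ht := by
    have h1 : Tendsto (fun s => ‖u s - u t‖ ^ 2) (𝓝 t) (𝓝 0) := by
      have := (tendsto_iff_norm_sub_tendsto_zero.mp
        (hu.continuousOn.continuousAt (hI.mem_nhds ht))).pow 2
      simpa using this
    exact squeeze_zero (fun s => h1NormSq_nonneg _) (fun s => h1NormSq_le (u s - u t)) h1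
  equation φ hφ t ht := by
    have h := inner_equation (hp := hp) hγ (u t) (EnergySpace.mk φ hφ)
    have h2 := (hasDerivAt_const t (EnergySpace.mk φ hφ : EnergySpace γ)).inner ℂ (hu.hasDerivAt t ht)
    rw [inner_zero_left, add_zero, ← h] at h2
    convert! h2 using 1
    funext s
    rw [inner_resolvent_right]
    simp only [mul_comm (conj _)]
    rfl

lemma IsFlow.mono {I J : Set ℝ} (h : J ⊆ I) {u : ℝ → EnergySpace γ} (hu : IsFlow hp I u) :
    IsFlow hp J u :=
  ⟨hu.continuousOn.mono h, fun t ht => hu.hasDerivAt t (h ht)⟩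

lemma IsFlow.congr {I : Set ℝ} (hI : IsOpen I) {u w : ℝ → EnergySpace γ} (hu : IsFlow hp I u)
    (h : Set.EqOn w u I) : IsFlow hp I w := by
  refine ⟨hu.continuousOn.congr h, fun t ht => ?_⟩
  rw [h ht]
  refine (hu.hasDerivAt t ht).congr_of_eventuallyEq ?_
  filter_upwards [hI.mem_nhds ht] with s hs
  rw [h hs]

lemma IsFlow.union {I J : Set ℝ} (hI : IsOpen I) (hJ : IsOpen J) {u : ℝ → EnergySpace γ}
    (h₁ : IsFlow hp I u) (h₂ : IsFlow hp J u) : IsFlow hp (I ∪ J) u := by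
  refine ⟨h₁.continuousOn.union_of_isOpen h₂.continuousOn hI hJ, fun t ht => ?_⟩
  rcases ht with ht | ht
  · exact h₁.hasDerivAt t ht
  · exact h₂.hasDerivAt t ht

/-- A maximal solution that is bounded in the energy space is global. -/
lemma eq_univ_of_bounded (hp : 5 < p) (hγ : γ < 0) {u₀ : ℝ → ℂ} {I : Set ℝ} {u : ℝ → ℝ → ℂ}
    (hu : IsMaximalSolution p γ u₀ I u) {ρ : ℝ}
    (hρ : ∀ t ∈ I, ‖(lift (u t) : EnergySpace γ)‖ ≤ ρ) : I = Set.univ := by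
  classical
  obtain ⟨hsol, hmax⟩ := hu
  have hfl : IsFlow hp I fun t => (lift (u t) : EnergySpace γ) := isFlow_lift hγ hsol
  obtain ⟨T, hT, hex⟩ := exists_isFlow γ hp ρ
  -- `T` depends on `ρ` alone. The local flow from `t₀` agrees with `u` on the overlap by
  -- uniqueness, the two glue to a solution, and maximality forbids an extension. Hence `I` is
  -- closed as well as open.
  have key : ∀ t₀ ∈ I, Set.Ioo (t₀ - T) (t₀ + T) ⊆ I := by
    intro t₀ ht₀
    obtain ⟨w, hw0, hw⟩ := hex t₀ _ (hρ t₀ ht₀)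
    set J := Set.Ioo (t₀ - T) (t₀ + T) with hJ
    have ht₀J : t₀ ∈ J := ⟨by linarith, by linarith⟩
    have hJo : IsOpen J := isOpen_Ioo
    have heq : Set.EqOn w (fun t => lift (u t)) (I ∩ J) :=
      (hw.mono Set.inter_subset_right).eqOn (hsol.isOpen.inter hJo)
        (hsol.ordConnected.inter Set.ordConnected_Ioo) (hfl.mono Set.inter_subset_left)
        ⟨ht₀, ht₀J⟩ hw0
    set z : ℝ → EnergySpace γ := fun t => if t ∈ I then lift (u t) else w t with hz
    have hzI : Set.EqOn z (fun t => lift (u t)) I := fun t ht => if_pos ht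
    have hzJ : Set.EqOn z w J := by
      intro t ht
      by_cases h : t ∈ I
      · rw [hzI h, heq ⟨h, ht⟩]
      · exact if_neg h
    have hflow : IsFlow hp (I ∪ J) z :=
      (hfl.congr hsol.isOpen hzI).union hsol.isOpen hJo (hw.congr hJo hzJ)
    have hord : (I ∪ J).OrdConnected := isPreconnected_iff_ordConnected.mp
      (IsPreconnected.union t₀ ht₀ ht₀J (isPreconnected_iff_ordConnected.mpr hsol.ordConnected)
        isPreconnected_Ioo)
    have hzu : ∀ t ∈ I, (z t : ℝ → ℂ) = u t := fun t ht => by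
      rw [hzI ht, coe_lift (hsol.memH1 t ht)]
    have hs := hflow.isSolution hγ (hsol.isOpen.union hJo) hord (Or.inl hsol.zero_mem)
    rw [hzu 0 hsol.zero_mem, hsol.initial] at hs
    have := hmax _ _ hs Set.subset_union_left hzu
    exact this ▸ Set.subset_union_right
  have hclosed : IsClosed I := by
    refine isClosed_of_closure_subset fun t ht => ?_
    obtain ⟨s, hs, hd⟩ := Metric.mem_closure_iff.mp ht T hT
    rw [Real.dist_eq, abs_lt] at hd
    exact key s hs ⟨by linarith, by linarith⟩
  exact IsClopen.eq_univ ⟨hclosed, hsol.isOpen⟩ ⟨0, hsol.zero_mem⟩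

/-! ### Reflection -/

end EnergySpace

lemma IsPrimitive.comp_neg {f w : ℝ → ℂ} (h : IsPrimitive f w) :
    IsPrimitive (fun x => f (-x)) fun x => -w (-x) := by
  refine ⟨?_, fun a b => ?_⟩
  · have : LocallyIntegrable (fun x => w (-x)) volume := by
      rw [locallyIntegrable_iff]
      intro k hk
      have h1 := h.locallyIntegrable.integrableOn_isCompact (hk.image continuous_neg)
      have h2 : MeasurePreserving (fun x : ℝ => -x) volume volume :=
        Measure.measurePreserving_neg volume
      have h3 := (h2.integrableOn_comp_preimage
        (Homeomorph.neg ℝ).measurableEmbedding).mpr h1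
      rwa [Set.preimage_image_eq _ neg_injective] at h3
    exact this.neg
  · rw [intervalIntegral.integral_neg, intervalIntegral.integral_comp_neg, h.integral_eq]
    ring

lemma MemH1.comp_neg {f : ℝ → ℂ} (hf : MemH1 f) : MemH1 fun x => f (-x) := by
  have h2 : MeasurePreserving (fun x : ℝ => -x) volume volume :=
    Measure.measurePreserving_neg volume
  exact hf.isPrimitive.comp_neg.memH1 (hf.memLp.comp_measurePreserving h2)
    (hf.memLp_deriv.comp_measurePreserving h2).neg

namespace EnergySpace

variable {γ p : ℝ} {hp : 5 < p}

/-- Reflection on the energy space. -/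
def reflect : EnergySpace γ →ₗᵢ[ℂ] EnergySpace γ where
  toFun f := mk (fun x => f (-x)) f.memH1.comp_neg
  map_add' _ _ := rfl
  map_smul' _ _ := rfl
  norm_map' f := by
    refine (sq_eq_sq₀ (norm_nonneg _) (norm_nonneg _)).mp ?_
    rw [norm_sq, norm_sq]
    change (∫ x, ‖deriv (fun x => f (-x)) x‖ ^ 2) + |γ| * ‖f (-0)‖ ^ 2 + (∫ x, ‖f (-x)‖ ^ 2) = _
    simp only [deriv_comp_neg, norm_neg, neg_zero]
    rw [integral_neg_eq_self (fun x => ‖f x‖ ^ 2),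
      integral_neg_eq_self (fun x => ‖deriv f x‖ ^ 2)]

@[simp] lemma reflect_apply (f : EnergySpace γ) (x : ℝ) : reflect f x = f (-x) := rfl

lemma reflect_reflect (f : EnergySpace γ) : reflect (reflect f) = f := by
  ext x
  simp

lemma resolvent_reflect (f : EnergySpace γ) : resolvent (reflect f) = reflect (resolvent f) := by
  refine ext_inner_left ℂ fun φ => ?_
  have h : inner ℂ φ (reflect (resolvent f)) = inner ℂ (reflect φ) (resolvent f) := by
    rw [← LinearIsometry.inner_map_map reflect (reflect φ), reflect_reflect]
  rw [h, inner_resolvent_right, inner_resolvent_right,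
    ← integral_neg_eq_self (fun x => conj (reflect φ x) * f x)]
  simp

lemma source_reflect (f : EnergySpace γ) : source hp (reflect f) = reflect (source hp f) := rfl

lemma IsFlow.reflect {I : Set ℝ} {u : ℝ → EnergySpace γ} (hu : IsFlow hp I u) :
    IsFlow hp I fun t => reflect (u t) := by
  refine ⟨EnergySpace.reflect.continuous.comp_continuousOn hu.continuousOn, fun t ht => ?_⟩
  have h := (EnergySpace.reflect.toContinuousLinearMap.restrictScalars ℝ).hasFDerivAt.comp_hasDerivAt
    t (hu.hasDerivAt t ht)
  simp only [source_reflect, resolvent_reflect]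
  rw [← map_sub, ← map_smul]
  exact h

/-- Evenness is preserved by the flow. -/
lemma IsFlow.even {I : Set ℝ} (hI : IsOpen I) (hI' : I.OrdConnected) {u : ℝ → EnergySpace γ}
    (hu : IsFlow hp I u) {t₀ t : ℝ} (ht₀ : t₀ ∈ I) (h : ∀ x, u t₀ (-x) = u t₀ x) (ht : t ∈ I)
    (x : ℝ) : u t (-x) = u t x := by
  have h1 := hu.reflect.eqOn hI hI' hu ht₀ (by ext x; exact h x) ht
  exact congrArg (fun f : EnergySpace γ => f x) h1

/-! ### Standing waves -/

lemma norm_exp_I_mul (y : ℝ) : ‖Complex.exp (Complex.I * (y : ℂ))‖ = 1 := by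
  rw [mul_comm, Complex.norm_exp_ofReal_mul_I]

/-- The hypothesis is `-Δ_γ f + ω f = |f|^{p-1} f` after applying `(1 - Δ_γ)⁻¹`. The phase is one at
`t₀`, where the wave is later compared with a given flow. -/
lemma isFlow_standingWave {ω t₀ : ℝ} {f : EnergySpace γ}
    (hf : f + (ω - 1 : ℂ) • resolvent f = resolvent (nonlinMap hp f)) :
    IsFlow hp Set.univ fun t : ℝ => Complex.exp (Complex.I * (ω * (t - t₀) : ℝ)) • f := by
  have hd : ∀ t : ℝ, HasDerivAt (fun t : ℝ => Complex.exp (Complex.I * (ω * (t - t₀) : ℝ)))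
      (Complex.exp (Complex.I * (ω * (t - t₀) : ℝ)) * (Complex.I * ω)) t := by
    intro t
    have h1 : HasDerivAt (fun t : ℝ => ω * (t - t₀)) ω t := by
      simpa using ((hasDerivAt_id t).sub_const t₀).const_mul ω
    exact (h1.ofReal_comp.const_mul Complex.I).cexp
  refine ⟨?_, fun t _ => ?_⟩
  · have : Continuous fun t : ℝ => Complex.exp (Complex.I * (ω * (t - t₀) : ℝ)) := by fun_prop
    exact (this.smul continuous_const).continuousOn
  · have h := (hd t).smul_const (resolvent f)
    simp only [map_smul, source, nonlinMap_smul hp (norm_exp_I_mul _)]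
    convert! h using 1
    rw [← smul_add, map_smul, map_add, ← hf]
    module

end EnergySpace

/-! ### The ground state -/

/-- The profile of the ground state on the half-line, as a function on the real line. -/
def profile (p ω γ x : ℝ) : ℝ :=
  ((p + 1) * ω / 2 *
    (1 / Real.cosh ((p - 1) * √ω / 2 * x + Real.artanh (γ / (2 * √ω)))) ^ 2) ^ (1 / (p - 1))

/-- The hyperbolic tangent of the phase of the profile. -/
def phaseTanh (p ω γ x : ℝ) : ℝ :=
  Real.tanh ((p - 1) * √ω / 2 * x + Real.artanh (γ / (2 * √ω)))

lemma groundState_eq (p ω γ x : ℝ) : groundState p ω γ x = (profile p ω γ |x| : ℂ) := rfl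

lemma hasDerivAt_phaseTanh (p ω γ x : ℝ) : HasDerivAt (phaseTanh p ω γ)
    ((p - 1) * √ω / 2 * (1 - phaseTanh p ω γ x ^ 2)) x := by
  set β := (p - 1) * √ω / 2 with hβ
  set θ := Real.artanh (γ / (2 * √ω)) with hθ
  have hc : Real.cosh (β * x + θ) ≠ 0 := (Real.cosh_pos _).ne'
  have h1 : HasDerivAt (fun x => β * x + θ) β x := by
    simpa using ((hasDerivAt_id x).const_mul β).add_const θ
  have h2 := h1.sinh.fun_div h1.cosh hc
  have e : phaseTanh p ω γ = fun x => Real.sinh (β * x + θ) / Real.cosh (β * x + θ) := by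
    funext x
    rw [phaseTanh, Real.tanh_eq_sinh_div_cosh]
  rw [e]
  convert! h2 using 1
  field_simp

lemma abs_phaseTanh_lt (p ω γ x : ℝ) : |phaseTanh p ω γ x| < 1 := Real.abs_tanh_lt_one _

section Profile

variable {p ω γ : ℝ} (hp : 5 < p) (hω : 0 < ω)

include hp hω

lemma profile_base_pos (x : ℝ) : 0 < (p + 1) * ω / 2 *
    (1 / Real.cosh ((p - 1) * √ω / 2 * x + Real.artanh (γ / (2 * √ω)))) ^ 2 := by
  have := Real.cosh_pos ((p - 1) * √ω / 2 * x + Real.artanh (γ / (2 * √ω)))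
  have h1 : 0 < p + 1 := by linarith
  positivity

lemma profile_pos (x : ℝ) : 0 < profile p ω γ x :=
  Real.rpow_pos_of_pos (profile_base_pos hp hω x) _

/-- With `T = phaseTanh`, the relations `Q' = -√ω T Q`, `T' = ((p-1)√ω/2)(1 - T²)` and `Q^(p-1) =
((p+1)ω/2)(1 - T²)` reduce the later identities for `Q` to algebra in `T` and `Q`. -/
lemma hasDerivAt_profile (x : ℝ) : HasDerivAt (profile p ω γ)
    (-√ω * phaseTanh p ω γ x * profile p ω γ x) x := by
  set β := (p - 1) * √ω / 2 with hβ
  set θ := Real.artanh (γ / (2 * √ω)) with hθ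
  have hc : Real.cosh (β * x + θ) ≠ 0 := (Real.cosh_pos _).ne'
  have h1 : HasDerivAt (fun x => β * x + θ) β x := by
    simpa using ((hasDerivAt_id x).const_mul β).add_const θ
  have h2 := (((h1.cosh.fun_inv hc).fun_pow 2).const_mul ((p + 1) * ω / 2)).rpow_const
    (p := 1 / (p - 1)) (Or.inl (by simpa using (profile_base_pos hp hω (γ := γ) x).ne'))
  have e : profile p ω γ = fun x => ((p + 1) * ω / 2 * (Real.cosh (β * x + θ))⁻¹ ^ 2)
      ^ (1 / (p - 1)) := by
    funext x
    rw [profile, one_div]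
  rw [e]
  convert! h2 using 1
  have hpos : 0 < (p + 1) * ω / 2 * (Real.cosh (β * x + θ))⁻¹ ^ 2 := by
    simpa using (profile_base_pos hp hω (γ := γ) x)
  rw [Real.rpow_sub hpos, Real.rpow_one, phaseTanh, Real.tanh_eq_sinh_div_cosh, ← hθ, ← hβ]
  have h3 : p - 1 ≠ 0 := by linarith
  have h4 : p + 1 ≠ 0 := by linarith
  have h5 : ω ≠ 0 := hω.ne'
  have h6 : √ω = 2 * β / (p - 1) := by rw [hβ]; field_simp
  rw [h6]
  simp only [Nat.reduceSub, pow_one, Nat.cast_ofNat]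
  generalize Real.cosh (β * x + θ) = ch at hc ⊢
  generalize (Real.sinh (β * x + θ)) = sh
  field_simp

lemma profile_rpow (x : ℝ) :
    profile p ω γ x ^ (p - 1) = (p + 1) * ω / 2 * (1 - phaseTanh p ω γ x ^ 2) := by
  have h3 : p - 1 ≠ 0 := by linarith
  rw [profile, ← Real.rpow_mul (profile_base_pos hp hω x).le, one_div_mul_cancel h3, Real.rpow_one,
    phaseTanh, Real.tanh_eq_sinh_div_cosh]
  congr 1
  have hc := (Real.cosh_pos ((p - 1) * √ω / 2 * x + Real.artanh (γ / (2 * √ω)))).ne'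
  have := Real.cosh_sq ((p - 1) * √ω / 2 * x + Real.artanh (γ / (2 * √ω)))
  generalize (p - 1) * √ω / 2 * x + Real.artanh (γ / (2 * √ω)) = y at hc this ⊢
  field_simp
  linarith

lemma exists_profile_le : ∃ C : ℝ, 0 ≤ C ∧ ∀ x, profile p ω γ x ≤ C * Real.exp (-√ω * x) := by
  set β := (p - 1) * √ω / 2 with hβ
  set θ := Real.artanh (γ / (2 * √ω)) with hθ
  have hp1 : 0 < p - 1 := by linarith
  have hp2 : 0 < p + 1 := by linarith
  refine ⟨((p + 1) * ω / 2 * 4) ^ (1 / (p - 1)) * Real.exp (-2 * θ * (1 / (p - 1))), by positivity,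
    fun x => ?_⟩
  have h1 : (1 / Real.cosh (β * x + θ)) ^ 2 ≤ 4 * Real.exp (-2 * (β * x + θ)) := by
    have h2 : Real.exp (β * x + θ) / 2 ≤ Real.cosh (β * x + θ) := by
      rw [Real.cosh_eq]
      have := Real.exp_pos (-(β * x + θ))
      linarith
    have h3 : 1 / Real.cosh (β * x + θ) ≤ 2 * Real.exp (-(β * x + θ)) := by
      rw [div_le_iff₀ (Real.cosh_pos _)]
      have h4 : Real.exp (-(β * x + θ)) * Real.exp (β * x + θ) = 1 := by
        rw [← Real.exp_add]
        simp
      nlinarith [Real.exp_pos (-(β * x + θ))]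
    have h5 : Real.exp (-2 * (β * x + θ)) = Real.exp (-(β * x + θ)) ^ 2 := by
      rw [← Real.exp_nat_mul]
      congr 1
      push_cast
      ring
    rw [h5]
    have h6 : 0 ≤ 1 / Real.cosh (β * x + θ) := by have := Real.cosh_pos (β * x + θ); positivity
    calc _ ≤ (2 * Real.exp (-(β * x + θ))) ^ 2 := by gcongr
      _ = _ := by ring
  have h7 : profile p ω γ x ≤ ((p + 1) * ω / 2 * (4 * Real.exp (-2 * (β * x + θ)))) ^ (1 / (p - 1)) :=
    Real.rpow_le_rpow (profile_base_pos hp hω x).le (by gcongr) (by positivity)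
  refine h7.trans (le_of_eq ?_)
  rw [← mul_assoc, Real.mul_rpow (by positivity) (Real.exp_pos _).le, mul_assoc, ← Real.exp_add,
    ← Real.exp_mul]
  congr 2
  rw [hβ]
  field_simp
  ring

lemma continuous_profile : Continuous (profile p ω γ) :=
  continuous_iff_continuousAt.mpr fun x => (hasDerivAt_profile hp hω x).continuousAt

lemma tendsto_profile : Tendsto (profile p ω γ) atTop (𝓝 0) := by
  obtain ⟨C, hC, h⟩ := exists_profile_le (γ := γ) hp hω
  refine squeeze_zero (fun x => (profile_pos hp hω x).le) h ?_
  have : Tendsto (fun x => Real.exp (-√ω * x)) atTop (𝓝 0) :=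
    Real.tendsto_exp_atBot.comp (tendsto_id.const_mul_atTop_of_neg (by simpa using hω))
  simpa using this.const_mul C

lemma integrable_profile_abs_sq : Integrable fun x => (profile p ω γ |x|) ^ 2 := by
  obtain ⟨C, hC, h⟩ := exists_profile_le (γ := γ) hp hω
  have hs : 0 < √ω := Real.sqrt_pos.mpr hω
  have h1 : IntegrableOn (fun x : ℝ => C ^ 2 * Real.exp (-(2 * √ω) * |x|)) (Set.Ioi 0) := by
    have h2 := (exp_neg_integrableOn_Ioi 0 (show 0 < 2 * √ω by positivity)).const_mul (C ^ 2)
    refine IntegrableOn.congr_fun h2 (fun x hx => ?_) measurableSet_Ioi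
    rw [abs_of_pos hx]
  have h3 : Integrable fun x : ℝ => C ^ 2 * Real.exp (-(2 * √ω) * |x|) := by
    have h4 : IntegrableOn (fun x : ℝ => C ^ 2 * Real.exp (-(2 * √ω) * |x|)) (Set.Iic 0) := by
      rw [← Measure.map_neg_eq_self (volume : Measure ℝ)]
      let m : MeasurableEmbedding fun x : ℝ => -x := (Homeomorph.neg ℝ).measurableEmbedding
      rw [m.integrableOn_map_iff]
      simp_rw [Function.comp_def, abs_neg, Set.neg_preimage, Set.neg_Iic, neg_zero]
      exact (integrableOn_Ici_iff_integrableOn_Ioi).mpr h1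
    rw [← integrableOn_univ, ← Set.Iic_union_Ioi (a := (0 : ℝ))]
    exact h4.union h1
  refine h3.mono' (((continuous_profile hp hω).comp continuous_abs).pow 2).aestronglyMeasurable
    (Eventually.of_forall fun x => ?_)
  rw [Real.norm_of_nonneg (by positivity)]
  have h5 := pow_le_pow_left₀ (profile_pos hp hω |x|).le (h |x|) 2
  refine h5.trans (le_of_eq ?_)
  rw [mul_pow, ← Real.exp_nat_mul]
  congr 2
  push_cast
  ring

lemma hasDerivAt_groundState {x : ℝ} (hx : x ≠ 0) : HasDerivAt (groundState p ω γ)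
    ((SignType.sign x : ℝ) * (-√ω * phaseTanh p ω γ |x| * profile p ω γ |x|) : ℝ) x := by
  have h := (hasDerivAt_profile hp hω (γ := γ) |x|).comp x (hasDerivAt_abs hx)
  have h2 := h.ofReal_comp
  rw [mul_comm] at h2
  exact h2

lemma norm_deriv_groundState {x : ℝ} (hx : x ≠ 0) : ‖deriv (groundState p ω γ) x‖
    = √ω * |phaseTanh p ω γ (|x|)| * profile p ω γ |x| := by
  rw [(hasDerivAt_groundState hp hω hx).deriv, Complex.norm_real, norm_mul, norm_mul, norm_mul,
    Real.norm_eq_abs, Real.norm_eq_abs, Real.norm_eq_abs, Real.norm_eq_abs, abs_neg,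
    abs_of_nonneg (Real.sqrt_nonneg ω), abs_of_pos (profile_pos hp hω _)]
  rcases lt_or_gt_of_ne hx with h | h <;> simp [h]

lemma norm_groundState (x : ℝ) : ‖groundState p ω γ x‖ = profile p ω γ |x| := by
  rw [groundState_eq, Complex.norm_real, Real.norm_of_nonneg (profile_pos hp hω _).le]

lemma continuous_groundState : Continuous (groundState p ω γ) :=
  Complex.continuous_ofReal.comp ((continuous_profile hp hω).comp continuous_abs)

lemma memH1_groundState : MemH1 (groundState p ω γ) := by
  have hQ : MemLp (groundState p ω γ) 2 volume := by
    rw [memLp_two_iff_integrable_sq_norm (continuous_groundState hp hω).aestronglyMeasurable]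
    simp only [norm_groundState hp hω]
    exact integrable_profile_abs_sq hp hω
  have hdQ : MemLp (deriv (groundState p ω γ)) 2 volume := by
    refine hQ.of_le_mul (c := √ω) (stronglyMeasurable_deriv _).aestronglyMeasurable ?_
    filter_upwards [Measure.ae_ne volume (0 : ℝ)] with x hx
    rw [norm_deriv_groundState hp hω hx, norm_groundState hp hω, mul_assoc]
    gcongr
    exact mul_le_of_le_one_left (profile_pos hp hω _).le (abs_phaseTanh_lt p ω γ _).le
  refine ⟨hQ, hdQ, fun a b => ?_⟩
  refine integral_eq_of_hasDerivAt_off_countable (s := {0}) _ _ (Set.countable_singleton 0)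
    (continuous_groundState hp hω).continuousOn (fun x hx => ?_)
    (intervalIntegrable_of_locallyIntegrable (hdQ.locallyIntegrable one_le_two) a b)
  exact (hasDerivAt_groundState hp hω (by simpa using hx.2)).differentiableAt.hasDerivAt

end Profile

lemma groundState_neg (p ω γ x : ℝ) : groundState p ω γ (-x) = groundState p ω γ x := by
  rw [groundState_eq, groundState_eq, abs_neg]

lemma integral_even {g : ℝ → ℝ} (hg : ∀ x, g (-x) = g x) :
    ∫ x, g x = 2 * ∫ x in Set.Ioi (0 : ℝ), g x := by
  rw [← integral_comp_abs]
  congr 1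
  funext x
  rcases abs_cases x with ⟨h, -⟩ | ⟨h, -⟩ <;> rw [h]
  rw [hg]

lemma norm_deriv_neg_of_even {f : ℝ → ℂ} (hf : ∀ x, f (-x) = f x) (x : ℝ) :
    ‖deriv f (-x)‖ = ‖deriv f x‖ := by
  have h : deriv (fun x => f (-x)) x = -deriv f (-x) := deriv_comp_neg f x
  simp only [hf] at h
  have h2 : deriv f x = -deriv f (-x) := h
  rw [h2, norm_neg]

/-- The action `S_{ω,γ} = E_γ + ω/2 M`. -/
def action (p ω γ : ℝ) (f : ℝ → ℂ) : ℝ := energy p γ f + ω / 2 * mass f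

/-- The density of the action away from the origin. -/
def actionDensity (p ω : ℝ) (f : ℝ → ℂ) (x : ℝ) : ℝ :=
  1 / 2 * ‖deriv f x‖ ^ 2 + (ω / 2 * ‖f x‖ ^ 2 - 1 / (p + 1) * ‖f x‖ ^ (p + 1))

lemma MemH1.integrable_norm_rpow {p : ℝ} (hp : 5 < p) {f : ℝ → ℂ} (hf : MemH1 f) :
    Integrable fun x => ‖f x‖ ^ (p + 1) :=
  EnergySpace.integrable_norm_rpow hp (EnergySpace.mk f hf : EnergySpace 0)

lemma MemH1.integrable_actionDensity {p ω : ℝ} (hp : 5 < p) {f : ℝ → ℂ} (hf : MemH1 f) :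
    Integrable (actionDensity p ω f) :=
  (hf.integrable_deriv_sq.const_mul _).add
    ((hf.integrable_sq.const_mul _).sub ((hf.integrable_norm_rpow hp).const_mul _))

lemma action_eq_of_even {p ω γ : ℝ} (hp : 5 < p) {f : ℝ → ℂ} (hf : MemH1 f)
    (he : ∀ x, f (-x) = f x) : action p ω γ f
      = 2 * (∫ x in Set.Ioi (0 : ℝ), actionDensity p ω f x) - γ / 2 * ‖f 0‖ ^ 2 := by
  rw [← integral_even]
  · have i1 := hf.integrable_deriv_sq.const_mul (1 / 2)
    have i2 := hf.integrable_sq.const_mul (ω / 2)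
    have i3 := (hf.integrable_norm_rpow hp).const_mul (1 / (p + 1))
    have i4 : Integrable fun x => ω / 2 * ‖f x‖ ^ 2 - 1 / (p + 1) * ‖f x‖ ^ (p + 1) := i2.sub i3
    simp only [actionDensity]
    rw [integral_add i1 i4, integral_sub i2 i3, integral_const_mul, integral_const_mul,
      integral_const_mul]
    simp only [action, energy, hdotNormSq, mass, lpPow]
    ring
  · intro x
    simp only [actionDensity, he, norm_deriv_neg_of_even he]

/-! ### The calibration and the sharp inequality -/

/-- The function `v` with `v(|z|²)² |z|² = ω |z|² - 2/(p+1) |z|^{p+1}`. -/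
def speed (p ω X : ℝ) : ℝ := √(ω - 2 / (p + 1) * X ^ ((p - 1) / 2))

/-- The primitive of half of `speed`. -/
def calib (p ω X : ℝ) : ℝ := ∫ τ in (0 : ℝ)..X, speed p ω τ / 2

lemma sq_rpow_half (p : ℝ) {a : ℝ} (ha : 0 ≤ a) : (a ^ 2) ^ ((p - 1) / 2) = a ^ (p - 1) := by
  rw [← Real.rpow_natCast, ← Real.rpow_mul ha]
  congr 1
  push_cast
  ring

section Calibration

variable {p ω γ : ℝ} (hp : 5 < p)

include hp

lemma continuous_speed : Continuous (speed p ω) :=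
  (continuous_const.sub (continuous_const.mul
    (Real.continuous_rpow_const (by linarith)))).sqrt

lemma hasDerivAt_calib (X : ℝ) : HasDerivAt (calib p ω) (speed p ω X / 2) X := by
  have hc : Continuous fun τ => speed p ω τ / 2 := (continuous_speed hp).div_const 2
  exact intervalIntegral.integral_hasDerivAt_right (hc.intervalIntegrable _ _)
    hc.stronglyMeasurable.stronglyMeasurableAtFilter hc.continuousAt

lemma contDiff_calib : ContDiff ℝ 1 (calib p ω) := by
  rw [contDiff_one_iff_deriv]
  refine ⟨fun X => (hasDerivAt_calib hp X).differentiableAt, ?_⟩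
  rw [show deriv (calib p ω) = fun X => speed p ω X / 2 from
    funext fun X => (hasDerivAt_calib hp X).deriv]
  exact (continuous_speed hp).div_const 2

lemma rpow_mul_sq {a : ℝ} (ha : 0 ≤ a) : a ^ (p - 1) * a ^ 2 = a ^ (p + 1) := by
  rw [← Real.rpow_natCast, ← Real.rpow_add' ha (by push_cast; linarith)]
  congr 1
  push_cast
  ring

/-- The bound on `a` is the peak height of `Q`; up to it the radicand in `speed` is nonnegative and
the square root loses nothing. -/
lemma speed_sq_mul {a : ℝ} (ha : 0 ≤ a) (h : a ^ (p - 1) ≤ (p + 1) * ω / 2) :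
    speed p ω (a ^ 2) ^ 2 * a ^ 2 = ω * a ^ 2 - 2 / (p + 1) * a ^ (p + 1) := by
  rw [speed, sq_rpow_half p ha, Real.sq_sqrt, ← rpow_mul_sq hp ha]
  · ring
  · have hp1 : 0 < p + 1 := by linarith
    rw [sub_nonneg, div_mul_eq_mul_div, div_le_iff₀ hp1]
    linarith

lemma contDiff_calib_norm_sq : ContDiff ℝ 1 fun z : ℂ => calib p ω (‖z‖ ^ 2) :=
  (contDiff_calib hp).comp (contDiff_norm_sq ℝ)

lemma fderiv_calib_norm_sq (z w : ℂ) :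
    fderiv ℝ (fun z : ℂ => calib p ω (‖z‖ ^ 2)) z w = speed p ω (‖z‖ ^ 2) * inner ℝ z w := by
  have h2 : HasFDerivAt (fun z : ℂ => ‖z‖ ^ 2) (2 • innerSL ℝ z) z :=
    (hasStrictFDerivAt_norm_sq z).hasFDerivAt
  have h3 : HasFDerivAt (fun z : ℂ => calib p ω (‖z‖ ^ 2)) _ z :=
    (hasDerivAt_calib hp _).comp_hasFDerivAt z h2
  rw [h3.fderiv]
  simp only [smul_apply, smul_eq_mul, innerSL_apply_apply, nsmul_eq_mul]
  push_cast
  ring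

/-- The derivative of `calib (|f|²)` is `speed · Re(f̄ f')`, at most `½|f'|² + ½ speed² |f|²` by
Young's inequality, and this is the action density. -/
lemma abs_calib_sub_le {f : ℝ → ℂ} (hf : MemH1 f)
    (hb : ∀ x, ‖f x‖ ^ (p - 1) ≤ (p + 1) * ω / 2) {a b : ℝ} (hab : a ≤ b) :
    |calib p ω (‖f b‖ ^ 2) - calib p ω (‖f a‖ ^ 2)| ≤ ∫ x in a..b, actionDensity p ω f x := by
  rw [← (hf.isPrimitive.comp_contDiff (contDiff_calib_norm_sq (ω := ω) hp)).integral_eq a b,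
    ← Real.norm_eq_abs]
  refine intervalIntegral.norm_integral_le_of_norm_le hab (Eventually.of_forall fun x _ => ?_)
    (hf.integrable_actionDensity hp).intervalIntegrable
  have h1 := speed_sq_mul hp (norm_nonneg (f x)) (hb x)
  have h2 : 0 ≤ speed p ω (‖f x‖ ^ 2) := Real.sqrt_nonneg _
  rw [fderiv_calib_norm_sq hp, norm_mul, Real.norm_of_nonneg h2, actionDensity]
  have h3 : ‖inner ℝ (f x) (deriv f x)‖ ≤ ‖f x‖ * ‖deriv f x‖ := norm_inner_le_norm _ _
  have h4 := mul_le_mul_of_nonneg_left h3 h2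
  have h5 : 1 / (p + 1) = (2 / (p + 1)) / 2 := by ring
  rw [h5]
  nlinarith [sq_nonneg (speed p ω (‖f x‖ ^ 2) * ‖f x‖ - ‖deriv f x‖)]

/-- One leg goes from the origin to `x₁`, the other from `x₁` to infinity, where `f` tends to zero
and `calib 0 = 0`. It is applied with `x₁` a maximum point of `|f|`. -/
lemma le_integral_actionDensity {f : ℝ → ℂ} (hf : MemH1 f)
    (hb : ∀ x, ‖f x‖ ^ (p - 1) ≤ (p + 1) * ω / 2) {x₁ : ℝ} (hx₁ : 0 ≤ x₁) :
    2 * calib p ω (‖f x₁‖ ^ 2) - calib p ω (‖f 0‖ ^ 2)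
      ≤ ∫ x in Set.Ioi (0 : ℝ), actionDensity p ω f x := by
  have hi := hf.integrable_actionDensity (ω := ω) hp
  have h1 := (le_abs_self _).trans (abs_calib_sub_le hp hf hb hx₁)
  have h2 : calib p ω (‖f x₁‖ ^ 2) ≤ ∫ x in Set.Ioi x₁, actionDensity p ω f x := by
    have t1 := intervalIntegral_tendsto_integral_Ioi x₁ hi.integrableOn tendsto_id
    have t2 : Tendsto (fun b => calib p ω (‖f x₁‖ ^ 2) - calib p ω (‖f b‖ ^ 2)) atTop
        (𝓝 (calib p ω (‖f x₁‖ ^ 2))) := by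
      have h3 : Tendsto (fun b => calib p ω (‖f b‖ ^ 2)) atTop (𝓝 0) := by
        have h4 := ((contDiff_calib_norm_sq (ω := ω) hp).continuous.tendsto 0).comp
          hf.tendsto_atTop
        simpa [Function.comp_def, calib] using h4
      simpa using tendsto_const_nhds.sub h3
    refine le_of_tendsto_of_tendsto t2 t1 ?_
    filter_upwards [eventually_ge_atTop x₁] with b hb'
    have := (neg_le_abs _).trans (abs_calib_sub_le hp hf hb hb')
    simp only [id]
    linarith
  have h3 : ∫ x in Set.Ioi (0 : ℝ), actionDensity p ω f x
      = (∫ x in (0 : ℝ)..x₁, actionDensity p ω f x)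
        + ∫ x in Set.Ioi x₁, actionDensity p ω f x := by
    rw [intervalIntegral.integral_of_le hx₁, ← setIntegral_union _ measurableSet_Ioi
      hi.integrableOn hi.integrableOn, Set.Ioc_union_Ioi_eq_Ioi hx₁]
    exact Set.Ioc_disjoint_Ioi le_rfl
  rw [h3]
  linarith

/-- `calib` is concave on `[0, ∞)` because `speed` decreases there, so it lies below its tangents.
-/
lemma calib_sub_le {X X₀ : ℝ} (hX : 0 ≤ X) (hX₀ : 0 ≤ X₀) :
    calib p ω X - calib p ω X₀ ≤ speed p ω X₀ / 2 * (X - X₀) := by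
  have hc : Continuous fun τ => speed p ω τ / 2 := (continuous_speed hp).div_const 2
  have hmono : ∀ a b : ℝ, 0 ≤ a → a ≤ b → speed p ω b / 2 ≤ speed p ω a / 2 := by
    intro a b ha hab
    have hp1 : 0 < p + 1 := by linarith
    have : a ^ ((p - 1) / 2) ≤ b ^ ((p - 1) / 2) := Real.rpow_le_rpow ha hab (by linarith)
    unfold speed
    gcongr
  rw [calib, calib, intervalIntegral.integral_interval_sub_left (hc.intervalIntegrable _ _)
    (hc.intervalIntegrable _ _)]
  rcases le_total X₀ X with h | h
  · have := intervalIntegral.integral_mono_on h (hc.intervalIntegrable _ _)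
      (continuous_const.intervalIntegrable (μ := volume) _ _) (g := fun _ => speed p ω X₀ / 2)
      fun x hx => hmono X₀ x hX₀ hx.1
    simp only [intervalIntegral.integral_const, smul_eq_mul] at this
    linarith
  · have := intervalIntegral.integral_mono_on h (continuous_const.intervalIntegrable (μ := volume) _ _)
      (hc.intervalIntegrable _ _) (f := fun _ => speed p ω X₀ / 2)
      fun x hx => hmono x X₀ (hX.trans hx.1) hx.2
    rw [intervalIntegral.integral_symm]
    simp only [intervalIntegral.integral_const, smul_eq_mul] at this
    linarith

end Calibration

lemma continuous_phaseTanh (p ω γ : ℝ) : Continuous (phaseTanh p ω γ) :=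
  continuous_iff_continuousAt.mpr fun x => (hasDerivAt_phaseTanh p ω γ x).continuousAt

/-- Equivalent to `Q'(0+) = -(γ/2) Q(0)`, the jump condition of the delta potential. The bound on
`ω` puts the argument of `artanh` in `(-1, 1)`. -/
lemma phaseTanh_zero {p ω γ : ℝ} (hω : 0 < ω) (hγω : γ ^ 2 / 4 < ω) :
    √ω * phaseTanh p ω γ 0 = γ / 2 := by
  have hs : 0 < √ω := Real.sqrt_pos.mpr hω
  have h1 : |γ| < 2 * √ω := by
    refine abs_lt_of_sq_lt_sq ?_ (by positivity)
    rw [mul_pow, Real.sq_sqrt hω.le]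
    linarith
  rw [phaseTanh, mul_zero, zero_add, Real.tanh_artanh]
  · field_simp
  · rw [abs_lt] at h1
    constructor
    · rw [lt_div_iff₀ (by positivity)]
      linarith
    · rw [div_lt_iff₀ (by positivity)]
      linarith

/-! ### The ground state attains the calibration bound -/

section GroundState

variable {p ω γ : ℝ} (hp : 5 < p) (hω : 0 < ω)

include hp hω

lemma speed_profile (x : ℝ) :
    speed p ω (profile p ω γ x ^ 2) = √ω * |phaseTanh p ω γ x| := by
  have hp1 : p + 1 ≠ 0 := by linarith
  rw [speed, sq_rpow_half p (profile_pos hp hω x).le, profile_rpow hp hω, ← Real.sqrt_sq_eq_abs,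
    ← Real.sqrt_mul hω.le]
  congr 1
  field_simp
  ring

lemma actionDensity_groundState {x : ℝ} (hx : 0 < x) :
    actionDensity p ω (groundState p ω γ) x
      = ω * phaseTanh p ω γ x ^ 2 * profile p ω γ x ^ 2 := by
  have hp1 : p + 1 ≠ 0 := by linarith
  rw [actionDensity, norm_deriv_groundState hp hω hx.ne', norm_groundState hp hω, abs_of_pos hx,
    ← rpow_mul_sq hp (profile_pos hp hω x).le, profile_rpow hp hω, mul_pow, mul_pow, sq_abs,
    Real.sq_sqrt hω.le]
  field_simp
  ring

lemma hasDerivAt_calib_profile (x : ℝ) :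
    HasDerivAt (fun x => calib p ω (profile p ω γ x ^ 2))
      (-(ω * |phaseTanh p ω γ x| * phaseTanh p ω γ x * profile p ω γ x ^ 2)) x := by
  have h := (hasDerivAt_calib (ω := ω) hp (profile p ω γ x ^ 2)).comp x
    ((hasDerivAt_profile hp hω (γ := γ) x).fun_pow 2)
  convert! h using 1
  rw [speed_profile hp hω]
  have := Real.mul_self_sqrt hω.le
  simp only [Nat.cast_ofNat, Nat.reduceSub, pow_one]
  linear_combination (|phaseTanh p ω γ x| * phaseTanh p ω γ x * profile p ω γ x ^ 2) * this

lemma memH1_actionDensity_groundState : Integrable (actionDensity p ω (groundState p ω γ)) :=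
  (memH1_groundState hp hω).integrable_actionDensity hp

lemma groundState_zero_norm : ‖groundState p ω γ 0‖ = profile p ω γ 0 := by
  rw [norm_groundState hp hω, abs_zero]

/-- Along `Q` one has `|Q'| = speed · Q`, so Young's inequality is an equality, and `Q` is monotone
on either side of `x₀`: both legs of `le_integral_actionDensity` are exact. -/
lemma integral_actionDensity_groundState {x₀ : ℝ} (hx₀ : 0 ≤ x₀)
    (hneg : ∀ x ∈ Set.Ioc 0 x₀, phaseTanh p ω γ x ≤ 0)
    (hpos : ∀ x ∈ Set.Ioi x₀, 0 ≤ phaseTanh p ω γ x) :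
    ∫ x in Set.Ioi (0 : ℝ), actionDensity p ω (groundState p ω γ) x
      = 2 * calib p ω (profile p ω γ x₀ ^ 2) - calib p ω (profile p ω γ 0 ^ 2) := by
  have hi := memH1_actionDensity_groundState (γ := γ) hp hω
  have h3 : ∫ x in Set.Ioi (0 : ℝ), actionDensity p ω (groundState p ω γ) x
      = (∫ x in (0 : ℝ)..x₀, actionDensity p ω (groundState p ω γ) x)
        + ∫ x in Set.Ioi x₀, actionDensity p ω (groundState p ω γ) x := by
    rw [intervalIntegral.integral_of_le hx₀, ← setIntegral_union _ measurableSet_Ioi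
      hi.integrableOn hi.integrableOn, Set.Ioc_union_Ioi_eq_Ioi hx₀]
    exact Set.Ioc_disjoint_Ioi le_rfl
  have hcont : Continuous fun x =>
      -(ω * |phaseTanh p ω γ x| * phaseTanh p ω γ x * profile p ω γ x ^ 2) := by
    have h1 := continuous_phaseTanh p ω γ
    have h2 := continuous_profile (γ := γ) hp hω
    fun_prop
  have h1 : ∫ x in (0 : ℝ)..x₀, actionDensity p ω (groundState p ω γ) x
      = calib p ω (profile p ω γ x₀ ^ 2) - calib p ω (profile p ω γ 0 ^ 2) := by
    rw [← intervalIntegral.integral_eq_sub_of_hasDerivAt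
      (fun x _ => hasDerivAt_calib_profile hp hω (γ := γ) x) (hcont.intervalIntegrable _ _),
      intervalIntegral.integral_of_le hx₀, intervalIntegral.integral_of_le hx₀]
    refine setIntegral_congr_fun measurableSet_Ioc fun x hx => ?_
    rw [actionDensity_groundState hp hω hx.1, abs_of_nonpos (hneg x hx)]
    ring
  have h2 : ∫ x in Set.Ioi x₀, actionDensity p ω (groundState p ω γ) x
      = calib p ω (profile p ω γ x₀ ^ 2) := by
    have hd : ∀ x ∈ Set.Ici x₀, HasDerivAt (fun x => -calib p ω (profile p ω γ x ^ 2))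
        (ω * |phaseTanh p ω γ x| * phaseTanh p ω γ x * profile p ω γ x ^ 2) x := fun x _ => by
      have := (hasDerivAt_calib_profile hp hω (γ := γ) x).fun_neg
      rwa [neg_neg] at this
    have he : Set.EqOn (actionDensity p ω (groundState p ω γ))
        (fun x => ω * |phaseTanh p ω γ x| * phaseTanh p ω γ x * profile p ω γ x ^ 2)
        (Set.Ioi x₀) := by
      intro x hx
      beta_reduce
      rw [actionDensity_groundState hp hω (hx₀.trans_lt hx), abs_of_nonneg (hpos x hx)]
      ring
    have ht : Tendsto (fun x => -calib p ω (profile p ω γ x ^ 2)) atTop (𝓝 0) := by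
      have h4 := ((contDiff_calib (ω := ω) hp).continuous.tendsto 0).comp
        (by simpa using (tendsto_profile (γ := γ) hp hω).pow 2)
      have h5 : calib p ω 0 = 0 := by simp [calib]
      rw [h5] at h4
      simpa [Function.comp_def] using h4.neg
    rw [setIntegral_congr_fun measurableSet_Ioi he,
      integral_Ioi_of_hasDerivAt_of_tendsto' hd (hi.integrableOn.congr_fun he measurableSet_Ioi) ht]
    ring
  rw [h3, h1, h2]
  ring

/-- The Nehari identity for the ground state. -/
lemma nehari_groundState (hγω : γ ^ 2 / 4 < ω) :
    hdotNormSq γ (groundState p ω γ) + ω * mass (groundState p ω γ)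
      = lpPow p (groundState p ω γ) := by
  have hQ := memH1_groundState (γ := γ) hp hω
  have i1 := hQ.integrable_deriv_sq
  have i2 := hQ.integrable_sq.const_mul ω
  have i3 := hQ.integrable_norm_rpow hp
  have i4 : Integrable fun x => ω * ‖groundState p ω γ x‖ ^ 2
    - ‖groundState p ω γ x‖ ^ (p + 1) := i2.sub i3
  have hi : Integrable fun x => ‖deriv (groundState p ω γ) x‖ ^ 2
    + (ω * ‖groundState p ω γ x‖ ^ 2 - ‖groundState p ω γ x‖ ^ (p + 1)) := i1.add i4
  have hT := phaseTanh_zero (p := p) hω hγω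
  -- On the positive half-line the integrand is the derivative of `Q Q'`; the boundary term at `0`
  -- produces the delta contribution.
  have hd : ∀ x ∈ Set.Ici (0 : ℝ), HasDerivAt
      (fun x => -(√ω * phaseTanh p ω γ x * profile p ω γ x ^ 2))
      (ω * phaseTanh p ω γ x ^ 2 * profile p ω γ x ^ 2 + (ω * profile p ω γ x ^ 2
        - profile p ω γ x ^ (p + 1))) x := fun x _ => by
    have h := (((hasDerivAt_phaseTanh p ω γ x).const_mul √ω).fun_mul
      ((hasDerivAt_profile hp hω (γ := γ) x).fun_pow 2)).fun_neg
    convert! h using 1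
    rw [← rpow_mul_sq hp (profile_pos hp hω x).le, profile_rpow hp hω]
    have := Real.mul_self_sqrt hω.le
    simp only [Nat.cast_ofNat, Nat.reduceSub, pow_one]
    linear_combination ((-(p - 1) / 2 * (1 - phaseTanh p ω γ x ^ 2)
      + 2 * phaseTanh p ω γ x ^ 2) * profile p ω γ x ^ 2) * (-this)
  have he : Set.EqOn (fun x => ‖deriv (groundState p ω γ) x‖ ^ 2
      + (ω * ‖groundState p ω γ x‖ ^ 2 - ‖groundState p ω γ x‖ ^ (p + 1)))
      (fun x => ω * phaseTanh p ω γ x ^ 2 * profile p ω γ x ^ 2 + (ω * profile p ω γ x ^ 2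
        - profile p ω γ x ^ (p + 1))) (Set.Ioi 0) := by
    intro x (hx : 0 < x)
    simp only [norm_deriv_groundState hp hω hx.ne', norm_groundState hp hω, abs_of_pos hx,
      mul_pow, sq_abs, Real.sq_sqrt hω.le]
  have ht : Tendsto (fun x => -(√ω * phaseTanh p ω γ x * profile p ω γ x ^ 2)) atTop (𝓝 0) := by
    have h1 : Tendsto (fun x => √ω * profile p ω γ x ^ 2) atTop (𝓝 0) := by
      simpa using ((tendsto_profile (γ := γ) hp hω).pow 2).const_mul √ω
    refine squeeze_zero_norm (fun x => ?_) h1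
    rw [norm_neg, norm_mul, norm_mul, Real.norm_of_nonneg (Real.sqrt_nonneg ω),
      Real.norm_of_nonneg (sq_nonneg _), Real.norm_eq_abs]
    gcongr
    exact mul_le_of_le_one_right (Real.sqrt_nonneg ω) (abs_phaseTanh_lt p ω γ x).le
  have h1 : ∫ x, (‖deriv (groundState p ω γ) x‖ ^ 2
      + (ω * ‖groundState p ω γ x‖ ^ 2 - ‖groundState p ω γ x‖ ^ (p + 1)))
      = γ * profile p ω γ 0 ^ 2 := by
    rw [integral_even fun x => by
        simp only [groundState_neg, norm_deriv_neg_of_even (groundState_neg p ω γ)],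
      setIntegral_congr_fun measurableSet_Ioi he,
      integral_Ioi_of_hasDerivAt_of_tendsto' hd
        (hi.integrableOn.congr_fun he measurableSet_Ioi) ht]
    linear_combination 2 * profile p ω γ 0 ^ 2 * hT
  rw [integral_add i1 i4, integral_sub i2 i3, integral_const_mul] at h1
  rw [hdotNormSq, mass, lpPow, groundState_zero_norm hp hω]
  linarith

/-- The virial functional vanishes at the ground state. -/
lemma virial_groundState (hγω : γ ^ 2 / 4 < ω) : virial p γ (groundState p ω γ) = 0 := by
  have hQ := memH1_groundState (γ := γ) hp hω
  have hp1 : p + 1 ≠ 0 := by linarith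
  -- This integrates the first integral `Q'² = ω Q² - (2/(p+1)) Q^(p+1)` of the profile equation.
  -- Its mean with the Nehari identity is the assertion.
  have h1 : ∫ x, ‖deriv (groundState p ω γ) x‖ ^ 2
      = ω * mass (groundState p ω γ) - 2 / (p + 1) * lpPow p (groundState p ω γ) := by
    rw [mass, lpPow, ← integral_const_mul, ← integral_const_mul,
      ← integral_sub (hQ.integrable_sq.const_mul ω) ((hQ.integrable_norm_rpow hp).const_mul _)]
    refine integral_congr_ae ?_
    filter_upwards [Measure.ae_ne volume (0 : ℝ)] with x hx
    rw [norm_deriv_groundState hp hω hx, norm_groundState hp hω,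
      ← rpow_mul_sq hp (profile_pos hp hω _).le, profile_rpow hp hω, mul_pow, mul_pow, sq_abs,
      Real.sq_sqrt hω.le]
    field_simp
    ring
  have h2 := nehari_groundState hp hω hγω
  rw [hdotNormSq] at h2
  rw [virial]
  have h3 : (p - 1) / (2 * (p + 1)) = 1 / 2 - 1 / (p + 1) := by field_simp; ring
  rw [h3]
  have h4 : 2 / (p + 1) = 2 * (1 / (p + 1)) := by ring
  rw [h4] at h1
  linear_combination 1 / 2 * h1 + 1 / 2 * h2

/-- The ground state minimizes the action among even functions with the same maximum modulus. -/
lemma action_groundState_le (hγ : γ < 0) (hγω : γ ^ 2 / 4 < ω) {f : ℝ → ℂ} (hf : MemH1 f)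
    (he : ∀ x, f (-x) = f x) {x₁ : ℝ} (hx₁ : 0 ≤ x₁) (hmax : ∀ x, ‖f x‖ ≤ ‖f x₁‖)
    (hval : ‖f x₁‖ ^ (p - 1) = (p + 1) * ω / 2) :
    action p ω γ (groundState p ω γ) ≤ action p ω γ f := by
  have hp1 : 0 < p - 1 := by linarith
  have hs : 0 < √ω := Real.sqrt_pos.mpr hω
  have hβ : 0 < (p - 1) * √ω / 2 := by positivity
  have hT := phaseTanh_zero (p := p) hω hγω
  set θ := Real.artanh (γ / (2 * √ω)) with hθ
  have hT0 : phaseTanh p ω γ 0 < 0 := by nlinarith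
  have hθ0 : θ < 0 := by
    by_contra! h
    have : 0 ≤ phaseTanh p ω γ 0 := by
      rw [phaseTanh, mul_zero, zero_add, Real.tanh_eq_sinh_div_cosh]
      exact div_nonneg (Real.sinh_nonneg_iff.mpr h) (Real.cosh_pos _).le
    linarith
  -- The phase vanishes at `x₀`, which is positive because `γ < 0`: `Q` has two humps, at `±x₀`.
  set x₀ := -θ / ((p - 1) * √ω / 2) with hx₀
  have hx₀0 : 0 ≤ x₀ := div_nonneg (by linarith) hβ.le
  have hβx : (p - 1) * √ω / 2 * x₀ = -θ := by rw [hx₀]; field_simp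
  have hneg : ∀ x ∈ Set.Ioc 0 x₀, phaseTanh p ω γ x ≤ 0 := fun x hx => by
    rw [phaseTanh, Real.tanh_eq_sinh_div_cosh]
    refine div_nonpos_of_nonpos_of_nonneg (Real.sinh_nonpos_iff.mpr ?_) (Real.cosh_pos _).le
    have := mul_le_mul_of_nonneg_left hx.2 hβ.le
    linarith
  have hpos : ∀ x ∈ Set.Ioi x₀, 0 ≤ phaseTanh p ω γ x := fun x hx => by
    rw [phaseTanh, Real.tanh_eq_sinh_div_cosh]
    refine div_nonneg (Real.sinh_nonneg_iff.mpr ?_) (Real.cosh_pos _).le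
    have := mul_le_mul_of_nonneg_left (le_of_lt hx) hβ.le
    linarith
  have hTx₀ : phaseTanh p ω γ x₀ = 0 := by
    rw [phaseTanh, hβx, neg_add_cancel, Real.tanh_zero]
  have hm : profile p ω γ x₀ = ‖f x₁‖ := by
    have h := profile_rpow hp hω (γ := γ) x₀
    rw [hTx₀, zero_pow two_ne_zero, sub_zero, mul_one, ← hval] at h
    exact (Real.rpow_left_inj (profile_pos hp hω _).le (norm_nonneg _) hp1.ne').mp h
  have hb : ∀ x, ‖f x‖ ^ (p - 1) ≤ (p + 1) * ω / 2 := fun x =>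
    (Real.rpow_le_rpow (norm_nonneg _) (hmax x) hp1.le).trans hval.le
  have h1 := le_integral_actionDensity hp hf hb hx₁
  have h2 := integral_actionDensity_groundState hp hω hx₀0 hneg hpos
  -- The tangent of `calib` at `Q(0)²` has slope `-γ/4`, which is what the term `-(γ/2)|f(0)|²`
  -- balances after both half-lines are counted.
  have h3 := calib_sub_le (ω := ω) hp (sq_nonneg ‖f 0‖) (sq_nonneg (profile p ω γ 0))
  rw [speed_profile hp hω, abs_of_neg hT0] at h3
  have h4 : √ω * -phaseTanh p ω γ 0 = -γ / 2 := by linarith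
  rw [h4] at h3
  rw [action_eq_of_even hp hf he, action_eq_of_even hp (memH1_groundState hp hω)
    (groundState_neg p ω γ), h2, groundState_zero_norm hp hω, hm]
  linarith

end GroundState

lemma MemH1.exists_isMax_of_even {f : ℝ → ℂ} (hf : MemH1 f) (he : ∀ x, f (-x) = f x) :
    ∃ x₁, 0 ≤ x₁ ∧ ∀ x, ‖f x‖ ≤ ‖f x₁‖ := by
  by_cases h0 : ∀ x, f x = 0
  · exact ⟨0, le_rfl, fun x => by rw [h0, h0]⟩
  push Not at h0
  obtain ⟨a, ha⟩ := h0
  have habs : ∀ x, f |x| = f x := fun x => by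
    rcases abs_cases x with ⟨h, -⟩ | ⟨h, -⟩ <;> rw [h]
    exact he x
  have h1 : ∀ᶠ x in atTop, ‖f x‖ < ‖f a‖ :=
    hf.tendsto_atTop.norm.eventually_lt_const (by simpa using ha)
  obtain ⟨R, hR⟩ := eventually_atTop.mp h1
  obtain ⟨x₁, hx₁, hm⟩ := isCompact_Icc.exists_isMaxOn
    (s := Set.Icc 0 (max R |a|)) ⟨0, le_rfl, (abs_nonneg a).trans (le_max_right _ _)⟩
    hf.continuous'.norm.continuousOn
  refine ⟨x₁, hx₁.1, fun x => ?_⟩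
  rw [← habs]
  rcases le_or_gt |x| (max R |a|) with h | h
  · exact hm ⟨abs_nonneg x, h⟩
  · have h2 := hR |x| ((le_max_left _ _).trans h.le)
    rw [← habs a] at h2
    exact h2.le.trans (hm ⟨abs_nonneg a, le_max_right _ _⟩)

/-- The square of the norm associated with `-Δ_γ + ω`. -/
def formNormSq (ω γ : ℝ) (f : ℝ → ℂ) : ℝ := hdotNormSq γ f + ω * mass f

lemma mass_nonneg (f : ℝ → ℂ) : 0 ≤ mass f := integral_nonneg fun _ => sq_nonneg _

lemma lpPow_nonneg (p : ℝ) (f : ℝ → ℂ) : 0 ≤ lpPow p f :=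
  integral_nonneg fun _ => Real.rpow_nonneg (norm_nonneg _) _

lemma hdotNormSq_nonneg {γ : ℝ} (hγ : γ < 0) (f : ℝ → ℂ) : 0 ≤ hdotNormSq γ f := by
  have : 0 ≤ ∫ x, ‖deriv f x‖ ^ 2 := integral_nonneg fun _ => sq_nonneg _
  rw [hdotNormSq]
  nlinarith [sq_nonneg ‖f 0‖]

lemma formNormSq_nonneg {ω γ : ℝ} (hω : 0 < ω) (hγ : γ < 0) (f : ℝ → ℂ) :
    0 ≤ formNormSq ω γ f :=
  add_nonneg (hdotNormSq_nonneg hγ f) (mul_nonneg hω.le (mass_nonneg f))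

lemma norm_ofReal_mul {σ : ℝ} (hσ : 0 ≤ σ) (z : ℂ) : ‖(σ : ℂ) * z‖ = σ * ‖z‖ := by
  rw [norm_mul, Complex.norm_real, Real.norm_of_nonneg hσ]

lemma formNormSq_const_mul (ω γ : ℝ) {σ : ℝ} (hσ : 0 ≤ σ) (f : ℝ → ℂ) :
    formNormSq ω γ (fun x => (σ : ℂ) * f x) = σ ^ 2 * formNormSq ω γ f := by
  have h : ∀ x, deriv (fun x => (σ : ℂ) * f x) x = σ * deriv f x :=
    fun x => deriv_const_mul_field (σ : ℂ)
  simp only [formNormSq, hdotNormSq, mass, h, norm_ofReal_mul hσ, mul_pow, integral_const_mul]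
  ring

lemma lpPow_const_mul (p : ℝ) {σ : ℝ} (hσ : 0 ≤ σ) (f : ℝ → ℂ) :
    lpPow p (fun x => (σ : ℂ) * f x) = σ ^ (p + 1) * lpPow p f := by
  simp only [lpPow, norm_ofReal_mul hσ, Real.mul_rpow hσ (norm_nonneg _), integral_const_mul]

lemma action_eq (p ω γ : ℝ) (f : ℝ → ℂ) :
    action p ω γ f = 1 / 2 * formNormSq ω γ f - 1 / (p + 1) * lpPow p f := by
  rw [action, energy, formNormSq]
  ring

/-! ### The sharp inequality, free of the normalization of the peak -/

section Sharp

variable {p ω γ : ℝ} (hp : 5 < p) (hω : 0 < ω) (hγ : γ < 0) (hγω : γ ^ 2 / 4 < ω)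

include hp hω

lemma mass_groundState_pos : 0 < mass (groundState p ω γ) := by
  refine (mass_nonneg _).lt_of_ne fun h => ?_
  have h1 := (memH1_groundState (γ := γ) hp hω).eq_zero_of_mass_eq_zero h.symm
  have h2 := norm_groundState hp hω (γ := γ) 0
  have h3 := profile_pos hp hω (γ := γ) |0|
  rw [h1] at h2
  simp at h2
  simp [← h2] at h3

include hγ

lemma formNormSq_groundState_pos : 0 < formNormSq ω γ (groundState p ω γ) :=
  add_pos_of_nonneg_of_pos (hdotNormSq_nonneg hγ _) (mul_pos hω (mass_groundState_pos hp hω))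

include hγω

/-- The sharp Gagliardo–Nirenberg type inequality for even functions, with the ground state as an
optimizer. -/
lemma lpPow_mul_le {f : ℝ → ℂ} (hf : MemH1 f) (he : ∀ x, f (-x) = f x) :
    lpPow p f * formNormSq ω γ (groundState p ω γ) ^ ((p - 1) / 2)
      ≤ formNormSq ω γ f ^ ((p + 1) / 2) := by
  have hp1 : 0 < p - 1 := by linarith
  have hp2 : 0 < p + 1 := by linarith
  have hG0 := formNormSq_nonneg hω hγ f
  have hL0 := lpPow_nonneg p f
  have hGQ := formNormSq_groundState_pos hp hω hγ
  obtain ⟨x₁, hx₁, hmax⟩ := hf.exists_isMax_of_even he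
  rcases (norm_nonneg (f x₁)).eq_or_lt with h0 | h0
  · have hz : ∀ x, ‖f x‖ = 0 := fun x => le_antisymm ((hmax x).trans h0.symm.le) (norm_nonneg _)
    have hL : lpPow p f = 0 := by simp [lpPow, hz, Real.zero_rpow hp2.ne']
    rw [hL, zero_mul]
    positivity
  -- `m` is the peak height of `Q`, and `σ` rescales `f` to it.
  set m : ℝ := ((p + 1) * ω / 2) ^ (1 / (p - 1)) with hm
  have hm0 : 0 < m := by positivity
  set σ : ℝ := m / ‖f x₁‖ with hσ
  have hσ0 : 0 < σ := div_pos hm0 h0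
  have hmin : action p ω γ (groundState p ω γ) ≤ action p ω γ (fun x => (σ : ℂ) * f x) := by
    refine action_groundState_le hp hω hγ hγω (hf.const_mul σ) (fun x => by simp only [he]) hx₁
      (fun x => ?_) ?_
    · simp only [norm_ofReal_mul hσ0.le]
      exact mul_le_mul_of_nonneg_left (hmax x) hσ0.le
    · rw [norm_ofReal_mul hσ0.le, hσ, div_mul_cancel₀ _ h0.ne', hm, ← Real.rpow_mul (by positivity),
        one_div_mul_cancel hp1.ne', Real.rpow_one]
  rw [action_eq, action_eq, formNormSq_const_mul ω γ hσ0.le, lpPow_const_mul p hσ0.le,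
    ← nehari_groundState hp hω hγω] at hmin
  change 1 / 2 * formNormSq ω γ (groundState p ω γ)
    - 1 / (p + 1) * formNormSq ω γ (groundState p ω γ) ≤ _ at hmin
  set GQ := formNormSq ω γ (groundState p ω γ)
  set G := formNormSq ω γ f
  set Lf := lpPow p f
  have hτ : 0 ≤ σ ^ (p + 1) * Lf := by positivity
  -- Minimality reads `((p-1)/(p+1)) N(Q) + (2/(p+1)) σ^(p+1) L(f) ≤ σ² N(f)`. The weighted
  -- geometric mean of the left-hand side also carries the factor `σ²`, so `σ` drops out.
  have hamgm := Real.geom_mean_le_arith_mean2_weighted (w₁ := (p - 1) / (p + 1))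
    (w₂ := 2 / (p + 1)) (p₁ := GQ) (p₂ := σ ^ (p + 1) * Lf) (by positivity) (by positivity)
    hGQ.le hτ (by field_simp; ring)
  have hle : GQ ^ ((p - 1) / (p + 1)) * (σ ^ (p + 1) * Lf) ^ (2 / (p + 1)) ≤ σ ^ 2 * G := by
    refine hamgm.trans ?_
    have e1 : (p - 1) / (p + 1) = 1 - 2 * (1 / (p + 1)) := by field_simp; ring
    have e2 : 2 / (p + 1) = 2 * (1 / (p + 1)) := by ring
    rw [e1, e2]
    linarith
  have hpow := Real.rpow_le_rpow (by positivity) hle (show 0 ≤ (p + 1) / 2 by positivity)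
  rw [Real.mul_rpow (by positivity) (by positivity), ← Real.rpow_mul hGQ.le, ← Real.rpow_mul hτ,
    Real.mul_rpow (by positivity) hG0, ← Real.rpow_natCast, ← Real.rpow_mul hσ0.le,
    show (p - 1) / (p + 1) * ((p + 1) / 2) = (p - 1) / 2 by field_simp,
    show 2 / (p + 1) * ((p + 1) / 2) = 1 by field_simp,
    show ((2 : ℕ) : ℝ) * ((p + 1) / 2) = p + 1 by push_cast; ring, Real.rpow_one] at hpow
  have hσp : 0 < σ ^ (p + 1) := by positivity
  refine le_of_mul_le_mul_left ?_ hσp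
  linarith

end Sharp

/-! ### Coercivity of the virial functional -/

section Coercive

variable {P q κ : ℝ}

/-- The optimal choice of the dilation parameter. -/
lemma virial_exp_ineq (hP : P < 1) {s : ℝ}
    (h : ∀ l : ℝ, 0 < l → l ^ P * Real.exp s ^ q
      ≤ 1 + q * (Real.exp s - 1) + (κ + P * Real.exp s) * (l - 1)) {σ : ℝ}
    (hσ : σ = (P - q) / (1 - P)) :
    (1 - P) * (Real.exp (-σ * s) - 1 + σ * (Real.exp s - 1))
      ≤ κ * (Real.exp (-(1 + σ) * s) - 1) := by
  have hP' : 0 < 1 - P := by linarith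
  -- With `w = exp s`, this is `l = w^(-(1+σ))`, the minimizer over `l` of the right side minus the
  -- left when `κ = 0`; there `l^P w^q = l w`.
  have h1 := h (Real.exp (-(1 + σ) * s)) (Real.exp_pos _)
  have hσ' : σ * (1 - P) = P - q := by rw [hσ]; field_simp
  have e1 : -(1 + σ) * s * P + s * q = -σ * s := by linear_combination s * hσ'
  have e2 : Real.exp s * Real.exp (-(1 + σ) * s) = Real.exp (-σ * s) := by
    rw [← Real.exp_add]
    congr 1
    ring
  rw [← Real.exp_mul, ← Real.exp_mul, ← Real.exp_add, e1] at h1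
  linear_combination h1 + P * e2 + (Real.exp s - 1) * hσ'

/-- For `s = log w < 0` the left side of `virial_exp_ineq` is at least `(1-P)σ²s²/2`, while the
factor of `κ` is `exp y - 1 ≤ y exp y` with `y = -(1+σ)s`. Division leaves a multiple of `-s ≥ 1 -
w`. The factor `exp (-y) = w^(1+σ)` is the reason for keeping `w` away from zero. -/
lemma virial_lower_near (hP : P < 1) (hqP : q < P) {w w₀ σ : ℝ} (hσ : σ = (P - q) / (1 - P))
    (hw₀ : 0 < w₀) (hw : w₀ ≤ w) (hw1 : w < 1)
    (h : ∀ l : ℝ, 0 < l → l ^ P * w ^ q ≤ 1 + q * (w - 1) + (κ + P * w) * (l - 1)) :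
    (1 - P) * σ ^ 2 / (2 * (1 + σ)) * w₀ ^ (1 + σ) * (1 - w) ≤ κ := by
  have hP' : 0 < 1 - P := by linarith
  have hσ0 : 0 < σ := by rw [hσ]; exact div_pos (by linarith) hP'
  have hwpos : 0 < w := hw₀.trans_le hw
  set s := Real.log w with hs
  have hes : Real.exp s = w := Real.exp_log hwpos
  have hs0 : s < 0 := Real.log_neg hwpos hw1
  rw [← hes] at h
  have h1 := virial_exp_ineq hP h hσ
  have h2 := Real.quadratic_le_exp_of_nonneg (x := -σ * s) (by nlinarith)
  have h3 := Real.add_one_le_exp s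
  set y := (1 + σ) * -s with hy
  have hy0 : 0 < y := by nlinarith
  have h4 : Real.exp (-(1 + σ) * s) = Real.exp y := by rw [hy]; congr 1; ring
  have h5 : Real.exp y - 1 ≤ y * Real.exp y := by
    have := Real.add_one_le_exp (-y)
    have h6 : Real.exp (-y) * Real.exp y = 1 := by rw [← Real.exp_add]; simp
    nlinarith [Real.exp_pos y]
  rw [h4] at h1
  have h7 : (1 - P) * (σ ^ 2 * s ^ 2 / 2) ≤ κ * (Real.exp y - 1) := by
    refine le_trans (mul_le_mul_of_nonneg_left ?_ hP'.le) h1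
    nlinarith
  have h8 : 0 < Real.exp y - 1 := by have := Real.add_one_le_exp y; linarith
  have hκ : 0 < κ := by
    by_contra! hk
    have : 0 < (1 - P) * (σ ^ 2 * s ^ 2 / 2) := by have := hs0.ne; positivity
    nlinarith
  have h9 : (1 - P) * (σ ^ 2 * s ^ 2 / 2) ≤ κ * (y * Real.exp y) :=
    h7.trans (mul_le_mul_of_nonneg_left h5 hκ.le)
  have h10 : w ^ (1 + σ) * Real.exp y = 1 := by
    rw [← hes, ← Real.exp_mul, ← Real.exp_add, hy]
    ring_nf
    exact Real.exp_zero
  have h11 : (1 - P) * σ ^ 2 / (2 * (1 + σ)) * w ^ (1 + σ) * (-s) ≤ κ := by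
    have h12 : (1 - P) * σ ^ 2 / (2 * (1 + σ)) * w ^ (1 + σ) * (-s) * (y * Real.exp y)
        = (1 - P) * (σ ^ 2 * s ^ 2 / 2) := by
      rw [show (1 - P) * σ ^ 2 / (2 * (1 + σ)) * w ^ (1 + σ) * (-s) * (y * Real.exp y)
        = (1 - P) * σ ^ 2 / (2 * (1 + σ)) * (-s) * y * (w ^ (1 + σ) * Real.exp y) by ring, h10, hy]
      field_simp
    have hpos : 0 < y * Real.exp y := mul_pos hy0 (Real.exp_pos _)
    rw [← h12] at h9
    exact le_of_mul_le_mul_right h9 hpos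
  refine le_trans ?_ h11
  have h13 : w₀ ^ (1 + σ) ≤ w ^ (1 + σ) := Real.rpow_le_rpow hw₀.le hw (by linarith)
  have h14 : 1 - w ≤ -s := by rw [← hes]; linarith
  have h15 : 0 ≤ 1 - w := by linarith
  gcongr

/-- For `s = log w > 0` the left side of `virial_exp_ineq` is at least `(1-P)σ(w - 1 - s)`, and the
factor of `-κ` is `d = 1 - exp(-(1+σ)s)`. If `w ≤ 2`, use `d ≤ (1+σ)s` and `w - 1 - s ≥ s²/2`; if `w
> 2`, use `d ≤ 1` and the slow growth of the logarithm. -/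
lemma virial_upper (hP : P < 1) (hqP : q < P) {w σ : ℝ} (hσ : σ = (P - q) / (1 - P))
    (hw1 : 1 < w)
    (h : ∀ l : ℝ, 0 < l → l ^ P * w ^ q ≤ 1 + q * (w - 1) + (κ + P * w) * (l - 1)) :
    κ ≤ -((1 - P) * σ / (4 * (1 + σ)) * (w - 1)) := by
  have hP' : 0 < 1 - P := by linarith
  have hσ0 : 0 < σ := by rw [hσ]; exact div_pos (by linarith) hP'
  have hwpos : 0 < w := by linarith
  set s := Real.log w with hs
  have hes : Real.exp s = w := Real.exp_log hwpos
  have hs0 : 0 < s := Real.log_pos hw1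
  rw [← hes] at h
  have h1 := virial_exp_ineq hP h hσ
  rw [hes] at h1
  have h2 := Real.quadratic_le_exp_of_nonneg hs0.le
  rw [hes] at h2
  have h3 := Real.add_one_le_exp (-σ * s)
  set d := 1 - Real.exp (-(1 + σ) * s) with hd
  have hd0 : 0 < d := by
    have : Real.exp (-(1 + σ) * s) < 1 := Real.exp_lt_one_iff.mpr (by nlinarith)
    linarith
  have hd1 : d ≤ 1 := by have := Real.exp_pos (-(1 + σ) * s); linarith
  have hd2 : d ≤ (1 + σ) * s := by have := Real.add_one_le_exp (-(1 + σ) * s); linarith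
  have h4 : (1 - P) * (σ * (w - 1 - s)) ≤ -κ * d := by
    have : -κ * d = κ * (Real.exp (-(1 + σ) * s) - 1) := by rw [hd]; ring
    rw [this]
    refine le_trans (mul_le_mul_of_nonneg_left ?_ hP'.le) h1
    linarith
  have hκ : 0 < -κ := by
    by_contra! hk
    have : 0 < (1 - P) * (σ * (w - 1 - s)) := by
      have : 0 < w - 1 - s := by nlinarith
      positivity
    nlinarith
  rcases le_or_gt w 2 with hw | hw
  · have h5 : (1 - P) * (σ * (s ^ 2 / 2)) ≤ -κ * ((1 + σ) * s) := by
      calc (1 - P) * (σ * (s ^ 2 / 2)) ≤ (1 - P) * (σ * (w - 1 - s)) := by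
            gcongr
            linarith
        _ ≤ -κ * d := h4
        _ ≤ _ := by gcongr
    have h6 : (1 - P) * σ / (2 * (1 + σ)) * s ≤ -κ := by
      have hpos : 0 < (1 + σ) * s := by positivity
      refine le_of_mul_le_mul_right ?_ hpos
      refine le_trans (le_of_eq ?_) h5
      field_simp
    have h7 : (w - 1) / 2 ≤ s := by
      have h8 := Real.one_sub_inv_le_log_of_pos hwpos
      refine le_trans ?_ h8
      rw [← sub_nonneg, show 1 - w⁻¹ - (w - 1) / 2 = (w - 1) * (2 - w) / (2 * w) by field_simp]
      exact div_nonneg (mul_nonneg (by linarith) (by linarith)) (by linarith)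
    have h9 : (1 - P) * σ / (4 * (1 + σ)) * (w - 1) = (1 - P) * σ / (2 * (1 + σ)) * ((w - 1) / 2) := by
      field_simp
      ring
    have h10 : (1 - P) * σ / (2 * (1 + σ)) * ((w - 1) / 2) ≤ (1 - P) * σ / (2 * (1 + σ)) * s := by
      gcongr
    linarith
  -- The constant comes from `log (w/2) ≤ w/2 - 1` and `log 2 < 0.7`; it makes `w - 1 - s` at least
  -- a quarter of `w - 1` for `w > 2`.
  · have h5 : s ≤ w / 2 - 0.3 := by
      have h6 : s = Real.log (w / 2) + Real.log 2 := by
        rw [Real.log_div hwpos.ne' two_ne_zero]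
        ring
      have h7 := Real.log_le_sub_one_of_pos (show 0 < w / 2 by linarith)
      have h8 := Real.log_two_lt_d9
      linarith
    have h6 : (1 - P) * σ * (0.25 * (w - 1)) ≤ -κ := by
      calc (1 - P) * σ * (0.25 * (w - 1)) ≤ (1 - P) * σ * (w - 1 - s) := by
            gcongr
            linarith
        _ ≤ -κ * d := by linarith
        _ ≤ -κ * 1 := by gcongr
        _ = -κ := mul_one _
    have h7 : (1 - P) * σ / (4 * (1 + σ)) * (w - 1) ≤ (1 - P) * σ * (0.25 * (w - 1)) := by
      have h8 : (1 - P) * σ / (4 * (1 + σ)) ≤ (1 - P) * σ / 4 := by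
        gcongr
        linarith
      have := mul_le_mul_of_nonneg_right h8 (show 0 ≤ w - 1 by linarith)
      linarith
    linarith

/-- The case `w = 1`: the line lies above `l^P` and touches it at `l = 1`, so the slopes agree. -/
lemma virial_eq_zero (h : ∀ l : ℝ, 0 < l → l ^ P ≤ 1 + (κ + P) * (l - 1)) : κ = 0 := by
  have hmin : IsLocalMin (fun l : ℝ => 1 + (κ + P) * (l - 1) - l ^ P) 1 := by
    filter_upwards [lt_mem_nhds (zero_lt_one' ℝ)] with l hl
    have := h l hl
    simp only [sub_self, mul_zero, Real.one_rpow]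
    linarith
  have hd : HasDerivAt (fun l : ℝ => 1 + (κ + P) * (l - 1) - l ^ P) (κ + P - P) 1 := by
    have h1 := ((((hasDerivAt_id (1 : ℝ)).sub_const 1).const_mul (κ + P)).const_add 1).fun_sub
      (Real.hasDerivAt_rpow_const (x := 1) (p := P) (Or.inl one_ne_zero))
    simpa using h1
  have := hmin.hasDerivAt_eq_zero hd
  linarith

/-- Quantitative consequences of the dilated sharp inequality. -/
lemma exists_coercive (hP : P < 1) (hq : 0 < q) (hqP : q < P) : ∃ c : ℝ, 0 < c ∧ ∀ w κ : ℝ,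
    (∀ l : ℝ, 0 < l → l ^ P * w ^ q ≤ 1 + q * (w - 1) + (κ + P * w) * (l - 1)) →
    1 / 2 * (P - q * (1 - w)) - P * w ≤ κ → 0 ≤ w →
      (w < 1 → c * (1 - w) ≤ κ) ∧ (1 < w → κ ≤ c * (1 - w)) ∧ (w = 1 → κ = 0) := by
  have hP' : 0 < 1 - P := by linarith
  set σ := (P - q) / (1 - P) with hσ
  have hσ0 : 0 < σ := div_pos (by linarith) hP'
  -- The direct lower bound `½(P - q(1 - w)) - P w` equals `(P - q)/4` at `w = w₀` and is larger
  -- below. It takes over for small `w`, where the optimized bound degenerates.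
  set w₀ := (P - q) / (2 * (2 * P - q)) with hw₀
  have hw₀0 : 0 < w₀ := div_pos (by linarith) (by linarith)
  set c₁ := (1 - P) * σ ^ 2 / (2 * (1 + σ)) * w₀ ^ (1 + σ)
  set c₂ := (1 - P) * σ / (4 * (1 + σ))
  have hc₁ : 0 < c₁ := by positivity
  have hc₂ : 0 < c₂ := by positivity
  have hc₃ : 0 < (P - q) / 4 := by linarith
  refine ⟨min (min c₁ c₂) ((P - q) / 4), lt_min (lt_min hc₁ hc₂) hc₃,
    fun w κ h hlow hw => ⟨fun hw1 => ?_, fun hw1 => ?_, fun hw1 => ?_⟩⟩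
  · have h0 : 0 ≤ 1 - w := by linarith
    rcases le_or_gt w₀ w with hww | hww
    · refine le_trans ?_ (virial_lower_near hP hqP hσ hw₀0 hww hw1 h)
      exact mul_le_mul_of_nonneg_right ((min_le_left _ _).trans (min_le_left _ _)) h0
    · have h1 : w * (2 * (2 * P - q)) < P - q := by
        rwa [hw₀, lt_div_iff₀ (by linarith)] at hww
      calc _ ≤ (P - q) / 4 * (1 - w) := mul_le_mul_of_nonneg_right (min_le_right _ _) h0
        _ ≤ (P - q) / 4 := mul_le_of_le_one_right hc₃.le (by linarith)
        _ ≤ κ := by nlinarith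
  · have h0 : 0 ≤ w - 1 := by linarith
    have h1 := virial_upper hP hqP hσ hw1 h
    have h2 := mul_le_mul_of_nonneg_right
      ((min_le_left (min c₁ c₂) ((P - q) / 4)).trans (min_le_right _ _)) h0
    linarith
  · subst hw1
    exact virial_eq_zero (P := P) fun l hl => by simpa using h l hl

end Coercive

/-! ### Mass-preserving dilations -/

/-- The mass-preserving dilation. -/
def dilate (l : ℝ) (f : ℝ → ℂ) (x : ℝ) : ℂ := (√l : ℂ) * f (l * x)

lemma deriv_dilate (l : ℝ) (f : ℝ → ℂ) (x : ℝ) :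
    deriv (dilate l f) x = √l * (l * deriv f (l * x)) := by
  have h : dilate l f = fun x => (√l : ℂ) * (fun y => f (l * y)) x := rfl
  rw [h, deriv_const_mul_field, deriv_comp_mul_left, Complex.real_smul]

section Dilate

variable {l : ℝ} (hl : 0 < l)

include hl

lemma norm_dilate_sq (f : ℝ → ℂ) (x : ℝ) : ‖dilate l f x‖ ^ 2 = l * ‖f (l * x)‖ ^ 2 := by
  rw [dilate, norm_ofReal_mul (Real.sqrt_nonneg l), mul_pow, Real.sq_sqrt hl.le]

lemma norm_deriv_dilate_sq (f : ℝ → ℂ) (x : ℝ) :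
    ‖deriv (dilate l f) x‖ ^ 2 = l ^ 3 * ‖deriv f (l * x)‖ ^ 2 := by
  rw [deriv_dilate, norm_ofReal_mul (Real.sqrt_nonneg l), norm_ofReal_mul hl.le, mul_pow, mul_pow,
    Real.sq_sqrt hl.le]
  ring

lemma mass_dilate (f : ℝ → ℂ) : mass (dilate l f) = mass f := by
  simp only [mass, norm_dilate_sq hl]
  rw [integral_const_mul, Measure.integral_comp_mul_left (fun x => ‖f x‖ ^ 2) l, abs_of_pos (inv_pos.mpr hl),
    smul_eq_mul, mul_inv_cancel_left₀ hl.ne']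

lemma integral_deriv_dilate (f : ℝ → ℂ) :
    ∫ x, ‖deriv (dilate l f) x‖ ^ 2 = l ^ 2 * ∫ x, ‖deriv f x‖ ^ 2 := by
  simp only [norm_deriv_dilate_sq hl]
  rw [integral_const_mul, Measure.integral_comp_mul_left (fun x => ‖deriv f x‖ ^ 2) l,
    abs_of_pos (inv_pos.mpr hl), smul_eq_mul]
  field_simp

lemma lpPow_dilate (p : ℝ) (f : ℝ → ℂ) :
    lpPow p (dilate l f) = l ^ ((p - 1) / 2) * lpPow p f := by
  have h : ∀ x, ‖dilate l f x‖ ^ (p + 1) = √l ^ (p + 1) * ‖f (l * x)‖ ^ (p + 1) := fun x => by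
    rw [dilate, norm_ofReal_mul (Real.sqrt_nonneg l), Real.mul_rpow (Real.sqrt_nonneg l)
      (norm_nonneg _)]
  simp only [lpPow, h]
  rw [integral_const_mul, Measure.integral_comp_mul_left (fun x => ‖f x‖ ^ (p + 1)) l,
    abs_of_pos (inv_pos.mpr hl), smul_eq_mul, ← mul_assoc]
  congr 1
  rw [Real.sqrt_eq_rpow, ← Real.rpow_mul hl.le, ← Real.rpow_neg_one, ← Real.rpow_add hl]
  congr 1
  ring

lemma MemH1.dilate {f : ℝ → ℂ} (hf : MemH1 f) : MemH1 (dilate l f) := by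
  have hc : Continuous (DeltaNLS.dilate l f) :=
    continuous_const.mul (hf.continuous'.comp (continuous_const.mul continuous_id))
  refine ⟨?_, ?_, fun a b => ?_⟩
  · rw [memLp_two_iff_integrable_sq_norm hc.aestronglyMeasurable]
    simp only [norm_dilate_sq hl]
    exact (hf.integrable_sq.comp_mul_left' hl.ne').const_mul l
  · rw [memLp_two_iff_integrable_sq_norm (stronglyMeasurable_deriv _).aestronglyMeasurable]
    simp only [norm_deriv_dilate_sq hl]
    exact (hf.integrable_deriv_sq.comp_mul_left' hl.ne').const_mul (l ^ 3)
  · simp only [deriv_dilate]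
    rw [intervalIntegral.integral_const_mul, intervalIntegral.integral_const_mul,
      intervalIntegral.integral_comp_mul_left (fun x => deriv f x) hl.ne', hf.integral_deriv,
      Complex.real_smul, DeltaNLS.dilate, DeltaNLS.dilate]
    have : (l : ℂ) ≠ 0 := by exact_mod_cast hl.ne'
    push_cast
    rw [mul_inv_cancel_left₀ this]
    ring

end Dilate

/-! ### From dilations to the virial functional -/

section Virial

variable {p ω γ : ℝ} (hp : 5 < p) (hω : 0 < ω) (hγ : γ < 0) (hγω : γ ^ 2 / 4 < ω)

include hp hω hγ hγω

/-- The sharp inequality for dilations, after linearization in the dilation parameter. -/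
lemma dilated_ineq {f : ℝ → ℂ} (hf : MemH1 f) (he : ∀ x, f (-x) = f x) {l : ℝ} (hl : 0 < l) :
    l ^ ((p - 1) / (2 * (p + 1))) * lpPow p f ^ (2 / (p + 1))
        * formNormSq ω γ (groundState p ω γ) ^ ((p - 1) / (p + 1))
      ≤ formNormSq ω γ f + (virial p γ f + (p - 1) / (2 * (p + 1)) * lpPow p f) * (l - 1) := by
  have hp1 : 0 < p - 1 := by linarith
  have hp2 : 0 < p + 1 := by linarith
  have hs : 0 < √l := Real.sqrt_pos.mpr hl
  have hGQ := formNormSq_groundState_pos hp hω hγ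
  have hL0 := lpPow_nonneg p f
  -- Dilating by `√l` makes the gradient term linear in `l`, while the delta term scales like `√l`.
  have h1 := lpPow_mul_le hp hω hγ hγω (hf.dilate hs) fun x => by simp [dilate, he]
  have hG0 := formNormSq_nonneg hω hγ (dilate √l f)
  have h2 : formNormSq ω γ (dilate √l f)
      ≤ formNormSq ω γ f + (virial p γ f + (p - 1) / (2 * (p + 1)) * lpPow p f) * (l - 1) := by
    have h3 : ‖dilate √l f 0‖ ^ 2 = √l * ‖f 0‖ ^ 2 := by rw [norm_dilate_sq hs, mul_zero]
    rw [formNormSq, hdotNormSq, mass_dilate hs, integral_deriv_dilate hs, h3, Real.sq_sqrt hl.le,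
      formNormSq, hdotNormSq, virial]
    -- The tangent at `l = 1` replaces the only term that is not affine in `l`; the resulting slope
    -- `‖∂ₓf‖² - (γ/2)|f(0)|²` is `K` plus a multiple of `L`.
    have h4 : √l ≤ (l + 1) / 2 := by nlinarith [sq_nonneg (√l - 1), Real.sq_sqrt hl.le]
    have h5 := mul_le_mul_of_nonneg_left h4 (show 0 ≤ -γ * ‖f 0‖ ^ 2 by
      have := sq_nonneg ‖f 0‖
      nlinarith)
    linarith
  refine le_trans ?_ h2
  rw [lpPow_dilate hs] at h1
  have h3 := Real.rpow_le_rpow (by positivity) h1 (show 0 ≤ 2 / (p + 1) by positivity)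
  rw [← Real.rpow_mul hG0, Real.mul_rpow (by positivity) (by positivity),
    Real.mul_rpow (by positivity) (by positivity), ← Real.rpow_mul hs.le, ← Real.rpow_mul hGQ.le,
    show (p + 1) / 2 * (2 / (p + 1)) = 1 by field_simp, Real.rpow_one] at h3
  have h4 : √l ^ ((p - 1) / 2 * (2 / (p + 1))) = l ^ ((p - 1) / (2 * (p + 1))) := by
    rw [Real.sqrt_eq_rpow, ← Real.rpow_mul hl.le]
    congr 1
    field_simp
  rwa [h4, show (p - 1) / 2 * (2 / (p + 1)) = (p - 1) / (p + 1) by field_simp] at h3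

/-- On the mass-energy level of the ground state, the virial functional and `μ` have the same
sign, and the former controls the latter. -/
lemma exists_virial_coercive : ∃ c : ℝ, 0 < c ∧ ∀ f : ℝ → ℂ, MemH1 f → (∀ x, f (-x) = f x) →
    MassEnergy p ω γ f →
      (0 < mu p ω γ f → c * mu p ω γ f ≤ virial p γ f) ∧
      (mu p ω γ f < 0 → virial p γ f ≤ c * mu p ω γ f) ∧
      (mu p ω γ f = 0 → virial p γ f = 0) := by
  have hp1 : 0 < p - 1 := by linarith
  have hp2 : 0 < p + 1 := by linarith
  set P := (p - 1) / (2 * (p + 1)) with hP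
  set q := 2 / (p + 1) with hq
  have hq0 : 0 < q := by positivity
  have hPq : P = 1 / 2 - q / 2 := by rw [hP, hq]; field_simp; ring
  -- Since `P = (1 - q)/2`, this is equivalent to `q < P`, and it expresses `p > 5`.
  have hq3 : q < 1 / 3 := by rw [hq, div_lt_iff₀ hp2]; linarith
  obtain ⟨c, hc, H⟩ := exists_coercive (P := P) (q := q) (by linarith) hq0 (by linarith)
  refine ⟨c / q, by positivity, fun f hf he hME => ?_⟩
  have hGQ := formNormSq_groundState_pos hp hω hγ
  have hN : formNormSq ω γ (groundState p ω γ) = lpPow p (groundState p ω γ) :=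
    nehari_groundState hp hω hγω
  have hK := virial_groundState hp hω hγω
  have hL0 := lpPow_nonneg p f
  obtain ⟨hM, hE⟩ := hME
  set GQ := formNormSq ω γ (groundState p ω γ) with hGQdef
  set w := lpPow p f / GQ with hw
  set κ := virial p γ f / GQ with hκ
  have hLw : lpPow p f = GQ * w := by rw [hw]; field_simp
  have hKκ : virial p γ f = GQ * κ := by rw [hκ]; field_simp
  have hw0 : 0 ≤ w := by positivity
  have hq' : 1 / (p + 1) = q / 2 := by rw [hq]; ring
  have hd : hdotNormSq γ f = hdotNormSq γ (groundState p ω γ) + q * (GQ * w - GQ) := by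
    rw [energy, energy, ← hN, hLw, hq'] at hE
    linarith
  have hmu : mu p ω γ f = GQ * q * (1 - w) := by rw [mu, hd]; ring
  have hG : formNormSq ω γ f = GQ + q * (GQ * w - GQ) := by
    rw [formNormSq, hd, hM, hGQdef, formNormSq]
    ring
  have hdil : ∀ l : ℝ, 0 < l → l ^ P * w ^ q ≤ 1 + q * (w - 1) + (κ + P * w) * (l - 1) := by
    intro l hl
    have h1 := dilated_ineq hp hω hγ hγω hf he hl
    rw [← hP, ← hq, ← hGQdef, show (p - 1) / (p + 1) = 1 - q by rw [hq]; field_simp; ring, hG, hLw,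
      hKκ, Real.mul_rpow hGQ.le hw0] at h1
    have h2 : GQ ^ q * GQ ^ (1 - q) = GQ := by
      rw [← Real.rpow_add hGQ]
      simp
    refine le_of_mul_le_mul_left ?_ hGQ
    linear_combination h1 - (l ^ P * w ^ q) * h2
  -- Dropping half of the gradient term gives `K(f) ≥ ½‖f‖²_{Ḣ¹_γ} - P L(f)`, and `K(Q) = 0` gives
  -- `‖Q‖²_{Ḣ¹_γ} ≥ P N(Q)`.
  have hlow : 1 / 2 * (P - q * (1 - w)) - P * w ≤ κ := by
    refine le_of_mul_le_mul_left ?_ hGQ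
    have h0 := sq_nonneg ‖f 0‖
    have hQ0 := sq_nonneg ‖groundState p ω γ 0‖
    have hAQ : 0 ≤ ∫ x, ‖deriv (groundState p ω γ) x‖ ^ 2 := integral_nonneg fun _ => sq_nonneg _
    have hAf : 0 ≤ ∫ x, ‖deriv f x‖ ^ 2 := integral_nonneg fun _ => sq_nonneg _
    rw [virial, ← hN, ← hP] at hK
    rw [virial, hLw, ← hP] at hKκ
    rw [hdotNormSq, hdotNormSq] at hd
    nlinarith
  obtain ⟨h1, h2, h3⟩ := H w κ hdil hlow hw0
  have hGq : 0 < GQ * q := mul_pos hGQ hq0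
  have hcm : c / q * mu p ω γ f = GQ * (c * (1 - w)) := by rw [hmu]; field_simp
  rw [hcm, hKκ]
  refine ⟨fun hm => ?_, fun hm => ?_, fun hm => ?_⟩
  · refine mul_le_mul_of_nonneg_left (h1 ?_) hGQ.le
    rw [hmu] at hm
    have := pos_of_mul_pos_right hm hGq.le
    linarith
  · refine mul_le_mul_of_nonneg_left (h2 ?_) hGQ.le
    rw [hmu] at hm
    by_contra! hcon
    nlinarith
  · rw [hmu] at hm
    have := (mul_eq_zero.mp hm).resolve_left hGq.ne'
    rw [h3 (by linarith), mul_zero]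

end Virial

/-! ### Optimizers are standing waves -/

lemma hasDerivAt_zero_of_quadratic {F : ℝ → ℝ} {d C : ℝ}
    (h : ∀ ε : ℝ, |ε| ≤ 1 → |F ε - F 0 - ε * d| ≤ C * ε ^ 2) : HasDerivAt F d 0 := by
  rw [hasDerivAt_iff_isLittleO_nhds_zero]
  refine Asymptotics.IsBigO.trans_isLittleO (g := fun ε : ℝ => ε ^ 2)
    (Asymptotics.IsBigO.of_bound C ?_) (Asymptotics.isLittleO_pow_id one_lt_two)
  filter_upwards [Metric.closedBall_mem_nhds (0 : ℝ) one_pos] with ε hε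
  rw [mem_closedBall_zero_iff, Real.norm_eq_abs] at hε
  simpa using h ε hε

namespace EnergySpace

variable {γ p ω : ℝ}

lemma formNormSq_eq (hγ : γ < 0) (f : EnergySpace γ) :
    formNormSq ω γ f = ‖f‖ ^ 2 + (ω - 1) * ‖toL2 f‖ ^ 2 := by
  rw [formNormSq, hdotNormSq_eq hγ, norm_toL2_sq]
  ring

lemma formNormSq_add_smul (hγ : γ < 0) (f φ : EnergySpace γ) (ε : ℝ) :
    formNormSq ω γ (f + (ε : ℂ) • φ : EnergySpace γ) = formNormSq ω γ f
      + ε * (2 * (inner ℂ (f + (ω - 1 : ℂ) • resolvent f) φ).re) + ε ^ 2 * formNormSq ω γ φ := by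
  have h1 : inner ℂ (toL2 f) (toL2 φ) = inner ℂ (resolvent f) φ := by
    rw [inner_toL2, inner_resolvent_left]
  have h2 : conj (ω - 1 : ℂ) = ((ω - 1 : ℝ) : ℂ) := by
    rw [← Complex.ofReal_one, ← Complex.ofReal_sub, Complex.conj_ofReal]
  rw [formNormSq_eq hγ, formNormSq_eq hγ, formNormSq_eq hγ, map_add, map_smul,
    norm_add_sq (𝕜 := ℂ), norm_add_sq (𝕜 := ℂ), inner_smul_right, inner_smul_right, h1, norm_smul,
    norm_smul, inner_add_left, inner_smul_left, h2, RCLike.re_eq_complex_re, Complex.add_re,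
    Complex.re_ofReal_mul, Complex.re_ofReal_mul, Complex.re_ofReal_mul, Complex.norm_real,
    Real.norm_eq_abs, mul_pow, mul_pow, sq_abs]
  ring

lemma hasDerivAt_lpPow_add_smul (hp : 5 < p) (f φ : EnergySpace γ) :
    HasDerivAt (fun ε : ℝ => lpPow p (f + (ε : ℂ) • φ : EnergySpace γ))
      ((p + 1) * (inner ℂ (resolvent (nonlinMap hp f)) φ).re) 0 := by
  obtain ⟨C, -, hC⟩ := lpPow_expansion (γ := γ) hp (‖f‖ + ‖φ‖)
  refine hasDerivAt_zero_of_quadratic (C := C * mass φ) fun ε hε => ?_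
  have hn : ‖(ε : ℂ) • φ‖ ≤ ‖φ‖ := by
    rw [norm_smul, Complex.norm_real, Real.norm_eq_abs]
    exact mul_le_of_le_one_left (norm_nonneg _) hε
  have h := hC f (f + (ε : ℂ) • φ) (by linarith [norm_nonneg φ])
    ((norm_add_le _ _).trans (by linarith))
  have h0 : f + ((0 : ℝ) : ℂ) • φ = f := by simp
  have hm : mass ((ε : ℂ) • φ : EnergySpace γ) = ε ^ 2 * mass φ := by
    rw [← norm_toL2_sq, map_smul, norm_smul, Complex.norm_real, Real.norm_eq_abs, mul_pow, sq_abs,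
      norm_toL2_sq]
  have hi : (inner ℂ (resolvent ((ε : ℂ) • φ)) (nonlinMap hp f)).re
      = ε * (inner ℂ (resolvent (nonlinMap hp f)) φ).re := by
    rw [map_smul, inner_smul_left, Complex.conj_ofReal, Complex.re_ofReal_mul, ← inner_conj_symm,
      Complex.conj_re, inner_resolvent_right, inner_resolvent_left]
  rw [add_sub_cancel_left, hm, hi] at h
  rw [h0]
  calc _ = |lpPow p (f + (ε : ℂ) • φ : EnergySpace γ) - lpPow p f
        - (p + 1) * (ε * (inner ℂ (resolvent (nonlinMap hp f)) φ).re)| := by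
          congr 1
          ring
    _ ≤ _ := h
    _ = _ := by ring

/-- An even optimizer of the sharp inequality, suitably normalized, solves the equation of the
ground state. -/
lemma eq_of_optimizer (hp : 5 < p) (hω : 0 < ω) (hγ : γ < 0) (hγω : γ ^ 2 / 4 < ω)
    {f : EnergySpace γ} (he : ∀ x, f (-x) = f x)
    (hG : formNormSq ω γ f = formNormSq ω γ (groundState p ω γ))
    (hL : lpPow p f = formNormSq ω γ (groundState p ω γ)) :
    f + (ω - 1 : ℂ) • resolvent f = resolvent (nonlinMap hp f) := by
  have hp1 : 0 < p + 1 := by linarith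
  have hGQ := formNormSq_groundState_pos hp hω hγ
  set GQ := formNormSq ω γ (groundState p ω γ) with hGQdef
  -- `Z` is the gradient of the action at `f` in the energy space. It is even, hence an admissible
  -- direction in an inequality that is restricted to even functions.
  set Z := f + (ω - 1 : ℂ) • resolvent f - resolvent (nonlinMap hp f) with hZ
  have hfr : reflect f = f := by
    ext x
    exact he x
  have hZe : ∀ x, Z (-x) = Z x := by
    have h1 : reflect (resolvent f) = resolvent f := by rw [← resolvent_reflect, hfr]
    have h2 : reflect (nonlinMap hp f) = nonlinMap hp f := by
      ext x
      simp [he]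
    have h3 : reflect Z = Z := by
      rw [hZ, map_sub, map_add, map_smul, ← resolvent_reflect (nonlinMap hp f), h2, h1, hfr]
    exact fun x => congrArg (fun g : EnergySpace γ => g x) h3
  set a := 2 * (inner ℂ (f + (ω - 1 : ℂ) • resolvent f) Z).re with ha
  have h0 : f + ((0 : ℝ) : ℂ) • Z = f := by simp
  have hdG : HasDerivAt (fun ε : ℝ => formNormSq ω γ (f + (ε : ℂ) • Z : EnergySpace γ)) a 0 := by
    refine hasDerivAt_zero_of_quadratic (C := |formNormSq ω γ Z|) fun ε _ => ?_
    rw [h0, formNormSq_add_smul hγ, ← ha, add_sub_right_comm, add_sub_cancel_left, add_sub_cancel_left,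
      abs_mul, abs_of_nonneg (sq_nonneg ε), mul_comm]
  have hdL := (hasDerivAt_lpPow_add_smul hp f Z).mul_const (GQ ^ ((p - 1) / 2))
  have hd := (hdG.rpow_const (p := (p + 1) / 2) (Or.inl (by rw [h0, hG]; exact hGQ.ne'))).fun_sub hdL
  have hmin : IsLocalMin (fun ε : ℝ => formNormSq ω γ (f + (ε : ℂ) • Z : EnergySpace γ)
      ^ ((p + 1) / 2) - lpPow p (f + (ε : ℂ) • Z : EnergySpace γ) * GQ ^ ((p - 1) / 2)) 0 := by
    refine Eventually.of_forall fun ε => ?_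
    have h1 := lpPow_mul_le hp hω hγ hγω (f + (ε : ℂ) • Z : EnergySpace γ).memH1
      fun x => by rw [add_apply, add_apply, smul_apply, smul_apply, he, hZe]
    beta_reduce
    rw [h0, hG, hL]
    have h2 : GQ ^ ((p + 1) / 2) = GQ * GQ ^ ((p - 1) / 2) := by
      rw [← Real.rpow_one_add' hGQ.le (by linarith)]
      congr 1
      ring
    rw [h2, sub_self]
    linarith
  have hz := hmin.hasDerivAt_eq_zero hd
  rw [h0, hG, show (p + 1) / 2 - 1 = (p - 1) / 2 by ring] at hz
  have hpow : 0 < GQ ^ ((p - 1) / 2) := by positivity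
  -- With the normalization `N(f) = L(f) = N(Q)`, the derivative in the direction `Z` is `(p+1)
  -- N(Q)^((p-1)/2) ‖Z‖²`.
  have hin : (inner ℂ Z Z).re = 0 := by
    have h3 : (inner ℂ Z Z).re = (inner ℂ (f + (ω - 1 : ℂ) • resolvent f) Z).re
        - (inner ℂ (resolvent (nonlinMap hp f)) Z).re := by
      conv_lhs => rw [hZ, inner_sub_left, ← hZ, Complex.sub_re]
    rw [h3]
    have h4 : (p + 1) * GQ ^ ((p - 1) / 2) ≠ 0 := by positivity
    refine mul_left_cancel₀ h4 ?_
    linear_combination hz - (p + 1) / 2 * GQ ^ ((p - 1) / 2) * ha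
  have hZ0 : Z = 0 := by
    rw [← norm_eq_zero, ← sq_eq_zero_iff, ← inner_self_eq_norm_sq (𝕜 := ℂ)]
    exact hin
  exact sub_eq_zero.mp hZ0

lemma virial_smul {c : ℂ} (hc : ‖c‖ = 1) (f : EnergySpace γ) :
    virial p γ (c • f : EnergySpace γ) = virial p γ f := by
  have h1 : ((c • f : EnergySpace γ) : ℝ → ℂ) = fun x => c * f x := rfl
  have h2 : ∀ x, deriv (fun x => c * f x) x = c * deriv f x := fun x => deriv_const_mul_field c
  rw [h1]
  simp only [virial, lpPow, h2, norm_mul, hc, one_mul]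

/-- Along an even flow on the mass-energy level of the ground state, `μ` vanishes only if the
virial functional vanishes identically. -/
lemma IsFlow.virial_eq_zero {hp : 5 < p} (hω : 0 < ω) (hγ : γ < 0) (hγω : γ ^ 2 / 4 < ω)
    {I : Set ℝ} (hI : IsOpen I) (hI' : I.OrdConnected) {u : ℝ → EnergySpace γ}
    (hu : IsFlow hp I u) {s t : ℝ} (hs : s ∈ I) (ht : t ∈ I) (he : ∀ x, u t (-x) = u t x)
    (hME : MassEnergy p ω γ (u t)) (hmu : mu p ω γ (u t) = 0) : virial p γ (u s) = 0 := by
  have hN : formNormSq ω γ (groundState p ω γ) = lpPow p (groundState p ω γ) :=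
    nehari_groundState hp hω hγω
  obtain ⟨hM, hE⟩ := hME
  have hd : hdotNormSq γ (u t) = hdotNormSq γ (groundState p ω γ) := (sub_eq_zero.mp hmu).symm
  have hG : formNormSq ω γ (u t) = formNormSq ω γ (groundState p ω γ) := by
    rw [formNormSq, formNormSq, hd, hM]
  have hL : lpPow p (u t) = formNormSq ω γ (groundState p ω γ) := by
    rw [energy, energy, hd, ← hN] at hE
    have hp1 : 1 / (p + 1) ≠ 0 := one_div_ne_zero (by linarith)
    exact mul_left_cancel₀ hp1 (sub_right_injective hE)
  have heq := eq_of_optimizer hp hω hγ hγω he hG hL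
  -- The standing wave through `u t` coincides with `u` by uniqueness. As `K` ignores phases, its
  -- value at `s` is that at `t`, which is zero by the borderline case of `exists_virial_coercive`.
  have hw := (isFlow_standingWave (t₀ := t) heq).mono (Set.subset_univ I)
  have h1 := hu.eqOn hI hI' hw ht (by simp) hs
  obtain ⟨c, hc, H⟩ := exists_virial_coercive hp hω hγ hγω
  rw [h1, virial_smul (norm_exp_I_mul _)]
  exact (H _ (u t).memH1 he ⟨hM, hE⟩).2.2 hmu

/-- The sign of `μ` is constant along a flow along which `μ` does not vanish. -/
lemma IsFlow.mu_pos {hp : 5 < p} (hγ : γ < 0) {I : Set ℝ}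
    (hI' : I.OrdConnected) {u : ℝ → EnergySpace γ} (hu : IsFlow hp I u)
    (h0 : ∀ t ∈ I, mu p ω γ (u t) ≠ 0) {s t : ℝ} (hs : s ∈ I) (ht : t ∈ I)
    (hpos : 0 < mu p ω γ (u s)) : 0 < mu p ω γ (u t) := by
  have hc : ContinuousOn (fun t => mu p ω γ (u t)) I := by
    have h1 : (fun t => mu p ω γ (u t))
        = fun t => hdotNormSq γ (groundState p ω γ) - (‖u t‖ ^ 2 - ‖toL2 (u t)‖ ^ 2) := by
      funext t
      rw [mu, hdotNormSq_eq hγ (u t), norm_toL2_sq]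
    rw [h1]
    exact continuousOn_const.sub ((hu.continuousOn.norm.pow 2).sub
      ((toL2.continuous.comp_continuousOn hu.continuousOn).norm.pow 2))
  by_contra! hneg
  obtain ⟨r, hr, hr0⟩ := (isPreconnected_iff_ordConnected.mpr hI').intermediate_value ht hs hc
    ⟨hneg, hpos.le⟩
  exact h0 r hr hr0

end EnergySpace

/-! ### Conserved quantities and the sign of `μ` along solutions -/

section Conclusion

variable {p ω γ : ℝ} (hp : 5 < p) (hω : 0 < ω) (hγ : γ < 0) (hγω : γ ^ 2 / 4 < ω) {u₀ : ℝ → ℂ}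
  (hu₀ : MemH1Even u₀) (hME : MassEnergy p ω γ u₀) {I : Set ℝ} {u : ℝ → ℝ → ℂ}
  (hu : IsSolution p γ u₀ I u)

include hp hγ hu₀ hME hu

/-- Evenness, mass and energy are conserved by solutions. -/
lemma IsSolution.even_massEnergy {t : ℝ} (ht : t ∈ I) :
    (∀ x, u t (-x) = u t x) ∧ MassEnergy p ω γ (u t) := by
  have hfl : EnergySpace.IsFlow hp I fun t => (EnergySpace.lift (u t) : EnergySpace γ) :=
    EnergySpace.isFlow_lift hγ hu
  have hm := hfl.mass_eq hu.isOpen hu.ordConnected ht hu.zero_mem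
  have hE := hfl.energy_eq hγ hu.isOpen hu.ordConnected ht hu.zero_mem
  have he := hfl.even hu.isOpen hu.ordConnected hu.zero_mem (t := t)
  simp only [EnergySpace.coe_lift (hu.memH1 t ht), EnergySpace.coe_lift hu₀.1,
    hu.initial] at hm hE he
  exact ⟨he hu₀.2 ht, hm.trans hME.1, hE.trans hME.2⟩

include hω hγω

lemma IsSolution.mu_ne_zero (hK : virial p γ u₀ ≠ 0) {t : ℝ} (ht : t ∈ I) :
    mu p ω γ (u t) ≠ 0 := by
  intro h
  have hfl : EnergySpace.IsFlow hp I fun t => (EnergySpace.lift (u t) : EnergySpace γ) :=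
    EnergySpace.isFlow_lift hγ hu
  obtain ⟨he, hme⟩ := hu.even_massEnergy hp hγ hu₀ hME ht
  have h1 := hfl.virial_eq_zero (ω := ω) hω hγ hγω hu.isOpen hu.ordConnected hu.zero_mem ht
  simp only [EnergySpace.coe_lift (hu.memH1 t ht), EnergySpace.coe_lift hu₀.1,
    hu.initial] at h1
  exact hK (h1 he hme h)

lemma IsSolution.mu_pos (hK : virial p γ u₀ ≠ 0) {s t : ℝ} (hs : s ∈ I) (ht : t ∈ I)
    (hpos : 0 < mu p ω γ (u s)) : 0 < mu p ω γ (u t) := by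
  have hfl : EnergySpace.IsFlow hp I fun t => (EnergySpace.lift (u t) : EnergySpace γ) :=
    EnergySpace.isFlow_lift hγ hu
  have h := hfl.mu_pos (ω := ω) hγ hu.ordConnected (fun r hr => by
    rw [EnergySpace.coe_lift (hu.memH1 r hr)]
    exact hu.mu_ne_zero hp hω hγ hγω hu₀ hME hK hr) hs ht
  rw [EnergySpace.coe_lift (hu.memH1 s hs), EnergySpace.coe_lift (hu.memH1 t ht)] at h
  exact h hpos

end Conclusion

/-- A maximal solution on the mass level of the ground state with positive `μ` is global. -/
lemma IsMaximalSolution.eq_univ {p ω γ : ℝ} (hp : 5 < p) (hγ : γ < 0) {u₀ : ℝ → ℂ} {I : Set ℝ}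
    {u : ℝ → ℝ → ℂ} (hu : IsMaximalSolution p γ u₀ I u)
    (hM : ∀ t ∈ I, mass (u t) = mass (groundState p ω γ)) (hmu : ∀ t ∈ I, 0 < mu p ω γ (u t)) :
    I = Set.univ := by
  refine EnergySpace.eq_univ_of_bounded hp hγ hu
    (ρ := √(hdotNormSq γ (groundState p ω γ) + mass (groundState p ω γ))) fun t ht => ?_
  refine Real.le_sqrt_of_sq_le ?_
  have h1 := EnergySpace.hdotNormSq_eq hγ (EnergySpace.lift (u t))
  have h2 := hmu t ht
  rw [EnergySpace.coe_lift (hu.1.memH1 t ht), hM t ht] at h1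
  rw [mu] at h2
  linarith

end DeltaNLS

end

theorem proposition2p7 (p γ ω : ℝ) (hp : 5 < p) (hγ : γ < 0) (hω : γ ^ 2 / 4 < ω)
    (u₀ : ℝ → ℂ) (hu₀ : DeltaNLS.MemH1Even u₀) (hME : DeltaNLS.MassEnergy p ω γ u₀) :
    (0 < DeltaNLS.virial p γ u₀ →
      ∃ c : ℝ, 0 < c ∧ ∀ (I : Set ℝ) (u : ℝ → ℝ → ℂ),
        DeltaNLS.IsMaximalSolution p γ u₀ I u →
          I = Set.univ ∧
          ∀ t : ℝ, c * DeltaNLS.mu p ω γ (u t) ≤ DeltaNLS.virial p γ (u t) ∧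
            0 < c * DeltaNLS.mu p ω γ (u t)) ∧
    (DeltaNLS.virial p γ u₀ < 0 →
      ∃ c : ℝ, 0 < c ∧ ∀ (I : Set ℝ) (u : ℝ → ℝ → ℂ),
        DeltaNLS.IsMaximalSolution p γ u₀ I u →
          ∀ t ∈ I, DeltaNLS.virial p γ (u t) ≤ c * DeltaNLS.mu p ω γ (u t) ∧
            c * DeltaNLS.mu p ω γ (u t) < 0) := by
  have hω0 : 0 < ω := lt_of_le_of_lt (by positivity) hω
  -- The constant is fixed by `p`, `γ` and `ω` before any datum or solution is considered.
  obtain ⟨c, hc, H⟩ := DeltaNLS.exists_virial_coercive hp hω0 hγ hω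
  obtain ⟨h1, h2, h3⟩ := H u₀ hu₀.1 hu₀.2 hME
  refine ⟨fun hK => ⟨c, hc, fun I u hu => ?_⟩, fun hK => ⟨c, hc, fun I u hu t ht => ?_⟩⟩
  · have hpos₀ : 0 < DeltaNLS.mu p ω γ u₀ := by
      rcases lt_trichotomy (DeltaNLS.mu p ω γ u₀) 0 with h | h | h
      · linarith [h2 h, mul_neg_of_pos_of_neg hc h]
      · linarith [h3 h]
      · exact h
    have hpos : ∀ t ∈ I, 0 < DeltaNLS.mu p ω γ (u t) := fun t ht =>
      hu.1.mu_pos hp hω0 hγ hω hu₀ hME hK.ne' hu.1.zero_mem ht (by rwa [hu.1.initial])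
    have hI : I = Set.univ := hu.eq_univ hp hγ
      (fun t ht => (hu.1.even_massEnergy hp hγ hu₀ hME ht).2.1) hpos
    refine ⟨hI, fun t => ?_⟩
    have ht : t ∈ I := hI ▸ Set.mem_univ t
    obtain ⟨he, hme⟩ := hu.1.even_massEnergy hp hγ hu₀ hME ht
    exact ⟨(H (u t) (hu.1.memH1 t ht) he hme).1 (hpos t ht), mul_pos hc (hpos t ht)⟩
  · have hneg₀ : DeltaNLS.mu p ω γ u₀ < 0 := by
      rcases lt_trichotomy (DeltaNLS.mu p ω γ u₀) 0 with h | h | h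
      · exact h
      · linarith [h3 h]
      · linarith [h1 h, mul_pos hc h]
    have hneg : DeltaNLS.mu p ω γ (u t) < 0 := by
      refine (hu.1.mu_ne_zero hp hω0 hγ hω hu₀ hME hK.ne ht).lt_of_le (not_lt.mp fun h => ?_)
      have := hu.1.mu_pos hp hω0 hγ hω hu₀ hME hK.ne ht hu.1.zero_mem h
      rw [hu.1.initial] at this
      linarith
    obtain ⟨he, hme⟩ := hu.1.even_massEnergy hp hγ hu₀ hME ht
    exact ⟨(H (u t) (hu.1.memH1 t ht) he hme).2.1 hneg, mul_neg_of_pos_of_neg hc hneg⟩
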